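/- Let $k$ be a commutative ring, $A$ an associative unital $k$-algebra, $K\subseteq A$ a $k$-subalgebra (not necessarily commutative), $M$ an $A$-bimodule (on which $k$ acts centrally) and $\triangledown\colon M\otimes_A M\to M$ an associative $A$-bimodule map. Let $E=A\ltimes_\triangledown M$ be the cleft extension, i.e. $A\times M$ with $(a,m)(a',m')=(aa',\,am'+ma'+m\triangledown m')$. **Notation.** Write $\otimes=\otimes_K$, $\overline C=C/K$, and $V\otimes=V/[V,K]$ for a $K$-bimodule $V$. A *mixed complex* $(X,b,B)$ is a graded $k$-module with $b$ of degree $-1$, $B$ of degree $+1$ and $b^2=B^2=bB+Bb=0$. Its Hochschild homology is that of $(X,b)$; its periodic, negative and cyclic homologies are those of the complexes with degree $n$ part $\prod_p X_{n-2p}u^p$, the product over all $p\in\mathbb Z$, over $p\le 0$, and over $p\ge 0$ respectively, and differential $xu^p\mapsto b(x)u^p+B(x)u^{p-1}$ (with $u^{-1}=0$ in the cyclic case). A *double mixed complex* $(X,b,\beta,B)$ is a bigraded $k$-module with $b$ of bidegree $(-1,0)$, $\beta$ of bidegree $(0,-1)$, $B$ of bidegree $(1,0)$, all squaring to zero and pairwise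 anticommuting; its total mixed complex has degree $n$ part $\prod_p X_{p,n-p}$ and operators $b+\beta$ and $B$, and its homologies are those of the total mixed complex. Morphisms are degree-preserving families of linear maps commuting with all operators. The homologies of the $K$-algebra $E$ *relative to $M$* are those of the mixed complex $$(\breve{\mathfrak X},\breve{\mathfrak b},\breve{\mathfrak B})=\ker\bigl((E\otimes\overline E^{\otimes *}\otimes,b,B)\to(A\otimes\overline A^{\otimes *}\otimes,b,B)\bigr),$$ where $b$ is the Hochschild boundary and $B(x_0\otimes\cdots\otimes x_n)=\sum_{i=0}^n(-1)^{in}\,1\otimes x_i\otimes\cdots\otimes x_n\otimes x_0\otimes\cdots\otimes x_{i-1}$. Let $B^n_w\subseteq\overline E^{\otimes n}$ be the span of the simple tensors with exactly $w$ factors in $M$ and the others in $\overline A$. In what follows $n=v+w$, $X_{vw}=M\otimes B^n_w\otimes$ for $v,w\ge 0$ and $X_{vw}=0$ otherwise. Let $\pi_A,\pi_M$ be the projections of $E=A\oplus M$. Extend $\triangledown$ to $E$ by $0$ on $A\times E$ and $E\times A$, and let $xy$ denote the product of $A$, resp. the actions of $A$ on $M$, with $xy=0$ for $x,y\in M$.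 On $x_0\otimes\cdots\otimes x_n$ put $\mu_j=(-1)^j x_0\otimes\cdots\otimes x_jx_{j+1}\otimes\cdots\otimes x_n$ for $j<n$ and $\mu_n=(-1)^n x_nx_0\otimes x_1\otimes\cdots\otimes x_{n-1}$; let $\varrho_j$ be given by the same formulas with $\triangledown$ in place of the product, and let $\mu_j^A,\mu_j^M$ for $j\in\{0,n\}$ be obtained from $\mu_j$ by applying $\pi_A,\pi_M$ to the $0$-th factor. For a tensor with all $x_j\in A\cup M$, not all in $A$, let $i(x)$ be the last index with $x_i\in M$, and $$t(x_0\otimes\cdots\otimes x_n)=(-1)^{in}x_i\otimes\cdots\otimes x_n\otimes x_0\otimes\cdots\otimes x_{i-1}\quad(i=i(x)).$$ Put $b=\sum_{j=0}^n\mu_j$, $d'=\sum_{j=0}^{n-1}\varrho_j$, $d=d'+\varrho_n$, and $N=\sum_{l=0}^w t^l$ on $X_{vw}$ (for $n=0$: $b=d=d'=0$). Let $\hat X_{vw}=X_{vw}\oplus X_{v-1,w}$ with $$\hat b(x,y)=(b(x)+(1-t)(y),-b(y)),\quad \hat d(x,y)=(d(x),-d'(y)),\quad \hat B(x,y)=(0,N(x)).$$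 Let $\hat{\mathfrak X}_{vw}=(M\otimes B^n_w\otimes)\oplus(A\otimes B^n_{w+1}\otimes)$ for $v,w\ge0$ (and $0$ otherwise) with $$\hat{\mathfrak b}(x,y)=\Bigl(b(x)+\mu_0^M(y)+\mu_n^M(y),\ \mu_0^A(y)+\sum_{j=1}^{n-1}\mu_j(y)+\mu_n^A(y)\Bigr),\quad \hat{\mathfrak d}(x,y)=\sum_{j=0}^n(\varrho_j(x),\varrho_j(y)),\quad \hat{\mathfrak B}(x,y)=(0,B(x)+B(y)).$$ Finally let $\hat\theta\colon\hat{\mathfrak X}_{vw}\to\hat X_{vw}$ and $\hat\vartheta\colon\hat X_{vw}\to\hat{\mathfrak X}_{vw}$ be $$\hat\theta(x,y)=(x+t(y),\mu_0^M(y)),\qquad \hat\vartheta(x,y)=\Bigl(x,\ \sum_{l=0}^{n-1-i(y)}1\otimes\mathfrak t^l(y)\Bigr),$$ where $\mathfrak t(y_0\otimes\cdots\otimes y_{n-1})=(-1)^{n-1}y_{n-1}\otimes y_0\otimes\cdots\otimes y_{n-2}$. **Theorem.** 1. $(\hat X,\hat b,\hat d,\hat B)$ is a double mixed complex. 2. $(\hat{\mathfrak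 X},\hat{\mathfrak b},\hat{\mathfrak d},\hat{\mathfrak B})$ is a double mixed complex, and the sum of components identifies its total mixed complex with $(\breve{\mathfrak X},\breve{\mathfrak b},\breve{\mathfrak B})$. The maps $\hat\vartheta$ and $\hat\theta$ are morphisms of double mixed complexes with $\hat\theta\circ\hat\vartheta=\mathrm{id}$, and if $\breve\vartheta,\breve\theta$ denote the induced morphisms between the total complexes of $(\hat X,\hat b,\hat d)$ and $(\hat{\mathfrak X},\hat{\mathfrak b},\hat{\mathfrak d})$, then $\breve\vartheta\circ\breve\theta$ is homotopic to the identity. 3. The Hochschild, cyclic, periodic and negative homologies of $(\hat X,\hat b,\hat d,\hat B)$ are those of the $K$-algebra $E$ relative to $M$; the morphism induced by $\hat\vartheta$ gives the isomorphisms. -/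

import Mathlib

open CategoryTheory

universe u v w w'

namespace CleftHomology

noncomputable section

/-! ### Graded objects and chain complexes

Throughout, a (bi)graded module is a family of submodules of one ambient module `V`, and a
homogeneous operator is a family, indexed by the degree of the source, of linear maps of `V`, of
which only the restrictions to the homogeneous parts matter. -/

section Chains

variable {k : Type u} [CommRing k] {V : Type w} [AddCommGroup V] [Module k V]
  {V' : Type w} [AddCommGroup V'] [Module k V']

/-- The restrictions `d n : X n → X (n - 1)` are well defined and form a chain complex. -/
structure IsChain (X : ℤ → Submodule k V) (d : ℤ → V →ₗ[k] V) : Prop where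
  mem : ∀ {n m : ℤ}, m + 1 = n → ∀ x ∈ X n, d n x ∈ X m
  sq : ∀ {n m : ℤ}, m + 1 = n → ∀ x ∈ X n, d m (d n x) = 0

/-- The chain complex `(X, d)` of `k`-modules. -/
def chainComplex (X : ℤ → Submodule k V) (d : ℤ → V →ₗ[k] V) (h : IsChain X d) :
    ChainComplex (ModuleCat.{w} k) ℤ where
  X n := ModuleCat.of k (X n)
  d i j :=
    if hij : j + 1 = i then ModuleCat.ofHom ((d i).restrict (p := X i) (q := X j) (h.mem hij)) else 0
  shape i j hij := dif_neg hij
  d_comp_d' i j l hij hjl := by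
    have hij' : j + 1 = i := hij
    have hjl' : l + 1 = j := hjl
    rw [dif_pos hij', dif_pos hjl']
    refine ModuleCat.hom_ext (LinearMap.ext fun x => ?_)
    exact Subtype.ext (h.sq hij' x.1 x.2)

/-- The restrictions `f n : X n → X' n` are well defined and form a chain map. -/
structure IsChainMap (X : ℤ → Submodule k V) (d : ℤ → V →ₗ[k] V)
    (X' : ℤ → Submodule k V') (d' : ℤ → V' →ₗ[k] V') (f : ℤ → V →ₗ[k] V') : Prop where
  mem : ∀ n : ℤ, ∀ x ∈ X n, f n x ∈ X' n
  comm : ∀ {n m : ℤ}, m + 1 = n → ∀ x ∈ X n, d' n (f n x) = f m (d n x)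

/-- The chain map given by `f`. -/
def chainMap {X : ℤ → Submodule k V} {d : ℤ → V →ₗ[k] V} {X' : ℤ → Submodule k V'}
    {d' : ℤ → V' →ₗ[k] V'} (h : IsChain X d) (h' : IsChain X' d') {f : ℤ → V →ₗ[k] V'}
    (hf : IsChainMap X d X' d' f) : chainComplex X d h ⟶ chainComplex X' d' h' where
  f n := ModuleCat.ofHom ((f n).restrict (p := X n) (q := X' n) (hf.mem n))
  comm' i j hij := by
    have hij' : j + 1 = i := hij
    dsimp only [chainComplex]
    rw [dif_pos hij', dif_pos hij']
    refine ModuleCat.hom_ext (LinearMap.ext fun x => ?_)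
    exact Subtype.ext (hf.comm hij' x.1 x.2)

end Chains

/-- The data `(X, b, B)` of a mixed complex: `b n : X n → X (n - 1)` and `B n : X n → X (n + 1)`. -/
structure MixedDiagram (k : Type u) [CommRing k] (V : Type w) [AddCommGroup V] [Module k V] where
  X : ℤ → Submodule k V
  b : ℤ → V →ₗ[k] V
  B : ℤ → V →ₗ[k] V

/-- The data `(X, b, β, B)` of a double mixed complex: `b` lowers the first index, `β` lowers the
second index, `B` raises the first index. -/
structure DoubleMixedDiagram (k : Type u) [CommRing k] (V : Type w) [AddCommGroup V]
    [Module k V] where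
  X : ℤ → ℤ → Submodule k V
  b : ℤ → ℤ → V →ₗ[k] V
  β : ℤ → ℤ → V →ₗ[k] V
  B : ℤ → ℤ → V →ₗ[k] V

namespace MixedDiagram

variable {k : Type u} [CommRing k] {V : Type w} [AddCommGroup V] [Module k V]
  {V' : Type w} [AddCommGroup V'] [Module k V']

/-- `(X, b, B)` is a mixed complex. -/
structure IsMixedComplex (D : MixedDiagram k V) : Prop where
  b_mem : ∀ {n m : ℤ}, m + 1 = n → ∀ x ∈ D.X n, D.b n x ∈ D.X m
  B_mem : ∀ {n m : ℤ}, n + 1 = m → ∀ x ∈ D.X n, D.B n x ∈ D.X m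
  b_b : ∀ {n m : ℤ}, m + 1 = n → ∀ x ∈ D.X n, D.b m (D.b n x) = 0
  B_B : ∀ {n m : ℤ}, n + 1 = m → ∀ x ∈ D.X n, D.B m (D.B n x) = 0
  B_b : ∀ {l n m : ℤ}, l + 1 = n → n + 1 = m → ∀ x ∈ D.X n,
    D.B l (D.b n x) + D.b m (D.B n x) = 0

/-- `f` is a morphism of mixed complexes. -/
structure IsHom (D : MixedDiagram k V) (D' : MixedDiagram k V') (f : ℤ → V →ₗ[k] V') : Prop where
  mem : ∀ n : ℤ, ∀ x ∈ D.X n, f n x ∈ D'.X n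
  comm_b : ∀ {n m : ℤ}, m + 1 = n → ∀ x ∈ D.X n, D'.b n (f n x) = f m (D.b n x)
  comm_B : ∀ {n m : ℤ}, n + 1 = m → ∀ x ∈ D.X n, D'.B n (f n x) = f m (D.B n x)

theorem IsMixedComplex.isChain {D : MixedDiagram k V} (h : D.IsMixedComplex) :
    IsChain D.X D.b := ⟨h.b_mem, h.b_b⟩

theorem IsHom.isChainMap {D : MixedDiagram k V} {D' : MixedDiagram k V'} {f : ℤ → V →ₗ[k] V'}
    (h : IsHom D D' f) : IsChainMap D.X D.b D'.X D'.b f := ⟨h.mem, h.comm_b⟩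

/-- The chain complex `(X, b)`. -/
def hochChain (D : MixedDiagram k V) (h : D.IsMixedComplex) :
    ChainComplex (ModuleCat.{w} k) ℤ := chainComplex D.X D.b h.isChain

/-- The morphism `(X, b) ⟶ (X', b)` induced by a morphism of mixed complexes. -/
def hochMap {D : MixedDiagram k V} {D' : MixedDiagram k V'} (h : D.IsMixedComplex) (h' : D'.IsMixedComplex)
    {f : ℤ → V →ₗ[k] V'} (hf : IsHom D D' f) : D.hochChain h ⟶ D'.hochChain h' :=
  chainMap h.isChain h'.isChain hf.isChainMap

open Classical in
/-- Consider the double complex `BP` of a mixed complex, whose column `p` is `X u ^ p`, with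
`X_j u ^ p` in total degree `j + 2 p`. This is the degree `n` part `∏_{p ∈ P} X_{n - 2 p}` of the total
complex of the subquotient of `BP` that consists of the columns with index in `P`. -/
def totX (D : MixedDiagram k V) (P : Set ℤ) (n : ℤ) : Submodule k (ℤ → V) :=
  Submodule.pi Set.univ fun p => if p ∈ P then D.X (n - 2 * p) else ⊥

open Classical in
/-- The differential of the total complex of the columns `P`: `b (x u ^ p) = b (x) u ^ p` and
`B (x u ^ p) = B (x) u ^ (p - 1)`, where `u ^ (p - 1)` is read as `0` if `p - 1 ∉ P`. -/
def totD (D : MixedDiagram k V) (P : Set ℤ) (n : ℤ) : (ℤ → V) →ₗ[k] (ℤ → V) :=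
  LinearMap.pi fun p =>
    if p ∈ P then
      D.b (n - 2 * p) ∘ₗ LinearMap.proj p + D.B (n - 2 * (p + 1)) ∘ₗ LinearMap.proj (p + 1)
    else 0

theorem mem_totX {D : MixedDiagram k V} {P : Set ℤ} {n : ℤ} {x : ℤ → V} :
    x ∈ D.totX P n ↔ ∀ p, (p ∈ P → x p ∈ D.X (n - 2 * p)) ∧ (p ∉ P → x p = 0) := by
  simp only [totX, Submodule.mem_pi, Set.mem_univ, true_imp_iff]
  refine forall_congr' fun p => ?_
  by_cases hp : p ∈ P <;> simp [hp]

theorem totD_pos {D : MixedDiagram k V} {P : Set ℤ} {n : ℤ} (x : ℤ → V) {p : ℤ}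
    (hp : p ∈ P) :
    D.totD P n x p = D.b (n - 2 * p) (x p) + D.B (n - 2 * (p + 1)) (x (p + 1)) := by
  simp [totD, hp]

theorem totD_neg {D : MixedDiagram k V} {P : Set ℤ} {n : ℤ} (x : ℤ → V) {p : ℤ}
    (hp : p ∉ P) : D.totD P n x p = 0 := by
  simp [totD, hp]

theorem IsMixedComplex.isChain_tot {D : MixedDiagram k V} (h : D.IsMixedComplex)
    (P : Set ℤ) : IsChain (D.totX P) (D.totD P) where
  mem {n m} hnm x hx := by
    rw [mem_totX] at hx ⊢
    refine fun p => ⟨fun hp => ?_, fun hp => totD_neg x hp⟩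
    rw [totD_pos x hp]
    refine add_mem (h.b_mem (by lia) _ ((hx p).1 hp)) ?_
    by_cases hp' : p + 1 ∈ P
    · exact h.B_mem (by lia) _ ((hx (p + 1)).1 hp')
    · rw [(hx (p + 1)).2 hp', map_zero]
      exact zero_mem _
  sq {n m} hnm x hx := by
    rw [mem_totX] at hx
    funext p
    by_cases hp : p ∈ P
    · rw [totD_pos _ hp, totD_pos _ hp, map_add, h.b_b (by lia) _ ((hx p).1 hp), zero_add]
      by_cases hp' : p + 1 ∈ P
      · rw [totD_pos _ hp', map_add, ← add_assoc, add_comm (D.b _ _),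
          h.B_b (by lia) (by lia) _ ((hx (p + 1)).1 hp'), zero_add]
        by_cases hp2 : p + 1 + 1 ∈ P
        · exact h.B_B (by lia) _ ((hx (p + 1 + 1)).1 hp2)
        · rw [(hx _).2 hp2]; simp
      · rw [totD_neg _ hp', (hx _).2 hp']; simp
    · exact totD_neg _ hp

/-- The map induced on total complexes, column by column. -/
def totMap (f : ℤ → V →ₗ[k] V') (n : ℤ) :
    (ℤ → V) →ₗ[k] (ℤ → V') :=
  LinearMap.pi fun p => f (n - 2 * p) ∘ₗ LinearMap.proj p

theorem IsHom.isChainMap_tot {D : MixedDiagram k V} {D' : MixedDiagram k V'} {f : ℤ → V →ₗ[k] V'}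
    (h : IsHom D D' f) (P : Set ℤ) :
    IsChainMap (D.totX P) (D.totD P) (D'.totX P) (D'.totD P) (totMap f) where
  mem n x hx := by
    rw [mem_totX] at hx ⊢
    refine fun p => ⟨fun hp => h.mem _ _ ((hx p).1 hp), fun hp => ?_⟩
    simp [totMap, (hx p).2 hp]
  comm {n m} hnm x hx := by
    rw [mem_totX] at hx
    funext p
    by_cases hp : p ∈ P
    · have e1 : totMap f m (D.totD P n x) p = f (m - 2 * p) (D.totD P n x p) := rfl
      rw [e1, totD_pos _ hp, totD_pos _ hp, map_add]
      congr 1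
      · exact h.comm_b (by lia) _ ((hx p).1 hp)
      · by_cases hp' : p + 1 ∈ P
        · exact h.comm_B (by lia) _ ((hx _).1 hp')
        · simp [totMap, (hx _).2 hp']
    · rw [totD_neg _ hp]
      simp [totMap, totD_neg _ hp]

/-- The total complex of the columns `P` of `BP`. -/
def colChain (D : MixedDiagram k V) (h : D.IsMixedComplex) (P : Set ℤ) :
    ChainComplex (ModuleCat.{w} k) ℤ := chainComplex (D.totX P) (D.totD P) (h.isChain_tot P)

/-- The map of total complexes induced by a morphism of mixed complexes. -/
def colMap {D : MixedDiagram k V} {D' : MixedDiagram k V'} (h : D.IsMixedComplex) (h' : D'.IsMixedComplex)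
    {f : ℤ → V →ₗ[k] V'} (hf : IsHom D D' f) (P : Set ℤ) :
    D.colChain h P ⟶ D'.colChain h' P :=
  chainMap (h.isChain_tot P) (h'.isChain_tot P) (hf.isChainMap_tot P)

/-- Hochschild homology: the homology of `(X, b)`. -/
def HH (D : MixedDiagram k V) (h : D.IsMixedComplex) (n : ℤ) : ModuleCat.{w} k :=
  (D.hochChain h).homology n

/-- Cyclic homology: the columns with index `p ≥ 0`. -/
def HC (D : MixedDiagram k V) (h : D.IsMixedComplex) (n : ℤ) : ModuleCat.{w} k :=
  (D.colChain h (Set.Ici 0)).homology n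

/-- Periodic homology: all columns. -/
def HP (D : MixedDiagram k V) (h : D.IsMixedComplex) (n : ℤ) : ModuleCat.{w} k :=
  (D.colChain h Set.univ).homology n

/-- Negative homology: the columns with index `p ≤ 0`. -/
def HN (D : MixedDiagram k V) (h : D.IsMixedComplex) (n : ℤ) : ModuleCat.{w} k :=
  (D.colChain h (Set.Iic 0)).homology n

section
variable {D : MixedDiagram k V} {D' : MixedDiagram k V'} (h : D.IsMixedComplex)
  (h' : D'.IsMixedComplex) {f : ℤ → V →ₗ[k] V'} (hf : IsHom D D' f) (n : ℤ)

/-- The map induced on Hochschild homology. -/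
def HHMap : D.HH h n ⟶ D'.HH h' n := HomologicalComplex.homologyMap (hochMap h h' hf) n

/-- The map induced on cyclic homology. -/
def HCMap : D.HC h n ⟶ D'.HC h' n := HomologicalComplex.homologyMap (colMap h h' hf (Set.Ici 0)) n

/-- The map induced on periodic homology. -/
def HPMap : D.HP h n ⟶ D'.HP h' n := HomologicalComplex.homologyMap (colMap h h' hf Set.univ) n

/-- The map induced on negative homology. -/
def HNMap : D.HN h n ⟶ D'.HN h' n := HomologicalComplex.homologyMap (colMap h h' hf (Set.Iic 0)) n

end

end MixedDiagram

namespace DoubleMixedDiagram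

variable {k : Type u} [CommRing k] {V : Type w} [AddCommGroup V] [Module k V]
  {V' : Type w} [AddCommGroup V'] [Module k V']

/-- `(X, b, β, B)` is a double mixed complex. -/
structure IsDoubleMixedComplex (D : DoubleMixedDiagram k V) : Prop where
  b_mem : ∀ {v v' : ℤ} (w : ℤ), v' + 1 = v → ∀ x ∈ D.X v w, D.b v w x ∈ D.X v' w
  β_mem : ∀ (v : ℤ) {w w' : ℤ}, w' + 1 = w → ∀ x ∈ D.X v w, D.β v w x ∈ D.X v w'
  B_mem : ∀ {v v' : ℤ} (w : ℤ), v + 1 = v' → ∀ x ∈ D.X v w, D.B v w x ∈ D.X v' w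
  b_b : ∀ {v v' : ℤ} (w : ℤ), v' + 1 = v → ∀ x ∈ D.X v w, D.b v' w (D.b v w x) = 0
  β_β : ∀ (v : ℤ) {w w' : ℤ}, w' + 1 = w → ∀ x ∈ D.X v w, D.β v w' (D.β v w x) = 0
  B_B : ∀ {v v' : ℤ} (w : ℤ), v + 1 = v' → ∀ x ∈ D.X v w, D.B v' w (D.B v w x) = 0
  β_b : ∀ {v v' w w' : ℤ}, v' + 1 = v → w' + 1 = w → ∀ x ∈ D.X v w,
    D.β v' w (D.b v w x) + D.b v w' (D.β v w x) = 0
  β_B : ∀ {v v' w w' : ℤ}, v + 1 = v' → w' + 1 = w → ∀ x ∈ D.X v w,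
    D.β v' w (D.B v w x) + D.B v w' (D.β v w x) = 0
  b_B : ∀ {v₁ v v₂ : ℤ} (w : ℤ), v₁ + 1 = v → v + 1 = v₂ → ∀ x ∈ D.X v w,
    D.b v₂ w (D.B v w x) + D.B v₁ w (D.b v w x) = 0

/-- `f` is a morphism of double mixed complexes. -/
structure IsHom (D : DoubleMixedDiagram k V) (D' : DoubleMixedDiagram k V') (f : ℤ → ℤ → V →ₗ[k] V') : Prop where
  mem : ∀ v w : ℤ, ∀ x ∈ D.X v w, f v w x ∈ D'.X v w
  comm_b : ∀ {v v' : ℤ} (w : ℤ), v' + 1 = v → ∀ x ∈ D.X v w,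
    D'.b v w (f v w x) = f v' w (D.b v w x)
  comm_β : ∀ (v : ℤ) {w w' : ℤ}, w' + 1 = w → ∀ x ∈ D.X v w,
    D'.β v w (f v w x) = f v w' (D.β v w x)
  comm_B : ∀ {v v' : ℤ} (w : ℤ), v + 1 = v' → ∀ x ∈ D.X v w,
    D'.B v w (f v w x) = f v' w (D.B v w x)

/-- The total mixed complex: its degree `n` part is `∏_p X_{p, n - p}`, its operators are `b + β`
and `B`. -/
def total (D : DoubleMixedDiagram k V) : MixedDiagram k (ℤ → V) where
  X n := Submodule.pi Set.univ fun p => D.X p (n - p)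
  b n := LinearMap.pi fun p =>
    D.b (p + 1) (n - (p + 1)) ∘ₗ LinearMap.proj (p + 1) + D.β p (n - p) ∘ₗ LinearMap.proj p
  B n := LinearMap.pi fun p => D.B (p - 1) (n - (p - 1)) ∘ₗ LinearMap.proj (p - 1)

/-- The morphism of total mixed complexes induced by `f`. -/
def totalMap (f : ℤ → ℤ → V →ₗ[k] V') (n : ℤ) :
    (ℤ → V) →ₗ[k] (ℤ → V') :=
  LinearMap.pi fun p => f p (n - p) ∘ₗ LinearMap.proj p

theorem mem_total {D : DoubleMixedDiagram k V} {n : ℤ} {x : ℤ → V} :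
    x ∈ D.total.X n ↔ ∀ p, x p ∈ D.X p (n - p) := by
  simp only [total, Submodule.mem_pi, Set.mem_univ, true_imp_iff]

theorem total_b {D : DoubleMixedDiagram k V} (n : ℤ) (x : ℤ → V) (p : ℤ) :
    D.total.b n x p = D.b (p + 1) (n - (p + 1)) (x (p + 1)) + D.β p (n - p) (x p) := rfl

theorem total_B {D : DoubleMixedDiagram k V} (n : ℤ) (x : ℤ → V) (p : ℤ) :
    D.total.B n x p = D.B (p - 1) (n - (p - 1)) (x (p - 1)) := rfl

theorem IsDoubleMixedComplex.total {D : DoubleMixedDiagram k V}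
    (h : D.IsDoubleMixedComplex) : D.total.IsMixedComplex where
  b_mem {n m} e x hx := by
    subst e
    rw [mem_total] at hx ⊢
    intro p
    have e1 : m + 1 - (p + 1) = m - p := by ring
    refine add_mem ?_ (h.β_mem p (by lia) _ (hx p))
    have := h.b_mem (v' := p) _ rfl _ (hx (p + 1))
    rwa [e1] at this ⊢
  B_mem {n m} e x hx := by
    subst e
    rw [mem_total] at hx ⊢
    intro p
    have e1 : n - (p - 1) = n + 1 - p := by ring
    have := h.B_mem (v' := p) _ (by lia) _ (hx (p - 1))
    rw [total_B]
    rwa [e1] at this ⊢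
  b_b {n m} e x hx := by
    subst e
    rw [mem_total] at hx
    funext p
    simp only [total_b, map_add]
    have h1 := hx (p + 1 + 1)
    have h2 := hx (p + 1)
    have h3 := hx p
    have e1 : m + 1 - (p + 1 + 1) = m - (p + 1) := by ring
    have e2 : m + 1 - (p + 1) = m - p := by ring
    rw [e1] at h1 ⊢
    rw [e2] at h2 ⊢
    rw [h.b_b _ rfl _ h1, h.β_β p (by lia) _ h3, zero_add, add_zero, add_comm,
      h.β_b rfl (by lia) _ h2]
    rfl
  B_B {n m} e x hx := by
    subst e
    rw [mem_total] at hx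
    funext p
    have h1 := hx (p - 1 - 1)
    simp only [total_B]
    have e1 : n - (p - 1 - 1) = n + 1 - (p - 1) := by ring
    rw [e1] at h1 ⊢
    exact h.B_B _ (by lia) _ h1
  B_b {l n m} e e' x hx := by
    subst e
    subst e'
    rw [mem_total] at hx
    funext p
    have h1 := hx p
    have h2 := hx (p - 1)
    change D.total.B l _ p + D.total.b _ _ p = 0
    simp only [total_b, total_B, map_add]
    have e0 : p - 1 + 1 = p := by ring
    have e3 : p + 1 - 1 = p := by ring
    have e1 : l - (p - 1) = l + 1 - p := by ring
    have e2 : l + 1 + 1 - (p + 1) = l + 1 - p := by ring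
    have e4 : l + 1 + 1 - p = l + 1 - (p - 1) := by ring
    rw [e0, e3, e1, e2, e4]
    have r1 := h.b_B _ (v₁ := p - 1) (v₂ := p + 1) (by lia) (by lia) _ h1
    have r2 := h.β_B (v' := p) (w' := l + 1 - p) (by lia) (by lia) _ h2
    rw [← add_add_add_comm, add_comm (D.B _ _ _), add_comm (D.B _ _ _)]
    rw [r1, r2, add_zero]

theorem IsHom.total {D : DoubleMixedDiagram k V} {D' : DoubleMixedDiagram k V'} {f : ℤ → ℤ → V →ₗ[k] V'}
    (h : IsHom D D' f) : MixedDiagram.IsHom D.total D'.total (totalMap f) where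
  mem n x hx := by
    rw [mem_total] at hx ⊢
    exact fun p => h.mem _ _ _ (hx p)
  comm_b {n m} e x hx := by
    subst e
    rw [mem_total] at hx
    funext p
    have h1 := h.comm_b (v' := p) _ rfl _ (hx (p + 1))
    have h2 := h.comm_β p (w' := m - p) (by lia) _ (hx p)
    have e1 : m + 1 - (p + 1) = m - p := by ring
    have h3 : totalMap f m (D.total.b (m + 1) x) p = f p (m - p) (D.total.b (m + 1) x p) := rfl
    have h4 : ∀ q, totalMap f (m + 1) x q = f q (m + 1 - q) (x q) := fun q => rfl
    rw [h3, total_b, total_b, map_add, h4, h4, h1, h2, e1]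
  comm_B {n m} e x hx := by
    subst e
    rw [mem_total] at hx
    funext p
    have h1 := h.comm_B (v' := p) _ (by lia) _ (hx (p - 1))
    have e1 : n - (p - 1) = n + 1 - p := by ring
    have h3 : totalMap f (n + 1) (D.total.B n x) p = f p (n + 1 - p) (D.total.B n x p) := rfl
    have h4 : ∀ q, totalMap f n x q = f q (n - q) (x q) := fun q => rfl
    rw [h3, total_B, total_B, h4, h1, e1]

end DoubleMixedDiagram

open scoped TensorProduct

/-! ### Normalized cyclic tensors

`C` is a `k`-algebra, `K` a (not necessarily commutative) subalgebra. -/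

section Cyc

variable {k : Type u} [CommRing k] {C : Type v} [Ring C] [Algebra k C] (K : Subalgebra k C)
  {C' : Type w'} [Ring C'] [Algebra k C']

/-- The relations of `C ⊗ C̄ ^ (⊗ n) ⊗`, with `⊗ = ⊗_K` and `C̄ = C / K`, inside the `(n + 1)`-fold
tensor power of `C` over `k`: the `K`-balancing relations between cyclically consecutive factors
(`i + 1` is taken modulo `n + 1`), and the simple tensors with a factor of positive index in `K`. -/
def cyclicRel (n : ℕ) : Submodule k (⨂[k] _ : Fin (n + 1), C) :=
  Submodule.span k
    ({z | ∃ (x : Fin (n + 1) → C) (i : Fin (n + 1)), ∃ c ∈ K,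
        z = PiTensorProduct.tprod k (Function.update x i (x i * c))
          - PiTensorProduct.tprod k (Function.update x (i + 1) (c * x (i + 1)))} ∪
     {z | ∃ (x : Fin (n + 1) → C) (i : Fin (n + 1)), i ≠ 0 ∧ x i ∈ K ∧
        z = PiTensorProduct.tprod k x})

/-- The `k`-module `C ⊗ C̄ ^ (⊗ n) ⊗`. -/
abbrev NormChain (n : ℕ) : Type (max u v) := (⨂[k] _ : Fin (n + 1), C) ⧸ cyclicRel K n

/-- The class of `x_0 ⊗ ⋯ ⊗ x_n` in `C ⊗ C̄ ^ (⊗ n) ⊗`. -/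
def cls (n : ℕ) : MultilinearMap k (fun _ : Fin (n + 1) => C) (NormChain K n) :=
  (cyclicRel K n).mkQ.compMultilinearMap (PiTensorProduct.tprod k)

theorem cls_balanced {n : ℕ} (x : Fin (n + 1) → C) (i : Fin (n + 1)) {c : C} (hc : c ∈ K) :
    cls K n (Function.update x i (x i * c)) =
      cls K n (Function.update x (i + 1) (c * x (i + 1))) := by
  refine (Submodule.Quotient.eq _).2 (Submodule.subset_span (Or.inl ⟨x, i, c, hc, rfl⟩))

theorem cls_degenerate {n : ℕ} (x : Fin (n + 1) → C) {i : Fin (n + 1)} (hi : i ≠ 0)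
    (hx : x i ∈ K) : cls K n x = 0 :=
  (Submodule.Quotient.mk_eq_zero _).2 (Submodule.subset_span (Or.inr ⟨x, i, hi, hx, rfl⟩))

variable {K}

/-- The multilinear map `f` factors through `C ⊗ C̄ ^ (⊗ n) ⊗`. -/
structure Descends (K : Subalgebra k C) {n : ℕ} {N : Type w} [AddCommGroup N] [Module k N]
    (f : MultilinearMap k (fun _ : Fin (n + 1) => C) N) : Prop where
  balanced : ∀ (x : Fin (n + 1) → C) (i : Fin (n + 1)), ∀ c ∈ K,
    f (Function.update x i (x i * c)) = f (Function.update x (i + 1) (c * x (i + 1)))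
  degenerate : ∀ (x : Fin (n + 1) → C) (i : Fin (n + 1)), i ≠ 0 → x i ∈ K → f x = 0

section
variable {n : ℕ} {N : Type w} [AddCommGroup N] [Module k N]

/-- The linear map on `C ⊗ C̄ ^ (⊗ n) ⊗` with `x_0 ⊗ ⋯ ⊗ x_n ↦ f (x_0, …, x_n)`. -/
def descend (f : MultilinearMap k (fun _ : Fin (n + 1) => C) N) (h : Descends K f) :
    NormChain K n →ₗ[k] N :=
  (cyclicRel K n).liftQ (PiTensorProduct.lift f) <| by
    refine Submodule.span_le.2 ?_
    rintro z (⟨x, i, c, hc, rfl⟩ | ⟨x, i, hi, hx, rfl⟩)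
    · simpa [sub_eq_zero] using h.balanced x i c hc
    · simpa using h.degenerate x i hi hx

theorem descend_cls (f : MultilinearMap k (fun _ : Fin (n + 1) => C) N) (h : Descends K f)
    (x : Fin (n + 1) → C) : descend f h (cls K n x) = f x := by
  exact ((cyclicRel K n).liftQ_apply _ _).trans (PiTensorProduct.lift.tprod x)

theorem Descends.sum {ι : Type*} {s : Finset ι}
    {f : ι → MultilinearMap k (fun _ : Fin (n + 1) => C) N} (h : ∀ i ∈ s, Descends K (f i)) :
    Descends K (∑ i ∈ s, f i) where
  balanced x i c hc := by
    simp only [sum_apply]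
    exact Finset.sum_congr rfl fun j hj => (h j hj).balanced x i c hc
  degenerate x i hi hx := by
    simp only [sum_apply]
    exact Finset.sum_eq_zero fun j hj => (h j hj).degenerate x i hi hx

theorem Descends.smul {f : MultilinearMap k (fun _ : Fin (n + 1) => C) N} (h : Descends K f)
    (a : k) : Descends K (a • f) where
  balanced x i c hc := by simp [h.balanced x i c hc]
  degenerate x i hi hx := by simp [h.degenerate x i hi hx]

end

/-- `f` is a morphism of bimodules along `φ : K → K'`. -/
structure IsBimodMap (K : Subalgebra k C) (K' : Subalgebra k C') (φ : C → C')
    (f : C →ₗ[k] C') : Prop where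
  mapsTo : ∀ c ∈ K, φ c ∈ K'
  left : ∀ c ∈ K, ∀ x, f (c * x) = φ c * f x
  right : ∀ c ∈ K, ∀ x, f (x * c) = f x * φ c

/-- `x_0 ⊗ ⋯ ⊗ x_n ↦ y_s ⊗ y_{s+1} ⊗ ⋯ ⊗ y_n ⊗ y_0 ⊗ ⋯ ⊗ y_{s-1}` with `y_i = f_i (x_i)`. -/
def rotWord (K' : Subalgebra k C') {n : ℕ} (f : Fin (n + 1) → C →ₗ[k] C') (s : Fin (n + 1)) :
    MultilinearMap k (fun _ : Fin (n + 1) => C) (NormChain K' n) :=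
  ((cls K' n).domDomCongr (Equiv.addRight s)).compLinearMap f

/-- `x_0 ⊗ ⋯ ⊗ x_n ↦ 1 ⊗ y_s ⊗ y_{s+1} ⊗ ⋯ ⊗ y_n ⊗ y_0 ⊗ ⋯ ⊗ y_{s-1}` with `y_i = f_i (x_i)`. -/
def unitRotWord (K' : Subalgebra k C') {n : ℕ} (f : Fin (n + 1) → C →ₗ[k] C')
    (s : Fin (n + 1)) :
    MultilinearMap k (fun _ : Fin (n + 1) => C) (NormChain K' (n + 1)) :=
  (((cls K' (n + 1)).curryLeft 1).domDomCongr (Equiv.addRight s)).compLinearMap f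

theorem rotWord_apply (K' : Subalgebra k C') {n : ℕ} (f : Fin (n + 1) → C →ₗ[k] C') (s : Fin (n + 1))
    (x : Fin (n + 1) → C) :
    rotWord K' f s x = cls K' n (fun j => f (j + s) (x (j + s))) := rfl

theorem unitRotWord_apply (K' : Subalgebra k C') {n : ℕ} (f : Fin (n + 1) → C →ₗ[k] C') (s : Fin (n + 1))
    (x : Fin (n + 1) → C) :
    unitRotWord K' f s x = cls K' (n + 1) (Fin.cons 1 (fun j => f (j + s) (x (j + s)))) := rfl

theorem rot_update {n : ℕ} (f : Fin (n + 1) → C →ₗ[k] C') (s : Fin (n + 1))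
    (x : Fin (n + 1) → C) (i : Fin (n + 1)) (a : C) :
    (fun j => f (j + s) (Function.update x i a (j + s))) =
      Function.update (fun j => f (j + s) (x (j + s))) (i - s) (f i a) := by
  funext j
  by_cases h : j = i - s
  · subst h
    simp
  · have h' : j + s ≠ i := fun e => h (by rw [← e]; simp)
    simp [h, h']

theorem rotWord_descends {K' : Subalgebra k C'} {n : ℕ} {f : Fin (n + 1) → C →ₗ[k] C'} {s : Fin (n + 1)} {φ : C → C'}
    (hf : ∀ i, IsBimodMap K K' φ (f i))
    (hd : ∀ i, i ≠ 0 → ∀ c ∈ K, f i c ∈ K' ∧ (i = s → f i c = 0)) :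
    Descends K (rotWord K' f s) where
  balanced x i c hc := by
    rw [rotWord_apply, rotWord_apply, rot_update, rot_update, (hf i).right c hc,
      (hf (i + 1)).left c hc]
    have := cls_balanced K' (fun j => f (j + s) (x (j + s))) (i - s) ((hf i).mapsTo c hc)
    have e : i - s + 1 = i + 1 - s := by abel
    simpa [e] using this
  degenerate x i hi hx := by
    rw [rotWord_apply]
    by_cases h : i = s
    · refine (cls K' n).map_coord_zero 0 ?_
      subst h
      simpa using (hd i hi _ hx).2 rfl
    · refine cls_degenerate K' _ (i := i - s) (sub_ne_zero.2 h) ?_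
      simpa using (hd i hi _ hx).1

theorem cons_last_succ {n : ℕ} (i : Fin (n + 1)) (h : i + 1 ≠ 0) :
    i.succ + 1 = (i + 1).succ := by
  have hi : i ≠ Fin.last n := fun e => h (by rw [e]; simp)
  have := Fin.val_lt_last hi
  ext
  rw [Fin.val_add_one_of_lt (by rw [Fin.lt_def]; simpa using this), Fin.val_succ, Fin.val_succ,
    Fin.val_add_one_of_lt (by rwa [Fin.lt_def])]

theorem unitRotWord_descends {K' : Subalgebra k C'} {n : ℕ} {f : Fin (n + 1) → C →ₗ[k] C'} {s : Fin (n + 1)}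
    {φ : C → C'} (hf : ∀ i, IsBimodMap K K' φ (f i))
    (hd : ∀ i, i ≠ 0 → ∀ c ∈ K, f i c ∈ K') :
    Descends K (unitRotWord K' f s) where
  balanced x i c hc := by
    rw [unitRotWord_apply, unitRotWord_apply, rot_update, rot_update, (hf i).right c hc,
      (hf (i + 1)).left c hc, Fin.cons_update, Fin.cons_update]
    set y : Fin (n + 2) → C' := Fin.cons 1 (fun j => f (j + s) (x (j + s))) with hy
    have hc' := (hf i).mapsTo c hc
    have e : i - s + 1 = i + 1 - s := by abel
    have y1 : y (i - s).succ = f i (x i) := by simp [hy]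
    have y2 : y (i + 1 - s).succ = f (i + 1) (x (i + 1)) := by simp [hy]
    have y0 : y 0 = 1 := by simp [hy]
    rw [← y1, ← y2, cls_balanced K' y _ hc']
    by_cases h : i - s + 1 = 0
    · have h1 : i - s = Fin.last n := by
        rw [← Fin.last_add_one n] at h
        exact add_right_cancel h
      have h2 : (i - s).succ + 1 = 0 := by rw [h1]; simp
      rw [h2, ← e, h, y0, mul_one]
      have := cls_balanced K' y 0 hc'
      rw [y0, one_mul] at this
      rw [this]
      simp
    · rw [cons_last_succ _ h, e]
  degenerate x i hi hx := by
    rw [unitRotWord_apply]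
    refine cls_degenerate K' _ (i := (i - s).succ) (Fin.succ_ne_zero _) ?_
    simpa using hd i hi _ hx

/-- The factors of `x_0 ⊗ ⋯ ⊗ op (x_j, x_{j+1}) ⊗ ⋯ ⊗ x_{n+1}` for `j ≤ n`, and those of
`op (x_{n+1}, x_0) ⊗ x_1 ⊗ ⋯ ⊗ x_n` for `j = n + 1`. -/
def faceFun (op : C →ₗ[k] C →ₗ[k] C) {n : ℕ} (j : Fin (n + 2)) (x : Fin (n + 2) → C) :
    Fin (n + 1) → C := fun i =>
  if (i : ℕ) = j ∨ (i = 0 ∧ j = Fin.last (n + 1)) then op (x j) (x (j + 1))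
  else if (i : ℕ) < j then x i.castSucc else x i.succ

/-- The index of the factor of the `j`-th face that contains `x_r`. -/
def facePos {n : ℕ} (j r : Fin (n + 2)) : Fin (n + 1) :=
  if h : (r : ℕ) ≤ j then (if h' : (r : ℕ) < n + 1 then ⟨r, h'⟩ else 0)
  else ⟨(r : ℕ) - 1, by omega⟩

theorem val_add_one' {n : ℕ} (j : Fin (n + 1)) :
    ((j + 1 : Fin (n + 1)) : ℕ) = if (j : ℕ) = n then 0 else (j : ℕ) + 1 := by
  rw [Fin.val_add_one]
  simp [Fin.ext_iff]

theorem facePos_val {n : ℕ} (j r : Fin (n + 2)) :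
    (facePos j r : ℕ) =
      if (r : ℕ) ≤ j then (if (r : ℕ) < n + 1 then (r : ℕ) else 0) else (r : ℕ) - 1 := by
  unfold facePos
  split_ifs <;> rfl

theorem facePos_add_one {n : ℕ} (j r : Fin (n + 2)) :
    facePos j (r + 1) = if r = j then facePos j r else facePos j r + 1 := by
  have h0 := val_add_one' r
  have h1 := val_add_one' (facePos j r)
  have h2 := facePos_val j r
  have h3 := facePos_val j (r + 1)
  have hr := r.2
  have hj := j.2
  by_cases h : r = j
  · rw [if_pos h, Fin.ext_iff]
    rw [Fin.ext_iff] at h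
    grind
  · rw [if_neg h, Fin.ext_iff]
    rw [Fin.ext_iff] at h
    grind

theorem facePos_eq_iff {n : ℕ} (j r : Fin (n + 2)) (i : Fin (n + 1))
    (hi : ¬((i : ℕ) = j ∨ (i = 0 ∧ j = Fin.last (n + 1)))) :
    i = facePos j r ↔ r = if (i : ℕ) < j then i.castSucc else i.succ := by
  have h2 := facePos_val j r
  have hr := r.2
  have hj := j.2
  have hi' := i.2
  rw [Fin.ext_iff, Fin.ext_iff, Fin.val_last, Fin.val_zero] at hi
  rw [Fin.ext_iff, Fin.ext_iff, apply_ite Fin.val, Fin.val_succ, Fin.val_castSucc]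
  grind

theorem facePos_slot_iff {n : ℕ} (j r : Fin (n + 2)) :
    (((facePos j r : Fin (n + 1)) : ℕ) = j ∨ (facePos j r = 0 ∧ j = Fin.last (n + 1))) ↔
      r = j ∨ r = j + 1 := by
  have h0 := val_add_one' j
  have h2 := facePos_val j r
  have hr := r.2
  have hj := j.2
  rw [Fin.ext_iff, Fin.ext_iff, Fin.ext_iff, Fin.ext_iff, Fin.val_last, Fin.val_zero]
  grind

theorem faceFun_facePos (op : C →ₗ[k] C →ₗ[k] C) {n : ℕ} (j r : Fin (n + 2))
    (x : Fin (n + 2) → C) :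
    faceFun op j x (facePos j r) = if r = j ∨ r = j + 1 then op (x j) (x (j + 1)) else x r := by
  unfold faceFun
  by_cases h : r = j ∨ r = j + 1
  · rw [if_pos h, if_pos ((facePos_slot_iff j r).2 h)]
  · have h' := mt (facePos_slot_iff j r).1 h
    rw [if_neg h, if_neg h', ← apply_ite x, ← (facePos_eq_iff j r _ h').1 rfl]

theorem faceFun_update (op : C →ₗ[k] C →ₗ[k] C) {n : ℕ} (j r : Fin (n + 2))
    (x : Fin (n + 2) → C) (a : C) :
    faceFun op j (Function.update x r a) = Function.update (faceFun op j x) (facePos j r)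
      (if r = j then op a (x (j + 1)) else if r = j + 1 then op (x j) a else a) := by
  funext i
  have hne : j + 1 ≠ j := by simp
  by_cases hi : (i : ℕ) = j ∨ (i = 0 ∧ j = Fin.last (n + 1))
  · have hij : i = facePos j j := by
      have h2 := facePos_val j j
      have hj := j.2
      rw [Fin.ext_iff, Fin.ext_iff, Fin.val_last, Fin.val_zero] at hi
      rw [Fin.ext_iff]
      grind
    rw [hij, faceFun_facePos, if_pos (Or.inl rfl)]
    by_cases h1 : r = j
    · subst h1
      simp
    · by_cases h2 : r = j + 1
      · subst h2
        rw [facePos_add_one, if_pos rfl]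
        simp [hne.symm]
      · have h3 : facePos j j ≠ facePos j r := by
          rw [← hij]
          intro e
          rw [e] at hi
          exact ((facePos_slot_iff j r).1 hi).elim h1 h2
        rw [Function.update_of_ne h3, faceFun_facePos, if_pos (Or.inl rfl),
          Function.update_of_ne (Ne.symm h1), Function.update_of_ne (Ne.symm h2)]
  · have key : ∀ y : Fin (n + 2) → C,
        faceFun op j y i = y (if (i : ℕ) < j then i.castSucc else i.succ) := by
      intro y
      unfold faceFun
      rw [if_neg hi, ← apply_ite y]
    rw [key, Function.update_apply, Function.update_apply, key]
    by_cases h : i = facePos j r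
    · have hr := (facePos_eq_iff j r i hi).1 h
      rw [if_pos hr.symm, if_pos h]
      have h4 : ¬(r = j ∨ r = j + 1) := fun h5 => hi (h ▸ (facePos_slot_iff j r).2 h5)
      rw [not_or] at h4
      rw [if_neg h4.1, if_neg h4.2]
    · rw [if_neg h, if_neg fun e => h ((facePos_eq_iff j r i hi).2 e.symm)]

/-- The `j`-th face with respect to the product `op`, without its sign. -/
def face (K : Subalgebra k C) (op : C →ₗ[k] C →ₗ[k] C) {n : ℕ} (j : Fin (n + 2)) :
    MultilinearMap k (fun _ : Fin (n + 2) => C) (NormChain K n) :=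
  MultilinearMap.mk' (fun x => cls K n (faceFun op j x))
    (by
      intro x r a b
      simp only [faceFun_update]
      rw [← MultilinearMap.map_update_add]
      congr 2
      split_ifs <;> simp)
    (by
      intro x r c a
      simp only [faceFun_update]
      rw [← MultilinearMap.map_update_smul]
      congr 2
      split_ifs <;> simp)

theorem face_apply (op : C →ₗ[k] C →ₗ[k] C) {n : ℕ} (j : Fin (n + 2)) (x : Fin (n + 2) → C) :
    face K op j x = cls K n (faceFun op j x) := rfl

/-- `op` is a morphism of `K`-bimodules `C ⊗_K C → C`. -/
structure IsBalancedOp (K : Subalgebra k C) (op : C →ₗ[k] C →ₗ[k] C) : Prop where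
  left : ∀ c ∈ K, ∀ x y, op (c * x) y = c * op x y
  mid : ∀ c ∈ K, ∀ x y, op (x * c) y = op x (c * y)
  right : ∀ c ∈ K, ∀ x y, op x (y * c) = op x y * c

theorem face_balanced {op : C →ₗ[k] C →ₗ[k] C} (h : IsBalancedOp K op) {n : ℕ} (j : Fin (n + 2))
    (x : Fin (n + 2) → C) (i : Fin (n + 2)) (c : C) (hc : c ∈ K) :
    face K op j (Function.update x i (x i * c)) =
      face K op j (Function.update x (i + 1) (c * x (i + 1))) := by
  have hne : j + 1 ≠ j := by simp
  have e1 := faceFun_facePos op j i x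
  have e2 := faceFun_facePos op j (i + 1) x
  have hb := cls_balanced K (faceFun op j x) (facePos j i) hc
  rw [face_apply, face_apply, faceFun_update, faceFun_update]
  by_cases hij : i = j
  · subst hij
    rw [facePos_add_one, if_pos rfl, if_pos rfl, if_neg hne, if_pos rfl, h.mid c hc]
  · have hs : facePos j (i + 1) = facePos j i + 1 := by rw [facePos_add_one, if_neg hij]
    have hij' : ¬(i + 1 = j + 1) := fun e => hij (add_right_cancel e)
    rw [← hs] at hb
    by_cases h1 : i = j + 1 <;> by_cases h2 : i + 1 = j
    · rw [if_pos (Or.inr h1)] at e1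
      rw [if_pos (Or.inl h2)] at e2
      rw [e1, e2] at hb
      rw [if_neg hij, if_pos h1, if_pos h2, h2, h.left c hc, h1, h.right c hc]
      rwa [h2, h1] at hb
    · rw [if_pos (Or.inr h1)] at e1
      rw [if_neg (by tauto)] at e2
      rw [e1, e2, h1] at hb
      rwa [if_neg hij, if_pos h1, if_neg h2, if_neg hij', h1, h.right c hc]
    · rw [if_neg (by tauto)] at e1
      rw [if_pos (Or.inl h2)] at e2
      rw [e1, e2, h2] at hb
      rwa [if_neg hij, if_neg h1, if_pos h2, h2, h.left c hc]
    · rw [if_neg (by tauto)] at e1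
      rw [if_neg (by tauto)] at e2
      rw [e1, e2] at hb
      rwa [if_neg hij, if_neg h1, if_neg h2, if_neg hij']

theorem face_degenerate (op : C →ₗ[k] C →ₗ[k] C) {n : ℕ} (j r : Fin (n + 2))
    (x : Fin (n + 2) → C) (hr : r ≠ 0) (hx : x r ∈ K) (h1 : r ≠ j) (h2 : r ≠ j + 1) :
    face K op j x = 0 := by
  rw [face_apply]
  refine cls_degenerate K _ (i := facePos j r) ?_ ?_
  · have h0 := val_add_one' j
    have h3 := facePos_val j r
    have hr' := r.2
    have hj := j.2
    rw [Ne, Fin.ext_iff, Fin.val_zero] at hr ⊢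
    rw [Ne, Fin.ext_iff] at h1 h2
    grind
  · rw [faceFun_facePos, if_neg (by tauto)]
    exact hx

theorem face_descends {op : C →ₗ[k] C →ₗ[k] C} (h : IsBalancedOp K op) {n : ℕ} (j : Fin (n + 2))
    (h1 : j ≠ 0 → ∀ c ∈ K, ∀ x, op c x = 0) (h2 : ∀ c ∈ K, ∀ x, op x c = 0) :
    Descends K (face K op j) where
  balanced := face_balanced h j
  degenerate x r hr hx := by
    have key : op (x j) (x (j + 1)) = 0 → face K op j x = 0 := by
      intro h0
      rw [face_apply]
      refine (cls K n).map_coord_zero (facePos j j) ?_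
      rw [faceFun_facePos, if_pos (Or.inl rfl), h0]
    by_cases e1 : r = j
    · exact key (h1 (e1 ▸ hr) _ (e1 ▸ hx) _)
    · by_cases e2 : r = j + 1
      · exact key (h2 _ (e2 ▸ hx) _)
      · exact face_degenerate op j r x hr hx e1 e2

theorem boundary_descends {op : C →ₗ[k] C →ₗ[k] C} (h : IsBalancedOp K op) (n : ℕ)
    (h1 : ∀ c ∈ K, ∀ x, op c x = c * x) (h2 : ∀ c ∈ K, ∀ x, op x c = x * c) :
    Descends K (∑ j : Fin (n + 2), (-1 : k) ^ (j : ℕ) • face K op j) where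
  balanced x i c hc := by
    simp only [sum_apply, smul_apply, face_balanced h _ x i c hc]
  degenerate x r hr hx := by
    simp only [sum_apply, smul_apply]
    have hne : r - 1 ≠ r := by simp
    rw [Finset.sum_eq_add (r - 1) r hne]
    · have hv : (r : ℕ) = ((r - 1 : Fin (n + 2)) : ℕ) + 1 := by
        have := val_add_one' (r - 1)
        rw [sub_add_cancel] at this
        rw [Ne, Fin.ext_iff, Fin.val_zero] at hr
        grind
      have hr2 := r.2
      let p : Fin (n + 1) := ⟨((r - 1 : Fin (n + 2)) : ℕ), by omega⟩
      have hp : (p : ℕ) = ((r - 1 : Fin (n + 2)) : ℕ) := rfl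
      have hp1 := val_add_one' p
      let z : Fin (n + 1) → C := fun i => x (if (i : ℕ) < r then i.castSucc else i.succ)
      have f1 : faceFun op (r - 1) x = Function.update z p (z p * x r) := by
        funext i
        have hi := i.2
        rw [Function.update_apply]
        unfold faceFun
        rw [sub_add_cancel, h2 _ hx]
        by_cases e : i = p
        · rw [if_pos (Or.inl (by rw [e, hp])), if_pos e]
          have : (if (p : ℕ) < r then p.castSucc else p.succ) = r - 1 := by
            rw [if_pos (by omega)]
            ext
            simp [hp]
          rw [show z p = x (r - 1) from congrArg x this]
        · rw [if_neg e]
          rw [Fin.ext_iff] at e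
          rw [if_neg (by rw [Fin.ext_iff, Fin.ext_iff, Fin.val_last]; omega), ← apply_ite x]
          have : ((i : ℕ) < ((r - 1 : Fin (n + 2)) : ℕ)) ↔ (i : ℕ) < r := by omega
          simp only [this, z]
      have f2 : faceFun op r x = Function.update z (p + 1) (x r * z (p + 1)) := by
        funext i
        have hi := i.2
        rw [Function.update_apply]
        unfold faceFun
        rw [h1 _ hx]
        have hri := val_add_one' r
        have hc : ((i : ℕ) = r ∨ (i = 0 ∧ r = Fin.last (n + 1))) ↔ i = p + 1 := by
          rw [Fin.ext_iff, Fin.ext_iff, Fin.ext_iff, Fin.val_last, Fin.val_zero]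
          grind
        by_cases e : i = p + 1
        · rw [if_pos (hc.2 e), if_pos e]
          have : (if ((p + 1 : Fin (n + 1)) : ℕ) < r then (p + 1).castSucc else (p + 1).succ)
              = r + 1 := by
            rw [Fin.ext_iff, apply_ite Fin.val, Fin.val_succ, Fin.val_castSucc]
            grind
          rw [show z (p + 1) = x (r + 1) from congrArg x this]
        · rw [if_neg (mt hc.1 e), if_neg e, ← apply_ite x]
      rw [face_apply, face_apply, f1, f2, cls_balanced K z p hx, ← add_smul]
      have : (-1 : k) ^ ((r - 1 : Fin (n + 2)) : ℕ) + (-1 : k) ^ (r : ℕ) = 0 := by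
        rw [hv, pow_succ]
        ring
      rw [this, zero_smul]
    · intro j _ hj
      rw [face_degenerate op j r x hr hx (Ne.symm hj.2) (fun e => hj.1 (by rw [e]; simp)),
        smul_zero]
    · simp
    · simp

end Cyc

/-! ### The normalized mixed complex of a `K`-algebra, and the relative one -/

section Hochschild

variable {k : Type u} [CommRing k] {C : Type v} [Ring C] [Algebra k C] (K : Subalgebra k C)
  {C' : Type w'} [Ring C'] [Algebra k C'] (K' : Subalgebra k C')

/-- The ambient module `∏_n C ⊗ C̄ ^ (⊗ n) ⊗`. -/
abbrev Chains : Type (max u v) := ∀ n : ℕ, NormChain K n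

/-- The class of `x_0 ⊗ ⋯ ⊗ x_n`, in degree `n` of the ambient module. -/
def tens (n : ℕ) (x : Fin (n + 1) → C) : Chains K := Pi.single n (cls K n x)

variable {K} {K'}

/-- The operator of degree `-1` with components `g n`; it is `0` on degree `0`. -/
def lowering (g : ∀ n, NormChain K (n + 1) →ₗ[k] NormChain K n) : Chains K →ₗ[k] Chains K :=
  LinearMap.pi fun n => g n ∘ₗ LinearMap.proj (n + 1)

/-- The operator of degree `0` with components `g n`. -/
def preserving (g : ∀ n, NormChain K n →ₗ[k] NormChain K' n) : Chains K →ₗ[k] Chains K' :=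
  LinearMap.pi fun n => g n ∘ₗ LinearMap.proj n

/-- The operator of degree `1` with components `g n`. -/
def raising (g : ∀ n, NormChain K n →ₗ[k] NormChain K (n + 1)) : Chains K →ₗ[k] Chains K :=
  LinearMap.pi fun n =>
    match n with
    | 0 => 0
    | n + 1 => g n ∘ₗ LinearMap.proj n

theorem isBalancedOp_mul (K : Subalgebra k C) : IsBalancedOp K (LinearMap.mul k C) where
  left c _ x y := by simp [mul_assoc]
  mid c _ x y := by simp [mul_assoc]
  right c _ x y := by simp [mul_assoc]

theorem isBimodMap_id (K : Subalgebra k C) : IsBimodMap K K id (LinearMap.id : C →ₗ[k] C) :=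
  ⟨fun _ h => h, fun _ _ _ => rfl, fun _ _ _ => rfl⟩

theorem isBimodMap_algHom (f : C →ₐ[k] C') (hf : K.map f ≤ K') :
    IsBimodMap K K' f f.toLinearMap :=
  ⟨fun c h => hf ⟨c, h, rfl⟩, fun _ _ _ => map_mul f _ _, fun _ _ _ => map_mul f _ _⟩

variable (K)

/-- The Hochschild boundary `∑_j (-1) ^ j x_0 ⊗ ⋯ ⊗ x_j x_{j+1} ⊗ ⋯` (cyclically). -/
def hochB : Chains K →ₗ[k] Chains K :=
  lowering fun n => descend (∑ j : Fin (n + 2), (-1 : k) ^ (j : ℕ) • face K (LinearMap.mul k C) j)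
    (boundary_descends (isBalancedOp_mul K) n (fun _ _ _ => rfl) (fun _ _ _ => rfl))

/-- The Connes operator `∑_i (-1) ^ (i n) 1 ⊗ x_i ⊗ ⋯ ⊗ x_n ⊗ x_0 ⊗ ⋯ ⊗ x_{i-1}`. -/
def connes : Chains K →ₗ[k] Chains K :=
  raising fun n =>
    descend (∑ i : Fin (n + 1), (-1 : k) ^ ((i : ℕ) * n) •
        unitRotWord K (fun _ => (LinearMap.id : C →ₗ[k] C)) i)
      (Descends.sum fun _ _ => Descends.smul
        (unitRotWord_descends (fun _ => isBimodMap_id K) fun _ _ _ h => h) _)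

variable {K}

/-- The map induced by an algebra morphism `f` with `f (K) ⊆ K'`. -/
def chainsMap (f : C →ₐ[k] C') (hf : K.map f ≤ K') : Chains K →ₗ[k] Chains K' :=
  preserving fun _ => descend (rotWord K' (fun _ => f.toLinearMap) 0)
    (rotWord_descends (fun _ => isBimodMap_algHom f hf) fun _ hi c hc =>
      ⟨hf ⟨c, hc, rfl⟩, fun h => (hi h).elim⟩)

variable (K)

/-- The copy of `C ⊗ C̄ ^ (⊗ n) ⊗` inside the ambient module (zero if `n < 0`). -/
def degreePart (n : ℤ) : Submodule k (Chains K) :=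
  Submodule.pi {m : ℕ | (m : ℤ) ≠ n} fun _ => ⊥

/-- The normalized mixed complex of the `K`-algebra `C`. -/
def canonicalMixed : MixedDiagram k (Chains K) where
  X := degreePart K
  b _ := hochB K
  B _ := connes K

variable {K}

/-- The kernel of the map of normalized mixed complexes induced by `f`. For surjective `f` with
`K' = f (K)` its homologies are those of the `K`-algebra `C` relative to the ideal `ker f`. -/
def relativeMixed (f : C →ₐ[k] C') (hf : K.map f ≤ K') : MixedDiagram k (Chains K) where
  X n := (canonicalMixed K).X n ⊓ LinearMap.ker (chainsMap f hf)
  b := (canonicalMixed K).b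
  B := (canonicalMixed K).B

end Hochschild

/-! ### Cleft extensions -/

section Cleft

open MulOpposite

/-- An associative `A`-bimodule map `▽ : M ⊗_A M → M`, given as a balanced map of two variables. The
right action of `a` on `m` is `op a • m`. -/
structure AssocBimoduleMap (k : Type u) (A : Type v) (M : Type w) [CommRing k] [Ring A]
    [Algebra k A] [AddCommGroup M] [Module k M] [Module A M] [Module Aᵐᵒᵖ M] where
  toFun : M →ₗ[k] M →ₗ[k] M
  balanced : ∀ (a : A) (m m' : M), toFun (op a • m) m' = toFun m (a • m')
  map_left : ∀ (a : A) (m m' : M), toFun (a • m) m' = a • toFun m m'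
  map_right : ∀ (a : A) (m m' : M), toFun m (op a • m') = op a • toFun m m'
  assoc : ∀ m m' m'' : M, toFun (toFun m m') m'' = toFun m (toFun m' m'')

variable {k : Type u} {A : Type v} {M : Type w} [CommRing k] [Ring A] [Algebra k A]
  [AddCommGroup M] [Module k M] [Module A M] [Module Aᵐᵒᵖ M]

/-- The cleft extension `A ⋉_▽ M`, with `(a, m) (a', m') = (a a', a m' + m a' + m ▽ m')`. -/
def CleftExt (_T : AssocBimoduleMap k A M) : Type (max v w) := A × M

namespace CleftExt

variable (T : AssocBimoduleMap k A M)

instance : AddCommGroup (CleftExt T) := inferInstanceAs (AddCommGroup (A × M))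
instance : Module k (CleftExt T) := inferInstanceAs (Module k (A × M))

variable {T}

/-- The element `(a, m)`. -/
def mk (a : A) (m : M) : CleftExt T := (a, m)
/-- The component in `A`. -/
def fst (x : CleftExt T) : A := Prod.fst x
/-- The component in `M`. -/
def snd (x : CleftExt T) : M := Prod.snd x

theorem ext {x y : CleftExt T} (h1 : x.fst = y.fst) (h2 : x.snd = y.snd) : x = y :=
  Prod.ext h1 h2

@[simp] theorem fst_mk (a : A) (m : M) : (mk a m : CleftExt T).fst = a := rfl
@[simp] theorem snd_mk (a : A) (m : M) : (mk a m : CleftExt T).snd = m := rfl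
@[simp] theorem fst_add (x y : CleftExt T) : (x + y).fst = x.fst + y.fst := rfl
@[simp] theorem snd_add (x y : CleftExt T) : (x + y).snd = x.snd + y.snd := rfl
@[simp] theorem fst_zero : (0 : CleftExt T).fst = 0 := rfl
@[simp] theorem snd_zero : (0 : CleftExt T).snd = 0 := rfl
@[simp] theorem fst_smul (c : k) (x : CleftExt T) : (c • x).fst = c • x.fst := rfl
@[simp] theorem snd_smul (c : k) (x : CleftExt T) : (c • x).snd = c • x.snd := rfl

instance : One (CleftExt T) := ⟨mk 1 0⟩
instance : Mul (CleftExt T) :=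
  ⟨fun x y => mk (x.fst * y.fst) (x.fst • y.snd + op y.fst • x.snd + T.toFun x.snd y.snd)⟩

@[simp] theorem fst_one : (1 : CleftExt T).fst = 1 := rfl
@[simp] theorem snd_one : (1 : CleftExt T).snd = 0 := rfl
@[simp] theorem fst_mul (x y : CleftExt T) : (x * y).fst = x.fst * y.fst := rfl
@[simp] theorem snd_mul (x y : CleftExt T) :
    (x * y).snd = x.fst • y.snd + op y.fst • x.snd + T.toFun x.snd y.snd := rfl

variable [SMulCommClass A Aᵐᵒᵖ M] [IsScalarTower k A M] [IsScalarTower k Aᵐᵒᵖ M]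

instance : Ring (CleftExt T) :=
  { (inferInstance : AddCommGroup (CleftExt T)),
    (inferInstance : One (CleftExt T)),
    (inferInstance : Mul (CleftExt T)) with
    left_distrib := fun x y z => by
      apply ext <;> simp [mul_add, add_smul]; abel
    right_distrib := fun x y z => by
      apply ext <;> simp [add_mul, add_smul]; abel
    zero_mul := fun x => by apply ext <;> simp
    mul_zero := fun x => by apply ext <;> simp
    one_mul := fun x => by apply ext <;> simp
    mul_one := fun x => by apply ext <;> simp
    mul_assoc := fun x y z => by
      apply ext
      · simp [mul_assoc]
      · simp only [snd_mul, fst_mul, smul_add, map_add, LinearMap.add_apply, T.map_left,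
          T.map_right, T.balanced, T.assoc, op_mul, mul_smul]
        rw [smul_comm x.fst (op z.fst) y.snd]
        abel }

theorem smul_op_comm (c : k) (a : A) (m : M) : op a • c • m = c • op a • m := by
  rw [← algebraMap_smul A c m, ← algebraMap_smul A c (op a • m), smul_comm (algebraMap k A c)]

theorem smul_left_comm' (c : k) (a : A) (m : M) : a • c • m = c • a • m := by
  rw [← algebraMap_smul Aᵐᵒᵖ c m, ← algebraMap_smul Aᵐᵒᵖ c (a • m),
    smul_comm a (algebraMap k Aᵐᵒᵖ c)]

instance : Algebra k (CleftExt T) :=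
  Algebra.ofModule
    (fun c x y => by apply ext <;> simp [smul_op_comm])
    (fun c x y => by apply ext <;> simp [smul_left_comm'])

variable (T)

/-- The inclusion `a ↦ (a, 0)`. -/
def inl : A →ₐ[k] CleftExt T :=
  AlgHom.ofLinearMap
    { toFun := fun a => mk a 0
      map_add' := fun a b => by apply ext <;> simp
      map_smul' := fun a b => by apply ext <;> simp }
    rfl (fun a b => by apply ext <;> simp)

/-- The projection `(a, m) ↦ a`. -/
def proj : CleftExt T →ₐ[k] A :=
  AlgHom.ofLinearMap
    { toFun := fst
      map_add' := fun _ _ => rfl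
      map_smul' := fun _ _ => rfl }
    rfl (fun _ _ => rfl)

/-- The projection onto `A ⊆ A ⋉_▽ M`. -/
def piA : CleftExt T →ₗ[k] CleftExt T where
  toFun x := mk x.fst 0
  map_add' x y := by apply ext <;> simp
  map_smul' c x := by apply ext <;> simp

/-- The projection onto `M ⊆ A ⋉_▽ M`. -/
def piM : CleftExt T →ₗ[k] CleftExt T where
  toFun x := mk 0 x.snd
  map_add' x y := by apply ext <;> simp
  map_smul' c x := by apply ext <;> simp

/-- `A` as a submodule of `A ⋉_▽ M`. -/
def subA : Submodule k (CleftExt T) := LinearMap.range (inl T).toLinearMap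
/-- `M`, the kernel of the projection to `A`, as a submodule of `A ⋉_▽ M`. -/
def subM : Submodule k (CleftExt T) := LinearMap.ker (proj T).toLinearMap

/-- The bilinear operation `x ▽ y`, zero unless both arguments are in `M`. -/
def opTri : CleftExt T →ₗ[k] CleftExt T →ₗ[k] CleftExt T :=
  LinearMap.mk₂ k (fun x y => mk 0 (T.toFun x.snd y.snd))
    (fun x y z => by apply ext <;> simp) (fun c x y => by apply ext <;> simp)
    (fun x y z => by apply ext <;> simp) (fun c x y => by apply ext <;> simp)

/-- The bilinear operation `x y`: the product of `A`, the two actions on `M`, and zero on `M × M`. -/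
def opMul : CleftExt T →ₗ[k] CleftExt T →ₗ[k] CleftExt T :=
  LinearMap.mk₂ k (fun x y => mk (x.fst * y.fst) (x.fst • y.snd + op y.fst • x.snd))
    (fun x y z => by apply ext <;> simp [add_mul, add_smul]; abel)
    (fun c x y => by apply ext <;> simp [smul_op_comm])
    (fun x y z => by apply ext <;> simp [mul_add, add_smul]; abel)
    (fun c x y => by apply ext <;> simp [smul_left_comm'])

/-- `(x, y) ↦ π_A (x) π_M (y)`; for `x ∈ A` this is `π_M (x y)`. -/
def opAct : CleftExt T →ₗ[k] CleftExt T →ₗ[k] CleftExt T :=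
  LinearMap.mk₂ k (fun x y => mk 0 (x.fst • y.snd))
    (fun x y z => by apply ext <;> simp [add_smul]) (fun c x y => by apply ext <;> simp)
    (fun x y z => by apply ext <;> simp)
    (fun c x y => by apply ext <;> simp [smul_left_comm'])

theorem mem_map_inl {K : Subalgebra k A} {c : CleftExt T} (hc : c ∈ K.map (inl T)) :
    c.snd = 0 := by
  obtain ⟨a, -, rfl⟩ := hc
  rfl

variable {T}

theorem isBimodMap_piA (K : Subalgebra k A) :
    IsBimodMap (K.map (inl T)) (K.map (inl T)) id (piA T) where
  mapsTo _ h := h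
  left c hc x := by apply ext <;> simp [piA, mem_map_inl T hc]
  right c hc x := by apply ext <;> simp [piA, mem_map_inl T hc]

theorem isBimodMap_piM (K : Subalgebra k A) :
    IsBimodMap (K.map (inl T)) (K.map (inl T)) id (piM T) where
  mapsTo _ h := h
  left c hc x := by apply ext <;> simp [piM, mem_map_inl T hc]
  right c hc x := by apply ext <;> simp [piM, mem_map_inl T hc]

theorem piA_of_mem {K : Subalgebra k A} {c : CleftExt T} (hc : c ∈ K.map (inl T)) :
    piA T c = c := ext rfl (mem_map_inl T hc).symm

theorem piM_of_mem {K : Subalgebra k A} {c : CleftExt T} (hc : c ∈ K.map (inl T)) :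
    piM T c = 0 := ext rfl (mem_map_inl T hc : c.snd = 0)

theorem isBalancedOp_opTri (K : Subalgebra k A) : IsBalancedOp (K.map (inl T)) (opTri T) where
  left c hc x y := by apply ext <;> simp [opTri, mem_map_inl T hc, T.map_left]
  mid c hc x y := by apply ext <;> simp [opTri, mem_map_inl T hc, T.balanced]
  right c hc x y := by apply ext <;> simp [opTri, mem_map_inl T hc, T.map_right]

theorem opTri_left {K : Subalgebra k A} {c : CleftExt T} (hc : c ∈ K.map (inl T))
    (x : CleftExt T) : opTri T c x = 0 := by
  apply ext <;> simp [opTri, mem_map_inl T hc]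

theorem opTri_right {K : Subalgebra k A} {c : CleftExt T} (hc : c ∈ K.map (inl T))
    (x : CleftExt T) : opTri T x c = 0 := by
  apply ext <;> simp [opTri, mem_map_inl T hc]

theorem isBalancedOp_opMul (K : Subalgebra k A) : IsBalancedOp (K.map (inl T)) (opMul T) where
  left c hc x y := by
    apply ext <;> simp [opMul, mem_map_inl T hc, mul_assoc, mul_smul, smul_comm c.fst (op _)]
  mid c hc x y := by apply ext <;> simp [opMul, mem_map_inl T hc, mul_assoc, mul_smul]
  right c hc x y := by
    apply ext <;> simp [opMul, mem_map_inl T hc, mul_assoc, mul_smul, smul_comm x.fst (op _)]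

theorem isBalancedOp_opAct (K : Subalgebra k A) : IsBalancedOp (K.map (inl T)) (opAct T) where
  left c hc x y := by apply ext <;> simp [opAct, mem_map_inl T hc, mul_smul]
  mid c hc x y := by apply ext <;> simp [opAct, mem_map_inl T hc, mul_smul]
  right c hc x y := by apply ext <;> simp [opAct, mem_map_inl T hc, smul_comm x.fst (op _)]

theorem opMul_left {K : Subalgebra k A} {c : CleftExt T} (hc : c ∈ K.map (inl T))
    (x : CleftExt T) : opMul T c x = c * x := by
  apply ext <;> simp [opMul, mem_map_inl T hc]

theorem opMul_right {K : Subalgebra k A} {c : CleftExt T} (hc : c ∈ K.map (inl T))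
    (x : CleftExt T) : opMul T x c = x * c := by
  apply ext <;> simp [opMul, mem_map_inl T hc]

theorem opAct_right {K : Subalgebra k A} {c : CleftExt T} (hc : c ∈ K.map (inl T))
    (x : CleftExt T) : opAct T x c = 0 := by
  apply ext <;> simp [opAct, mem_map_inl T hc]

end CleftExt

open CleftExt

variable [SMulCommClass A Aᵐᵒᵖ M] [IsScalarTower k A M] [IsScalarTower k Aᵐᵒᵖ M]
variable (T : AssocBimoduleMap k A M) (K : Subalgebra k A)

/-- `K` as a subalgebra of `A ⋉_▽ M`. -/
abbrev baseSub : Subalgebra k (CleftExt T) := K.map (inl T)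

/-- `∑_{j=0}^n μ_j`, with the bilinear operation `x y`; on `X` this is the boundary `b`. -/
def muSum : Chains (baseSub T K) →ₗ[k] Chains (baseSub T K) :=
  lowering fun n =>
    descend (∑ j : Fin (n + 2), (-1 : k) ^ (j : ℕ) • face (baseSub T K) (opMul T) j)
      (boundary_descends (isBalancedOp_opMul K) n (fun _ h x => opMul_left h x)
        (fun _ h x => opMul_right h x))

/-- `μ_0^M`: on tensors with `x_0 ∈ A`, `x_0 ⊗ ⋯ ⊗ x_n ↦ π_M (x_0 x_1) ⊗ x_2 ⊗ ⋯ ⊗ x_n`. -/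
def muZeroM : Chains (baseSub T K) →ₗ[k] Chains (baseSub T K) :=
  lowering fun n =>
    descend (face (baseSub T K) (opAct T) (0 : Fin (n + 2)))
      (face_descends (isBalancedOp_opAct K) 0 (fun h => (h rfl).elim)
        (fun _ h x => opAct_right h x))

/-- `d = ∑_{j=0}^n ϱ_j`, with the bilinear operation `x ▽ y`. -/
def rhoD : Chains (baseSub T K) →ₗ[k] Chains (baseSub T K) :=
  lowering fun n =>
    descend (∑ j : Fin (n + 2), (-1 : k) ^ (j : ℕ) • face (baseSub T K) (opTri T) j)
      (Descends.sum fun j _ => Descends.smul (face_descends (isBalancedOp_opTri K) j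
        (fun _ _ h x => opTri_left h x) (fun _ h x => opTri_right h x)) _)

/-- `d' = ∑_{j=0}^{n-1} ϱ_j`, with the bilinear operation `x ▽ y`. -/
def rhoD' : Chains (baseSub T K) →ₗ[k] Chains (baseSub T K) :=
  lowering fun n =>
    descend (∑ j : Fin (n + 1), (-1 : k) ^ (j : ℕ) • face (baseSub T K) (opTri T) j.castSucc)
      (Descends.sum fun j _ => Descends.smul (face_descends (isBalancedOp_opTri K) j.castSucc
        (fun _ _ h x => opTri_left h x) (fun _ h x => opTri_right h x)) _)

/-- `p` on the factor with index `0`, the identity on the others. -/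
def slotProj (p : CleftExt T →ₗ[k] CleftExt T) {n : ℕ} (i : Fin (n + 1)) :
    CleftExt T →ₗ[k] CleftExt T := if i = 0 then p else LinearMap.id

theorem slotProj_descends {p : CleftExt T →ₗ[k] CleftExt T}
    (hp : IsBimodMap (baseSub T K) (baseSub T K) id p) (n : ℕ) :
    Descends (baseSub T K) (rotWord (baseSub T K) (slotProj T p (n := n)) 0) := by
  refine rotWord_descends (φ := id) (fun i => ?_) fun i hi c hc => ?_
  · unfold slotProj
    split_ifs
    exacts [hp, isBimodMap_id _]
  · simp only [slotProj, if_neg hi]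
    exact ⟨hc, fun h => (hi h).elim⟩

/-- The projection of the factor with index `0` to `M`. -/
def headM : Chains (baseSub T K) →ₗ[k] Chains (baseSub T K) :=
  preserving fun n => descend (rotWord (baseSub T K) (slotProj T (piM T) (n := n)) 0)
    (slotProj_descends T K (isBimodMap_piM K) n)

/-- The projection of the factor with index `0` to `A`. -/
def headA : Chains (baseSub T K) →ₗ[k] Chains (baseSub T K) :=
  preserving fun n => descend (rotWord (baseSub T K) (slotProj T (piA T) (n := n)) 0)
    (slotProj_descends T K (isBimodMap_piA K) n)

/-- The factor `r` of the projection onto the span of the tensors `x_0 ⊗ ⋯ ⊗ x_n` with `x_i ∈ M` and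
`x_r ∈ A` for `r > i`. On a tensor whose factors are all in `A ∪ M` it is the identity if `i` is the
last index with `x_i ∈ M`, and zero otherwise. -/
def lastProj {n : ℕ} (i r : Fin (n + 1)) : CleftExt T →ₗ[k] CleftExt T :=
  if r < i then LinearMap.id else if r = i then piM T else piA T

theorem lastProj_bimod {n : ℕ} (i r : Fin (n + 1)) :
    IsBimodMap (baseSub T K) (baseSub T K) id (lastProj T i r) := by
  unfold lastProj
  split_ifs
  exacts [isBimodMap_id _, isBimodMap_piM K, isBimodMap_piA K]

theorem lastProj_mem {n : ℕ} (i r : Fin (n + 1)) {c : CleftExt T} (hc : c ∈ baseSub T K) :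
    lastProj T i r c ∈ baseSub T K ∧ (r = i → lastProj T i r c = 0) := by
  unfold lastProj
  split_ifs with h1 h2
  · exact ⟨hc, fun h => (h1.ne h).elim⟩
  · rw [piM_of_mem hc]
    exact ⟨zero_mem _, fun _ => rfl⟩
  · rw [piA_of_mem hc]
    exact ⟨hc, fun h => (h2 h).elim⟩

/-- `t (x_0 ⊗ ⋯ ⊗ x_n) = (-1) ^ (i n) x_i ⊗ ⋯ ⊗ x_n ⊗ x_0 ⊗ ⋯ ⊗ x_{i-1}`, where all factors are in
`A ∪ M` and `i` is the last index with `x_i ∈ M`. -/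
def tOp : Chains (baseSub T K) →ₗ[k] Chains (baseSub T K) :=
  preserving fun n =>
    descend (∑ i : Fin (n + 1), (-1 : k) ^ ((i : ℕ) * n) •
        rotWord (baseSub T K) (lastProj T i) i)
      (Descends.sum fun i _ => Descends.smul
        (rotWord_descends (lastProj_bimod T K i) fun r _ _ hc => lastProj_mem T K i r hc) _)

/-- `y ↦ ∑_{l=0}^{n-i} 1 ⊗ 𝔱 ^ l (y)` for `y = y_0 ⊗ ⋯ ⊗ y_n` with all factors in `A ∪ M`, where `i` is
the last index with `y_i ∈ M` and `𝔱 (y) = (-1) ^ n y_n ⊗ y_0 ⊗ ⋯ ⊗ y_{n-1}`. -/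
def varthetaOne : Chains (baseSub T K) →ₗ[k] Chains (baseSub T K) :=
  raising fun n =>
    descend (∑ i : Fin (n + 1), ∑ l ∈ Finset.range (n - (i : ℕ) + 1), (-1 : k) ^ (l * n) •
        unitRotWord (baseSub T K) (lastProj T i) (-Fin.ofNat (n + 1) l))
      (Descends.sum fun i _ => Descends.sum fun _ _ => Descends.smul
        (unitRotWord_descends (lastProj_bimod T K i)
          fun r _ _ hc => (lastProj_mem T K i r hc).1) _)

/-- `N = ∑_{l=0}^w t ^ l` on `X_{v w}`. -/
def normOp (w : ℤ) : Chains (baseSub T K) →ₗ[k] Chains (baseSub T K) :=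
  ∑ l ∈ Finset.range (w.toNat + 1), tOp T K ^ l

/-- `F ⊗ B^n_r ⊗`: the span of the tensors with `x_0 ∈ F` and, among `x_1, …, x_n`, exactly `r`
factors in `M` and the others in `A`. For `F = A` and `F = M` these are direct summands of
`E ⊗ Ē ^ (⊗ n) ⊗`, because `E = A ⊕ M` and `Ē = Ā ⊕ M` as `K`-bimodules. -/
def tensorPart (F : Submodule k (CleftExt T)) (n r : ℤ) : Submodule k (Chains (baseSub T K)) :=
  Submodule.span k {z | ∃ (n' : ℕ) (S : Finset (Fin n')) (x : Fin (n' + 1) → CleftExt T),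
    (n' : ℤ) = n ∧ (S.card : ℤ) = r ∧ x 0 ∈ F ∧ (∀ i ∈ S, x i.succ ∈ subM T) ∧
      (∀ i ∉ S, x i.succ ∈ subA T) ∧ z = tens (baseSub T K) n' x}

/-- `X_{v w} = M ⊗ B^{v+w}_w ⊗`. -/
def XPart (v w : ℤ) : Submodule k (Chains (baseSub T K)) :=
  if 0 ≤ v ∧ 0 ≤ w then tensorPart T K (subM T) (v + w) w else ⊥

/-- `A ⊗ B^{v+w}_{w+1} ⊗`. -/
def YPart (v w : ℤ) : Submodule k (Chains (baseSub T K)) :=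
  if 0 ≤ v ∧ 0 ≤ w then tensorPart T K (subA T) (v + w) (w + 1) else ⊥

/-- The diagram `(X̂, b̂, d̂, B̂)`: `X̂_{v w} = X_{v w} ⊕ X_{v-1, w}`,
`b̂ (x, y) = (b x + (1 - t) y, - b y)`, `d̂ (x, y) = (d x, - d' y)`, `B̂ (x, y) = (0, N x)`. -/
def XHat : DoubleMixedDiagram k (Chains (baseSub T K) × Chains (baseSub T K)) where
  X v w := (XPart T K v w).prod (XPart T K (v - 1) w)
  b _ _ := ((muSum T K).coprod (LinearMap.id - tOp T K)).prod
    (-(muSum T K ∘ₗ LinearMap.snd k _ _))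
  β _ _ := (rhoD T K).prodMap (-rhoD' T K)
  B _ w := LinearMap.prod 0 (normOp T K w ∘ₗ LinearMap.fst k _ _)

/-- The canonical diagram: in bidegree `(v, w)` it is `(M ⊗ B^n_w ⊗) ⊕ (A ⊗ B^n_{w+1} ⊗)`, `n = v + w`,
with the operators `(x, y) ↦ (b x + α y, b¹ y)`, `(x, y) ↦ (∑ ϱ_j x, ∑ ϱ_j y)` and
`(x, y) ↦ (0, B x + B y)`. Here `b¹ = μ_0^A + μ_1 + ⋯ + μ_{n-1} + μ_n^A` and `α = μ_0^M + μ_n^M` are the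
components of `∑ μ_j` on `A ⊗ B^n_{w+1} ⊗` that have their factor with index `0` in `A`, and in `M`. -/
def canonicalHat : DoubleMixedDiagram k (Chains (baseSub T K) × Chains (baseSub T K)) where
  X v w := (XPart T K v w).prod (YPart T K v w)
  b _ _ := ((muSum T K).coprod (headM T K ∘ₗ muSum T K)).prod
    (headA T K ∘ₗ muSum T K ∘ₗ LinearMap.snd k _ _)
  β _ _ := (rhoD T K).prodMap (rhoD T K)
  B _ _ := LinearMap.prod 0 ((connes (baseSub T K)).coprod (connes (baseSub T K)))

/-- `θ̂ (x, y) = (x + t y, μ_0^M y)`. -/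
def thetaHat (_v _w : ℤ) : Chains (baseSub T K) × Chains (baseSub T K) →ₗ[k]
    Chains (baseSub T K) × Chains (baseSub T K) :=
  (LinearMap.id.coprod (tOp T K)).prod (muZeroM T K ∘ₗ LinearMap.snd k _ _)

/-- `ϑ̂ (x, y) = (x, ∑_l 1 ⊗ 𝔱 ^ l (y))`. -/
def varthetaHat (_v _w : ℤ) : Chains (baseSub T K) × Chains (baseSub T K) →ₗ[k]
    Chains (baseSub T K) × Chains (baseSub T K) :=
  LinearMap.id.prodMap (varthetaOne T K)

theorem map_proj_le : (baseSub T K).map (proj T) ≤ K := by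
  rintro _ ⟨_, ⟨a, ha, rfl⟩, rfl⟩
  exact ha

/-- The mixed complex whose homologies are those of the `K`-algebra `A ⋉_▽ M` relative to `M`. -/
def relativeHoch : MixedDiagram k (Chains (baseSub T K)) :=
  relativeMixed (proj T) (map_proj_le T K)

/-- The identification of the total mixed complex of the canonical diagram with the relative one:
the sum of all components. -/
def assemble (n : ℤ) : (ℤ → Chains (baseSub T K) × Chains (baseSub T K)) →ₗ[k]
    Chains (baseSub T K) :=
  ∑ p ∈ Finset.Icc 0 n, (LinearMap.id.coprod LinearMap.id) ∘ₗ LinearMap.proj p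

end Cleft
end
end CleftHomology

open CleftHomology

/-! The proof rests on one computation with cyclic tensors. For a word $z$ put
$h_L(z)=\sum_{l=0}^{L}1\otimes\mathfrak t^l(z)$, with $\mathfrak t$ the signed rotation. In the
boundary of $h_L(z)$ the two outer faces telescope to $z-\mathfrak t^{L+1}(z)$. The inner faces can
be moved past the rotations, and each face of $z$ then reappears under $L+1$ or $L$ rotations,
according to its position (`sum_sface_rot_pow`, `IsBoundary.sum_unitCons`). For the full range of
rotations this says that the Connes operator anticommutes with the boundary.

Now let $L$ be the number of letters after the last letter in $M$. Then $h_L=\vartheta$ is the map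
`varthetaOne`, $\mathfrak t^{L+1}(z)=t(z)$, and the two counts are the numbers of rotations that
$\vartheta$ uses on a face before, respectively after, that letter. The only mismatch is the
wrap-around face when the final letter lies in $M$, and it accounts for the shape of the operators.
If $x_0\in M$, the product $x_nx_0$ is zero and $\varrho_n$ is absent from $d'$, so
$b\vartheta+\vartheta b=1-t$ and $d\vartheta=-\vartheta d'$. If $x_0\in A$, then $x_n\triangledown
x_0=0$, while $x_nx_0$ is the term $\mu_n^M$, absent from $b^1=\mu_0^A+\mu_1+\dots+\mu_n^A$. Taking
$\mu_0^M$ into account as well, $b\vartheta+\vartheta b^1=1-t-\vartheta\mu_0^M$ and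
$d\vartheta=-\vartheta d$. Moreover $\vartheta N=B$ on words that start in $M$, because the blocks
of rotations contributed by the powers of $t$ join up, and $B\vartheta=\vartheta B=0$,
$t\vartheta=0$, because a second factor $1$ is degenerate.

The structure statements follow formally. The product of $E$ is the sum of `opMul` and `opTri`, both
associative; hence $b^2=d^2=bd+db=0$, and together with $B$ all relations hold in `flatDiagram`. The
canonical diagram embeds there by adding components, and $\hat X$ embeds into the canonical diagram
by $\hat\vartheta$, since $\hat\theta\hat\vartheta=1$; both therefore inherit the relations. The map
$(x,y)\mapsto(0,\vartheta y)$ is a homotopy between $\hat\vartheta\hat\theta$ and the identity that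
anticommutes with $\hat{\mathfrak d}$ and $\hat{\mathfrak B}$ (`isHomotopy_homotopyHat`). This
forces $\hat\theta$ to be a morphism (`IsHom.of_isHomotopy`), and it induces homotopies on the
Hochschild complex and on the total complex of any set of columns.

Finally, $E=A\oplus M$ grades the cyclic tensors by the number of factors in $M$. The kernel of the
projection to $A$ is the sum of the parts of positive weight, and the part of degree $n$ and weight
$n-p+1$ is column $p$ of the canonical total complex (`bijOn_assemble`). -/

namespace CleftHomology

noncomputable section

open scoped TensorProduct

/-! ### Tensor powers over the ground ring -/

/-! ### Index combinatorics of words -/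

section Words

/-- The `j`-th cyclic face of a word with letters `w 0, …, w (n + 1)`. -/
def faceNat {α : Type*} (op : α → α → α) (n j : ℕ) (w : ℕ → α) (i : ℕ) : α :=
  if j = n + 1 then (if i = 0 then op (w (n + 1)) (w 0) else w i)
  else if i < j then w i else if i = j then op (w j) (w (j + 1)) else w (i + 1)

/-- The rotation of `w 0, …, w n` that moves the last `l` letters to the front. -/
def rotNat {α : Type*} (n l : ℕ) (w : ℕ → α) (i : ℕ) : α :=
  if i < l then w (n + 1 - l + i) else w (i - l)

/-- The word `a, w 0, w 1, …`. -/
def consNat {α : Type*} (a : α) (w : ℕ → α) (i : ℕ) : α :=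
  if i = 0 then a else w (i - 1)

/-- Words are functions on `ℕ` of which only an initial segment matters. The wrap-around is then
explicit, and identities of this kind are case distinctions in linear arithmetic. -/
theorem faceNat_rotNat_succ {α : Type*} (op : α → α → α) {n j : ℕ} (hj : j ≤ n) (w : ℕ → α)
    {i : ℕ} (hi : i ≤ n) :
    faceNat op n (j + 1) (rotNat (n + 1) 1 w) i = rotNat n 1 (faceNat op n j w) i := by
  simp only [faceNat, rotNat]
  grind

theorem faceNat_rotNat_zero {α : Type*} (op : α → α → α) {n : ℕ} (w : ℕ → α) (i : ℕ) :
    faceNat op n 0 (rotNat (n + 1) 1 w) i = faceNat op n (n + 1) w i := by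
  simp only [faceNat, rotNat]
  grind

/-- Associativity is needed only when the two faces are cyclically adjacent, which includes the
wrap-around face next to face `0`; otherwise the two contractions do not meet. -/
theorem faceNat_faceNat {α : Type*} {op : α → α → α}
    (hop : ∀ a b c, op (op a b) c = op a (op b c)) {n i j : ℕ}
    (hij : i < j) (hj : j ≤ n + 2) (w : ℕ → α) {r : ℕ} (hr : r ≤ n) :
    faceNat op n i (faceNat op (n + 1) j w) r =
      faceNat op n (j - 1) (faceNat op (n + 1) i w) r := by
  simp only [faceNat]
  grind

theorem rotNat_rotNat {α : Type*} {n l : ℕ} (hl : l ≤ n) (w : ℕ → α) (i : ℕ) :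
    rotNat n 1 (rotNat n l w) i = rotNat n (l + 1) w i := by
  simp only [rotNat]
  grind

end Words

section Tensor

variable {k : Type u} [CommRing k] {C : Type v} [Ring C] [Algebra k C]

variable (k C) in
/-- The `(n + 1)`-fold tensor power of `C` over `k`. -/
abbrev TPow (n : ℕ) : Type (max u v) := ⨂[k] _ : Fin (n + 1), C

variable (k) in
/-- The tensor `w 0 ⊗ ⋯ ⊗ w n`. -/
def word (n : ℕ) (w : ℕ → C) : TPow k C n :=
  PiTensorProduct.tprod k fun i : Fin (n + 1) => w i

theorem word_congr {n : ℕ} {w w' : ℕ → C} (h : ∀ i ≤ n, w i = w' i) : word k n w = word k n w' :=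
  congrArg (PiTensorProduct.tprod k) (funext fun i : Fin (n + 1) => h i (Nat.lt_succ_iff.1 i.2))

/-- The extension of a finite word to a function on `ℕ`. -/
def extendWord {α : Type*} {n : ℕ} (x : Fin (n + 1) → α) (i : ℕ) : α := x (Fin.ofNat (n + 1) i)

@[simp] theorem extendWord_val {α : Type*} {n : ℕ} (x : Fin (n + 1) → α) (i : Fin (n + 1)) :
    extendWord x i = x i := by
  simp [extendWord]

theorem word_extendWord {n : ℕ} (x : Fin (n + 1) → C) :
    word k n (extendWord x) = PiTensorProduct.tprod k x :=
  congrArg _ (funext fun i => extendWord_val x i)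

theorem tpow_hom_ext {n : ℕ} {N : Type*} [AddCommGroup N] [Module k N] {f g : TPow k C n →ₗ[k] N}
    (h : ∀ w : ℕ → C, f (word k n w) = g (word k n w)) : f = g :=
  PiTensorProduct.ext (MultilinearMap.ext fun x => by
    simpa [word_extendWord] using h (extendWord x))

theorem word_eq_zero {n : ℕ} {w : ℕ → C} {i : ℕ} (hi : i ≤ n) (h : w i = 0) : word k n w = 0 :=
  (PiTensorProduct.tprod k).map_coord_zero (⟨i, by omega⟩ : Fin (n + 1)) h

/-- The signed cyclic rotation `x_0 ⊗ ⋯ ⊗ x_n ↦ (-1) ^ n x_n ⊗ x_0 ⊗ ⋯ ⊗ x_{n-1}`. -/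
def rot (n : ℕ) : TPow k C n →ₗ[k] TPow k C n :=
  (-1 : k) ^ n • (PiTensorProduct.reindex k (fun _ => C) (Equiv.addRight (1 : Fin (n + 1)))).toLinearMap

theorem val_sub_one {n : ℕ} (i : Fin (n + 1)) :
    ((i - 1 : Fin (n + 1)) : ℕ) = if (i : ℕ) = 0 then n else (i : ℕ) - 1 := by
  have := val_add_one' (i - 1)
  rw [sub_add_cancel] at this
  have h2 := (i - 1).2
  grind

theorem rot_word (n : ℕ) (w : ℕ → C) :
    rot n (word k n w) = (-1 : k) ^ n • word k n (rotNat n 1 w) := by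
  simp only [rot, LinearMap.smul_apply, word, LinearEquiv.coe_coe, PiTensorProduct.reindex_tprod]
  congr 2
  funext i
  simp only [Equiv.addRight_symm, Equiv.coe_addRight, ← sub_eq_add_neg, val_sub_one, rotNat]
  grind

theorem rot_pow_word (n l : ℕ) (hl : l ≤ n + 1) (w : ℕ → C) :
    (rot n ^ l) (word k n w) = (-1 : k) ^ (l * n) • word k n (rotNat n l w) := by
  induction l with
  | zero =>
    rw [pow_zero, Module.End.one_apply, zero_mul, pow_zero, one_smul]
    exact word_congr fun i _ => by simp [rotNat]
  | succ l ih =>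
    rw [pow_succ', Module.End.mul_apply, ih (by omega), map_smul, rot_word, smul_smul, ← pow_add,
      word_congr fun i _ => rotNat_rotNat (by omega) w i]
    congr 2
    ring

/-- A full turn carries the sign $(-1)^{n(n+1)}=1$. -/
theorem rot_pow_card (n : ℕ) (z : TPow k C n) : (rot n ^ (n + 1)) z = z := by
  have : (rot n ^ (n + 1) : TPow k C n →ₗ[k] TPow k C n) = LinearMap.id := by
    refine tpow_hom_ext fun w => ?_
    rw [rot_pow_word n _ le_rfl, Even.neg_one_pow, one_smul]
    · refine word_congr fun i hi => ?_
      simp only [rotNat]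
      rw [if_pos (by omega)]
      congr 1
      omega
    · rw [mul_comm]; exact Nat.even_mul_succ_self n
  rw [this]; rfl

/-- The unsigned `j`-th face with values in the tensor power. -/
def faceTensor (op : C →ₗ[k] C →ₗ[k] C) {n : ℕ} (j : Fin (n + 2)) :
    MultilinearMap k (fun _ : Fin (n + 2) => C) (TPow k C n) :=
  MultilinearMap.mk' (fun x => PiTensorProduct.tprod k (faceFun op j x))
    (by
      intro x r a b
      simp only [faceFun_update]
      rw [← MultilinearMap.map_update_add]
      congr 2
      split_ifs <;> simp)
    (by
      intro x r c a
      simp only [faceFun_update]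
      rw [← MultilinearMap.map_update_smul]
      congr 2
      split_ifs <;> simp)

theorem faceFun_eq_faceNat (op : C →ₗ[k] C →ₗ[k] C) {n : ℕ} (j : Fin (n + 2)) (w : ℕ → C)
    (i : Fin (n + 1)) :
    faceFun op j (fun i => w i) i = faceNat (fun a b => op a b) n j w i := by
  have hj := j.2
  have hi := i.2
  simp only [faceFun, faceNat, val_add_one', Fin.ext_iff, Fin.val_last, Fin.val_zero,
    Fin.val_castSucc, Fin.val_succ]
  grind

/-- The signed `j`-th face `(-1) ^ j x_0 ⊗ ⋯ ⊗ op (x_j, x_{j+1}) ⊗ ⋯` for `j ≤ n + 1`. -/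
def sface (op : C →ₗ[k] C →ₗ[k] C) (n j : ℕ) : TPow k C (n + 1) →ₗ[k] TPow k C n :=
  (-1 : k) ^ j • PiTensorProduct.lift (faceTensor op (Fin.ofNat (n + 2) j))

theorem sface_word (op : C →ₗ[k] C →ₗ[k] C) {n j : ℕ} (hj : j ≤ n + 1) (w : ℕ → C) :
    sface op n j (word k (n + 1) w) =
      (-1 : k) ^ j • word k n (faceNat (fun a b => op a b) n j w) := by
  simp only [sface, LinearMap.smul_apply, word, PiTensorProduct.lift.tprod]
  congr 1
  change PiTensorProduct.tprod k (faceFun _ _ _) = _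
  congr 1
  funext i
  rw [faceFun_eq_faceNat]
  congr 1
  simp only [Fin.val_ofNat]
  exact Nat.mod_eq_of_lt (by omega)

variable (k C) in
/-- `z ↦ 1 ⊗ z`. -/
def unitCons (n : ℕ) : TPow k C n →ₗ[k] TPow k C (n + 1) :=
  PiTensorProduct.lift ((PiTensorProduct.tprod k (s := fun _ : Fin (n + 2) => C)).curryLeft 1)

theorem unitCons_word (n : ℕ) (w : ℕ → C) :
    unitCons k C n (word k n w) = word k (n + 1) (consNat 1 w) := by
  simp only [unitCons, word, PiTensorProduct.lift.tprod, MultilinearMap.curryLeft_apply]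
  congr 1
  funext i
  refine Fin.cases ?_ (fun i => ?_) i <;> simp [consNat]

/-! ### Cyclic relations between signed faces, rotations and the insertion of a unit -/

section Relations
variable (op : C →ₗ[k] C →ₗ[k] C) {n : ℕ}

/-- The signs built into `sface` and `rot` cancel here and in `sface_zero_rot`, so faces and
rotations can be interchanged below without any bookkeeping of signs. -/
theorem sface_succ_rot {j : ℕ} (hj : j ≤ n) (z : TPow k C (n + 1)) :
    sface op n (j + 1) (rot (n + 1) z) = rot n (sface op n j z) := by
  suffices sface op n (j + 1) ∘ₗ rot (n + 1) = rot n ∘ₗ sface op n j from LinearMap.congr_fun this z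
  refine tpow_hom_ext fun w => ?_
  simp only [LinearMap.comp_apply, rot_word, map_smul, sface_word op (Nat.succ_le_succ hj),
    sface_word op (Nat.le_succ_of_le hj), smul_smul]
  rw [word_congr fun i hi => faceNat_rotNat_succ _ hj w hi]
  congr 1
  rw [← pow_add, ← pow_add, Nat.succ_eq_add_one, add_right_comm n 1, ← add_assoc, pow_succ,
    pow_succ, add_comm n j]
  ring

theorem sface_zero_rot (z : TPow k C (n + 1)) :
    sface op n 0 (rot (n + 1) z) = sface op n (n + 1) z := by
  suffices sface op n 0 ∘ₗ rot (n + 1) = sface op n (n + 1) from LinearMap.congr_fun this z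
  refine tpow_hom_ext fun w => ?_
  simp only [LinearMap.comp_apply, rot_word, map_smul, sface_word op (Nat.zero_le _),
    sface_word op le_rfl, smul_smul]
  rw [word_congr fun i _ => faceNat_rotNat_zero _ w i]
  simp

theorem sface_rot_pow_of_le {j l : ℕ} (hl : l ≤ j) (hj : j ≤ n + 1) (z : TPow k C (n + 1)) :
    sface op n j ((rot (n + 1) ^ l) z) = (rot n ^ l) (sface op n (j - l) z) := by
  induction l generalizing j with
  | zero => simp
  | succ l ih =>
    obtain ⟨j, rfl⟩ : ∃ i, j = i + 1 := ⟨j - 1, by omega⟩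
    rw [pow_succ', Module.End.mul_apply, sface_succ_rot op (by omega), ih (by omega) (by omega),
      pow_succ', Module.End.mul_apply, Nat.add_sub_add_right]

/-- After `j` rotations have passed through, the face index is `0`; the next rotation turns face `0`
into the last face and leaves nothing outside, whence the exponent `l - 1`. The remaining `l - j -
1` rotations lower the index from `n + 1`. -/
theorem sface_rot_pow_of_lt {j l : ℕ} (hl : j < l) (hl' : l ≤ n + 2) (z : TPow k C (n + 1)) :
    sface op n j ((rot (n + 1) ^ l) z) = (rot n ^ (l - 1)) (sface op n (n + 2 - l + j) z) := by
  induction j generalizing l with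
  | zero =>
    obtain ⟨l, rfl⟩ : ∃ i, l = i + 1 := ⟨l - 1, by omega⟩
    rw [pow_succ', Module.End.mul_apply, sface_zero_rot,
      sface_rot_pow_of_le op (by omega) le_rfl, Nat.add_sub_cancel]
    congr 3
    omega
  | succ j ih =>
    obtain ⟨l, rfl⟩ : ∃ i, l = i + 2 := ⟨l - 2, by omega⟩
    rw [pow_succ', Module.End.mul_apply, sface_succ_rot op (by omega), ih (by omega) (by omega),
      ← Module.End.mul_apply, ← pow_succ']
    congr 3
    omega

theorem sface_sface (hop : ∀ a b c, op (op a b) c = op a (op b c)) {i j : ℕ} (hij : i < j)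
    (hj : j ≤ n + 2) (z : TPow k C (n + 2)) :
    sface op n i (sface op (n + 1) j z) = -sface op n (j - 1) (sface op (n + 1) i z) := by
  suffices sface op n i ∘ₗ sface op (n + 1) j = -(sface op n (j - 1) ∘ₗ sface op (n + 1) i) from
    LinearMap.congr_fun this z
  refine tpow_hom_ext fun w => ?_
  simp only [LinearMap.comp_apply, LinearMap.neg_apply]
  rw [sface_word op hj, sface_word op (by omega), map_smul, map_smul, sface_word op (by omega),
    sface_word op (by omega), word_congr fun i hi => faceNat_faceNat hop hij hj w hi, smul_smul,
    smul_smul, ← neg_smul]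
  congr 1
  obtain ⟨j, rfl⟩ : ∃ i, j = i + 1 := ⟨j - 1, by omega⟩
  rw [Nat.add_sub_cancel]
  ring

theorem sface_unitCons_zero (h1 : ∀ a, op 1 a = a) (z : TPow k C n) :
    sface op n 0 (unitCons k C n z) = z := by
  suffices sface op n 0 ∘ₗ unitCons k C n = LinearMap.id from LinearMap.congr_fun this z
  refine tpow_hom_ext fun w => ?_
  simp only [LinearMap.comp_apply, unitCons_word, sface_word op (Nat.zero_le _), pow_zero,
    one_smul, LinearMap.id_apply]
  refine word_congr fun i hi => ?_
  simp only [faceNat, consNat]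
  grind

theorem sface_unitCons_last (h1 : ∀ a, op a 1 = a) (z : TPow k C n) :
    sface op n (n + 1) (unitCons k C n z) = -rot n z := by
  suffices sface op n (n + 1) ∘ₗ unitCons k C n = -rot n from LinearMap.congr_fun this z
  refine tpow_hom_ext fun w => ?_
  simp only [LinearMap.comp_apply, unitCons_word, sface_word op le_rfl,
    LinearMap.neg_apply, rot_word, pow_succ, mul_neg_one, neg_smul]
  congr 2
  refine word_congr fun i hi => ?_
  simp only [faceNat, consNat, rotNat]
  grind

theorem sface_unitCons_succ {j : ℕ} (hj : j ≤ n) (z : TPow k C (n + 1)) :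
    sface op (n + 1) (j + 1) (unitCons k C (n + 1) z) = -unitCons k C n (sface op n j z) := by
  suffices sface op (n + 1) (j + 1) ∘ₗ unitCons k C (n + 1) = -(unitCons k C n ∘ₗ sface op n j) from
    LinearMap.congr_fun this z
  refine tpow_hom_ext fun w => ?_
  simp only [LinearMap.comp_apply, unitCons_word, sface_word op (show j + 1 ≤ n + 1 + 1 by omega),
    LinearMap.neg_apply, sface_word op (show j ≤ n + 1 by omega), pow_succ, mul_neg_one, neg_smul,
    map_smul]
  congr 2
  refine word_congr fun i hi => ?_
  simp only [faceNat, consNat]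
  grind

/-- The sum over the faces that do not wrap around, summed over an initial segment of rotations. -/
theorem sum_sface_rot_pow {L : ℕ} (hL : L ≤ n + 1) (z : TPow k C (n + 1)) :
    ∑ l ∈ Finset.range (L + 1), ∑ j ∈ Finset.range (n + 1), sface op n j ((rot (n + 1) ^ l) z) =
      ∑ m ∈ Finset.range (n + 2),
        ∑ e ∈ Finset.range (if m < n + 1 - L then L + 1 else L), (rot n ^ e) (sface op n m z) := by
  induction L with
  | zero =>
    rw [Finset.sum_range_succ _ (n + 1)]
    simp only [zero_add, Finset.sum_range_one, pow_zero, Module.End.one_apply, Nat.sub_zero,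
      lt_irrefl, if_false, Finset.range_zero, Finset.sum_empty, add_zero]
    exact Finset.sum_congr rfl fun m hm => by simp [Finset.mem_range.1 hm]
  | succ L ih =>
    rw [Finset.sum_range_succ, ih (by omega)]
    -- Raising `L` by one adds one term for every face `m` except `m = n - L`. That face of `z`
    -- would come from the wrap-around face of the newly rotated tensor, and the inner sum over
    -- `range (n + 1)` omits it.
    have key : ∀ m ∈ Finset.range (n + 2),
        ∑ e ∈ Finset.range (if m < n + 1 - (L + 1) then L + 1 + 1 else L + 1),
            (rot n ^ e) (sface op n m z) =
          ∑ e ∈ Finset.range (if m < n + 1 - L then L + 1 else L), (rot n ^ e) (sface op n m z) +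
          (if m < n - L then (rot n ^ (L + 1)) (sface op n m z)
            else if m = n - L then 0 else (rot n ^ L) (sface op n m z)) := by
      intro m hm
      rcases lt_trichotomy m (n - L) with h | h | h
      · rw [if_pos (by omega), if_pos (by omega), if_pos h, Finset.sum_range_succ]
      · rw [if_neg (by omega), if_pos (by omega), if_neg (by omega), if_pos h, add_zero]
      · rw [if_neg (by omega), if_neg (by omega), if_neg (by omega), if_neg (by omega),
          Finset.sum_range_succ]
    rw [Finset.sum_congr rfl key, Finset.sum_add_distrib]
    congr 1
    -- The faces `j ≥ L + 1` of the rotated tensor produce the faces `m < n - L` of `z`, those with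
    -- `j ≤ L` the faces `m > n - L`. The ranges are cut accordingly.
    have e1 : n + 1 = (L + 1) + (n - L) := by omega
    have e2 : n + 2 = (n - L) + (1 + (L + 1)) := by omega
    conv_lhs => rw [Finset.sum_congr (congrArg _ e1) fun _ _ => rfl]
    conv_rhs => rw [Finset.sum_congr (congrArg _ e2) fun _ _ => rfl]
    rw [Finset.sum_range_add _ (L + 1), Finset.sum_range_add _ (n - L), Finset.sum_range_add _ 1,
      Finset.sum_range_one, add_comm]
    congr 1
    · refine Finset.sum_congr rfl fun m hm => ?_
      rw [Finset.mem_range] at hm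
      rw [if_pos hm, sface_rot_pow_of_le op (by omega) (by omega), Nat.add_sub_cancel_left]
    · rw [if_neg (by omega), if_pos (by omega), zero_add]
      refine Finset.sum_congr rfl fun m hm => ?_
      rw [Finset.mem_range] at hm
      rw [if_neg (by omega), if_neg (by omega), sface_rot_pow_of_lt op hm (by omega),
        Nat.add_sub_cancel]
      congr 3
      omega

/-- The simplicial identity pairs the term `(i, j)`, `i < j`, with `(j - 1, i)`; since the faces
carry signs, the two terms cancel. -/
theorem sum_sface_sface (hop : ∀ a b c, op (op a b) c = op a (op b c)) (z : TPow k C (n + 2)) :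
    ∑ i ∈ Finset.range (n + 2), ∑ j ∈ Finset.range (n + 3),
      sface op n i (sface op (n + 1) j z) = 0 := by
  rw [← Finset.sum_product']
  refine Finset.sum_involution
    (fun p _ => if p.1 < p.2 then (p.2 - 1, p.1) else (p.2, p.1 + 1)) ?_ ?_ ?_ ?_
  · rintro ⟨i, j⟩ h
    simp only [Finset.mem_product, Finset.mem_range] at h
    by_cases hij : i < j
    · simp only [hij, if_true]
      rw [sface_sface op hop hij (by omega), neg_add_cancel]
    · simp only [hij, if_false]
      rw [sface_sface op hop (show j < i + 1 by omega) (by omega), Nat.add_sub_cancel,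
        add_neg_cancel]
  · rintro ⟨i, j⟩ h -
    by_cases hij : i < j <;> simp only [hij, if_true, if_false, ne_eq, Prod.mk.injEq] <;> omega
  · rintro ⟨i, j⟩ h
    simp only [Finset.mem_product, Finset.mem_range] at h ⊢
    by_cases hij : i < j <;> simp only [hij, if_true, if_false] <;> omega
  · rintro ⟨i, j⟩ h
    by_cases hij : i < j
    · simp only [hij, if_true]
      rw [if_neg (by omega)]
      exact Prod.ext rfl (Nat.sub_add_cancel (by omega))
    · simp only [hij, if_false]
      rw [if_pos (by omega)]
      ext <;> simp

end Relations
end Tensor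

/-! ### Operators on normalized cyclic tensors -/

section Quotient

variable {k : Type u} [CommRing k] {C : Type v} [Ring C] [Algebra k C] (K : Subalgebra k C)
  {C' : Type w'} [Ring C'] [Algebra k C'] {K' : Subalgebra k C'}

/-- The class of a tensor, in degree `n` of the ambient module. -/
def chain (n : ℕ) : TPow k C n →ₗ[k] Chains K :=
  LinearMap.single k (fun n => NormChain K n) n ∘ₗ (cyclicRel K n).mkQ

theorem chain_apply (n : ℕ) (z : TPow k C n) :
    chain K n z = Pi.single n ((cyclicRel K n).mkQ z) := rfl

theorem tens_eq_chain (n : ℕ) (x : Fin (n + 1) → C) :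
    tens K n x = chain K n (word k n (extendWord x)) := by
  rw [word_extendWord]
  rfl

theorem chain_degenerate {n : ℕ} {w : ℕ → C} {i : ℕ} (h0 : i ≠ 0) (hi : i ≤ n) (h : w i ∈ K) :
    chain K n (word k n w) = 0 := by
  have := cls_degenerate K (fun i : Fin (n + 1) => w i) (i := ⟨i, by omega⟩)
    (by simpa [Fin.ext_iff] using h0) h
  rw [chain_apply]
  exact (congrArg _ this).trans (Pi.single_zero n)

/-- The elements of the ambient module with finitely many nonzero components. -/
def finChains : Submodule k (Chains K) := ⨆ n, LinearMap.range (chain K n)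

theorem chain_mem (n : ℕ) (z : TPow k C n) : chain K n z ∈ finChains K :=
  Submodule.mem_iSup_of_mem n ⟨z, rfl⟩

variable {K}

/-- The operators live on the product over all degrees, where words do not span. Identities are
therefore proved on `finChains`, which contains every homogeneous part that occurs. -/
theorem eq_of_mem_finChains {N : Type*} [AddCommGroup N] [Module k N] {f g : Chains K →ₗ[k] N}
    (h : ∀ n (z : TPow k C n), f (chain K n z) = g (chain K n z)) {x : Chains K}
    (hx : x ∈ finChains K) : f x = g x := by
  have : finChains K ≤ LinearMap.eqLocus f g := by
    refine iSup_le fun n => ?_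
    rintro _ ⟨z, rfl⟩
    exact h n z
  exact this hx

theorem lowering_chain_zero (g : ∀ n, NormChain K (n + 1) →ₗ[k] NormChain K n)
    (z : TPow k C 0) : lowering g (chain K 0 z) = 0 := by
  funext n
  simp [lowering, chain_apply]

theorem lowering_chain_succ (g : ∀ n, NormChain K (n + 1) →ₗ[k] NormChain K n) (n : ℕ)
    (z : TPow k C (n + 1)) :
    lowering g (chain K (n + 1) z) = Pi.single n (g n ((cyclicRel K (n + 1)).mkQ z)) := by
  funext m
  by_cases h : m = n
  · subst h
    simp [lowering, chain_apply]
  · have h' : m + 1 ≠ n + 1 := by omega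
    simp [lowering, chain_apply, Pi.single_eq_of_ne h, Pi.single_eq_of_ne h']

theorem preserving_chain (g : ∀ n, NormChain K n →ₗ[k] NormChain K' n) (n : ℕ)
    (z : TPow k C n) :
    preserving g (chain K n z) = Pi.single n (g n ((cyclicRel K n).mkQ z)) := by
  funext m
  by_cases h : m = n
  · subst h
    simp [preserving, chain_apply]
  · simp [preserving, chain_apply, Pi.single_eq_of_ne h]

theorem raising_chain (g : ∀ n, NormChain K n →ₗ[k] NormChain K (n + 1)) (n : ℕ)
    (z : TPow k C n) :
    raising g (chain K n z) = Pi.single (n + 1) (g n ((cyclicRel K n).mkQ z)) := by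
  funext m
  cases m with
  | zero => simp [raising]
  | succ m =>
    by_cases h : m = n
    · subst h
      simp [raising, chain_apply]
    · have h' : m + 1 ≠ n + 1 := by omega
      simp [raising, chain_apply, Pi.single_eq_of_ne h, Pi.single_eq_of_ne h']

theorem descend_mkQ {n : ℕ} {N : Type*} [AddCommGroup N] [Module k N]
    (f : MultilinearMap k (fun _ : Fin (n + 1) => C) N) (h : Descends K f) (z : TPow k C n) :
    descend f h ((cyclicRel K n).mkQ z) = PiTensorProduct.lift f z :=
  (cyclicRel K n).liftQ_apply _ _

theorem lift_word {n : ℕ} {N : Type*} [AddCommGroup N] [Module k N]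
    (f : MultilinearMap k (fun _ : Fin (n + 1) => C) N) (w : ℕ → C) :
    PiTensorProduct.lift f (word k n w) = f fun i => w i := by
  simp [word]

theorem single_cls (n : ℕ) (x : Fin (n + 1) → C) (w : ℕ → C) (h : ∀ i, x i = w i) :
    (Pi.single n (cls K n x) : Chains K) = chain K n (word k n w) := by
  have : x = fun i : Fin (n + 1) => w i := funext h
  rw [this]
  rfl

theorem single_face (op : C →ₗ[k] C →ₗ[k] C) {n : ℕ} (j : Fin (n + 2)) (w : ℕ → C) :
    (Pi.single n ((-1 : k) ^ (j : ℕ) • face K op j fun i => w i) : Chains K) =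
      chain K n (sface op n j (word k (n + 1) w)) := by
  rw [sface_word op (Nat.lt_succ_iff.1 j.2), map_smul,
    ← single_cls n _ _ fun i => faceFun_eq_faceNat op j w i]
  exact (LinearMap.single k (fun n => NormChain K n) n).map_smul _ _

/-- `D` is the alternating sum of all cyclic faces with respect to `op`. -/
structure IsBoundary (K : Subalgebra k C) (op : C →ₗ[k] C →ₗ[k] C)
    (D : Chains K →ₗ[k] Chains K) : Prop where
  zero : ∀ z, D (chain K 0 z) = 0
  succ : ∀ n z, D (chain K (n + 1) z) =
    chain K n (∑ j ∈ Finset.range (n + 2), sface op n j z)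

/-- The operators `hochB`, `muSum` and `rhoD` are all of this form, so that the square and the
boundary of $1\otimes z$ are computed once, for a general product. -/
theorem isBoundary_lowering (op : C →ₗ[k] C →ₗ[k] C)
    (h : ∀ n, Descends K (∑ j : Fin (n + 2), (-1 : k) ^ (j : ℕ) • face K op j)) :
    IsBoundary K op (lowering fun n => descend _ (h n)) where
  zero z := lowering_chain_zero _ z
  succ n z := by
    rw [lowering_chain_succ, descend_mkQ]
    suffices LinearMap.single k (fun n => NormChain K n) n ∘ₗ
        PiTensorProduct.lift (∑ j : Fin (n + 2), (-1 : k) ^ (j : ℕ) • face K op j) =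
        chain K n ∘ₗ ∑ j ∈ Finset.range (n + 2), sface op n j by
      simpa using LinearMap.congr_fun this z
    refine tpow_hom_ext fun w => ?_
    rw [LinearMap.comp_apply, lift_word, sum_apply, map_sum, LinearMap.comp_apply,
      LinearMap.sum_apply, map_sum, ← Fin.sum_univ_eq_sum_range
        (fun j => chain K n (sface op n j (word k (n + 1) w)))]
    exact Finset.sum_congr rfl fun j _ => single_face op j w

theorem IsBoundary.chain_mem {op : C →ₗ[k] C →ₗ[k] C} {D : Chains K →ₗ[k] Chains K}
    (hD : IsBoundary K op D) {x : Chains K} (hx : x ∈ finChains K) : D x ∈ finChains K := by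
  have : finChains K ≤ (finChains K).comap D := by
    refine iSup_le fun n => ?_
    rintro _ ⟨z, rfl⟩
    cases n with
    | zero => simp [hD.zero z]
    | succ n => simpa [hD.succ n z] using sum_mem fun i _ => CleftHomology.chain_mem K n _
  exact this hx

theorem IsBoundary.sq {op : C →ₗ[k] C →ₗ[k] C} {D : Chains K →ₗ[k] Chains K}
    (hD : IsBoundary K op D) (hop : ∀ a b c, op (op a b) c = op a (op b c)) {x : Chains K}
    (hx : x ∈ finChains K) : D (D x) = 0 := by
  refine eq_of_mem_finChains (f := D ∘ₗ D) (g := 0) (fun n z => ?_) hx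
  match n with
  | 0 => simp [hD.zero z]
  | 1 => simp only [LinearMap.comp_apply, hD.succ, zero_add, hD.zero, LinearMap.zero_apply]
  | n + 2 =>
    simp only [LinearMap.comp_apply, hD.succ, LinearMap.zero_apply, map_sum]
    rw [← map_zero (chain K n), ← sum_sface_sface op hop z]
    simp only [map_sum]
    exact Finset.sum_comm

theorem val_sub {n : ℕ} (i s : Fin (n + 1)) :
    ((i - s : Fin (n + 1)) : ℕ) = if (i : ℕ) < s then n + 1 - s + i else (i : ℕ) - s := by
  have hi := i.2
  have hs := s.2
  rw [Fin.val_sub]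
  split_ifs with h
  · rw [Nat.mod_eq_of_lt (by omega)]
  · rw [show n + 1 - (s : ℕ) + i = (i - s) + (n + 1) by omega, Nat.add_mod_right,
      Nat.mod_eq_of_lt (by omega)]

theorem val_add' {n : ℕ} (i s : Fin (n + 1)) :
    ((i + s : Fin (n + 1)) : ℕ) = if (i : ℕ) + s < n + 1 then (i : ℕ) + s else i + s - (n + 1) := by
  have hi := i.2
  have hs := s.2
  rw [Fin.val_add]
  split_ifs with h
  · rw [Nat.mod_eq_of_lt (by omega)]
  · rw [show (i : ℕ) + s = (i + s - (n + 1)) + (n + 1) by omega, Nat.add_mod_right,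
      Nat.mod_eq_of_lt (by omega)]
    omega

/-- Moving the factor of index `i` to the front is rotating `n + 1 - i` times; the two sign
conventions agree because $n(n+1)$ is even. -/
theorem neg_one_pow_rot {n i : ℕ} (hi : i ≤ n + 1) :
    (-1 : k) ^ (i * n) = (-1 : k) ^ ((n + 1 - i) * n) := by
  obtain ⟨m, hm⟩ : ∃ m, n + 1 = i + m := ⟨n + 1 - i, by omega⟩
  have h : Even ((i + m) * n) := by
    rw [← hm, mul_comm]
    exact Nat.even_mul_succ_self n
  rw [hm, Nat.add_sub_cancel_left]
  rw [add_mul] at h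
  rcases Nat.even_or_odd (i * n) with h1 | h1
  · rw [h1.neg_one_pow, ((Nat.even_add.1 h).1 h1).neg_one_pow]
  · rw [h1.neg_one_pow, Odd.neg_one_pow]
    rw [← Nat.not_even_iff_odd] at h1 ⊢
    exact fun h2 => h1 ((Nat.even_add.1 h).2 h2)

/-- A rotated word in terms of the signed rotation. -/
theorem single_rot {n : ℕ} (w : ℕ → C) (s : Fin (n + 1)) (x : Fin (n + 1) → C)
    (hx : ∀ j, x j = w (j + s : Fin (n + 1))) :
    (-1 : k) ^ ((s : ℕ) * n) • (Pi.single n (cls K n x) : Chains K) =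
      chain K n ((rot n ^ (n + 1 - s : ℕ)) (word k n w)) := by
  have hs := s.2
  rw [rot_pow_word n _ (by omega), map_smul, neg_one_pow_rot (show (s : ℕ) ≤ n + 1 by omega),
    single_cls n x _ fun j => ?_]
  rw [hx, val_add', rotNat]
  have hj := j.2
  split_ifs <;> (congr 1; omega)

theorem single_cons_rot {n : ℕ} (w : ℕ → C) {l : ℕ} (hl : l ≤ n + 1) (x : Fin (n + 1) → C)
    (hx : ∀ j : Fin (n + 1), x j = rotNat n l w j) :
    (-1 : k) ^ (l * n) • (Pi.single (n + 1) (cls K (n + 1) (Fin.cons 1 x)) : Chains K) =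
      chain K (n + 1) (unitCons k C n ((rot n ^ l) (word k n w))) := by
  rw [rot_pow_word n _ hl, map_smul, map_smul, unitCons_word, single_cls (n + 1) _ _ fun j => ?_]
  refine Fin.cases ?_ (fun i => ?_) j
  · simp [consNat]
  · simp [consNat, hx]

theorem connes_chain (n : ℕ) (z : TPow k C n) :
    connes K (chain K n z) =
      chain K (n + 1) (unitCons k C n (∑ l ∈ Finset.range (n + 1), (rot n ^ l) z)) := by
  rw [connes, raising_chain, descend_mkQ]
  suffices LinearMap.single k (fun n => NormChain K n) (n + 1) ∘ₗ
      PiTensorProduct.lift (∑ i : Fin (n + 1), (-1 : k) ^ ((i : ℕ) * n) •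
        unitRotWord K (fun _ => (LinearMap.id : C →ₗ[k] C)) i) =
      chain K (n + 1) ∘ₗ unitCons k C n ∘ₗ ∑ l ∈ Finset.range (n + 1), (rot n ^ l) by
    simpa using LinearMap.congr_fun this z
  refine tpow_hom_ext fun w => ?_
  have h1 : ∑ l ∈ Finset.range (n + 1), (rot n ^ l) (word k n w) =
      ∑ i ∈ Finset.range (n + 1), (rot n ^ (n + 1 - i)) (word k n w) := by
    rw [← Finset.sum_range_reflect fun l => (rot n ^ (n + 1 - l)) (word k n w)]
    rw [Finset.sum_range_succ', Finset.sum_range_succ, pow_zero, Module.End.one_apply]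
    congr 1
    · refine Finset.sum_congr rfl fun l hl => ?_
      rw [Finset.mem_range] at hl
      congr 2
      omega
    · rw [show n + 1 - (n + 1 - 1 - n) = n + 1 by omega, rot_pow_card]
  simp only [LinearMap.comp_apply, lift_word, sum_apply, LinearMap.sum_apply]
  rw [h1, map_sum, map_sum, map_sum, ← Fin.sum_univ_eq_sum_range
        (fun i => chain K (n + 1) (unitCons k C n ((rot n ^ (n + 1 - i)) (word k n w))))]
  refine Finset.sum_congr rfl fun i _ => ?_
  have hi := i.2
  rw [smul_apply, map_smul, neg_one_pow_rot (show (i : ℕ) ≤ n + 1 by omega),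
    unitRotWord_apply]
  refine single_cons_rot w (by omega) _ fun j => ?_
  rw [LinearMap.id_apply, val_add', rotNat]
  have hj := j.2
  split_ifs <;> (congr 1; omega)

theorem connes_mem {x : Chains K} (hx : x ∈ finChains K) : connes K x ∈ finChains K := by
  have : finChains K ≤ (finChains K).comap (connes K) := by
    refine iSup_le fun n => ?_
    rintro _ ⟨z, rfl⟩
    rw [Submodule.mem_comap, connes_chain]
    exact chain_mem K _ _
  exact this hx

/-- A rotation of `1 ⊗ z`, with a further unit in front, is degenerate. -/
theorem chain_unitCons_rot_unitCons {n l : ℕ} (hl : l ≤ n + 1) (z : TPow k C n) :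
    chain K (n + 2) (unitCons k C (n + 1) ((rot (n + 1) ^ l) (unitCons k C n z))) = 0 := by
  suffices chain K (n + 2) ∘ₗ unitCons k C (n + 1) ∘ₗ (rot (n + 1) ^ l) ∘ₗ unitCons k C n = 0 from
    LinearMap.congr_fun this z
  refine tpow_hom_ext fun w => ?_
  simp only [LinearMap.comp_apply, LinearMap.zero_apply]
  rw [unitCons_word, rot_pow_word _ _ (by omega), map_smul, map_smul, unitCons_word,
    chain_degenerate K (i := l + 1) (by omega) (by omega), smul_zero]
  have : consNat 1 (rotNat (n + 1) l (consNat 1 w)) (l + 1) = 1 := by simp [consNat, rotNat]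
  rw [this]
  exact one_mem K

theorem connes_unitCons (n : ℕ) (z : TPow k C n) :
    connes K (chain K (n + 1) (unitCons k C n z)) = 0 := by
  rw [connes_chain, map_sum, map_sum]
  exact Finset.sum_eq_zero fun l hl =>
    chain_unitCons_rot_unitCons (Nat.lt_succ_iff.1 (Finset.mem_range.1 hl)) z

theorem connes_connes {x : Chains K} (hx : x ∈ finChains K) : connes K (connes K x) = 0 := by
  refine eq_of_mem_finChains (f := connes K ∘ₗ connes K) (g := 0) (fun n z => ?_) hx
  rw [LinearMap.comp_apply, connes_chain, connes_unitCons, LinearMap.zero_apply]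

/-- The boundary of `1 ⊗ z`. -/
theorem IsBoundary.unitCons {op : C →ₗ[k] C →ₗ[k] C} {D : Chains K →ₗ[k] Chains K}
    (hD : IsBoundary K op D) (n : ℕ) (z : TPow k C (n + 1)) :
    D (chain K (n + 2) (unitCons k C (n + 1) z)) =
      chain K (n + 1) (sface op (n + 1) 0 (unitCons k C (n + 1) z)) +
      chain K (n + 1) (sface op (n + 1) (n + 2) (unitCons k C (n + 1) z)) -
      chain K (n + 1) (unitCons k C n (∑ j ∈ Finset.range (n + 1), sface op n j z)) := by
  rw [hD.succ, Finset.sum_range_succ, Finset.sum_range_succ',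
    Finset.sum_congr rfl fun j hj => sface_unitCons_succ op
      (Nat.lt_succ_iff.1 (Finset.mem_range.1 hj)) z]
  simp only [map_add, map_sum, map_neg, Finset.sum_neg_distrib]
  abel

/-- For a unital product the outer faces of $1\otimes z$ are $z$ and $-\mathfrak t z$. For a product
that is annihilated by $1$, as $\triangledown$ is, they vanish; this is the variant ending in
`of_null` below. -/
theorem IsBoundary.unitCons_of_unital {op : C →ₗ[k] C →ₗ[k] C} {D : Chains K →ₗ[k] Chains K}
    (hD : IsBoundary K op D) (h1 : ∀ a, op 1 a = a) (h2 : ∀ a, op a 1 = a) (n : ℕ)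
    (z : TPow k C (n + 1)) :
    D (chain K (n + 2) (CleftHomology.unitCons k C (n + 1) z)) = chain K (n + 1) (z - rot (n + 1) z) -
      chain K (n + 1) (CleftHomology.unitCons k C n (∑ j ∈ Finset.range (n + 1), sface op n j z)) := by
  rw [hD.unitCons, sface_unitCons_zero op h1, sface_unitCons_last op h2, map_sub, map_neg]
  abel

theorem rot_zero (z : TPow k C 0) : rot 0 z = z := by
  simpa using rot_pow_card 0 z

theorem IsBoundary.unitCons_zero {op : C →ₗ[k] C →ₗ[k] C} {D : Chains K →ₗ[k] Chains K}
    (hD : IsBoundary K op D) (h1 : ∀ a, op 1 a = a) (h2 : ∀ a, op a 1 = a) (z : TPow k C 0) :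
    D (chain K 1 (CleftHomology.unitCons k C 0 z)) = 0 := by
  rw [hD.succ, Finset.sum_range_succ, Finset.sum_range_one, sface_unitCons_zero op h1,
    sface_unitCons_last op h2, rot_zero, add_neg_cancel, map_zero]

/-- Telescoping over a range of rotations. -/
theorem sum_sub_rot (n L : ℕ) (z : TPow k C n) :
    ∑ l ∈ Finset.range L, ((rot n ^ l) z - rot n ((rot n ^ l) z)) = z - (rot n ^ L) z := by
  have := Finset.sum_range_sub' (fun l => (rot n ^ l) z) L
  simpa [pow_succ'] using this

/-- The computation on which everything rests: the outer faces telescope, and the inner ones are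
regrouped by `sum_sface_rot_pow`. The value `L = n + 1` gives the Connes operator; `L = n + 1 - i`,
with `i` the index of the last factor in `M`, gives `varthetaOne`. -/
theorem IsBoundary.sum_unitCons {op : C →ₗ[k] C →ₗ[k] C} {D : Chains K →ₗ[k] Chains K}
    (hD : IsBoundary K op D) (h1 : ∀ a, op 1 a = a) (h2 : ∀ a, op a 1 = a) {n L : ℕ}
    (hL : L ≤ n + 1) (z : TPow k C (n + 1)) :
    D (chain K (n + 2) (CleftHomology.unitCons k C (n + 1)
        (∑ l ∈ Finset.range (L + 1), (rot (n + 1) ^ l) z))) =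
      chain K (n + 1) (z - (rot (n + 1) ^ (L + 1)) z) -
      chain K (n + 1) (CleftHomology.unitCons k C n (∑ m ∈ Finset.range (n + 2),
        ∑ e ∈ Finset.range (if m < n + 1 - L then L + 1 else L), (rot n ^ e) (sface op n m z))) := by
  rw [hD.unitCons_of_unital h1 h2, ← sum_sface_rot_pow op hL, map_sum (rot (n + 1)),
    ← Finset.sum_sub_distrib, sum_sub_rot, Finset.sum_comm]
  simp only [map_sum]

theorem word_update_add {n i : ℕ} (hi : i ≤ n) (w : ℕ → C)
    (a b : C) : word k n (Function.update w i (a + b)) =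
      word k n (Function.update w i a) + word k n (Function.update w i b) := by
  have h : ∀ c, (fun j : Fin (n + 1) => Function.update w i c (j : ℕ)) =
      Function.update (fun j : Fin (n + 1) => w j) ⟨i, by omega⟩ c := by
    intro c
    funext j
    simp [Function.update_apply, Fin.ext_iff]
  simp only [word, h]
  exact (PiTensorProduct.tprod k).map_update_add _ _ _ _

/-- Isolates the only place where the product enters. With a common auxiliary `op'`, additivity of a
face in the product becomes additivity of a tensor in one factor. -/
theorem faceNat_eq_update {α : Type*} (op op' : α → α → α) (n j : ℕ)
    (w : ℕ → α) : faceNat op n j w = Function.update (faceNat op' n j w)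
      (if j = n + 1 then 0 else j) (op (w j) (w (if j = n + 1 then 0 else j + 1))) := by
  funext i
  simp only [faceNat, Function.update_apply]
  grind

theorem sface_add (op₁ op₂ : C →ₗ[k] C →ₗ[k] C) {n j : ℕ}
    (hj : j ≤ n + 1) (z : TPow k C (n + 1)) :
    sface (op₁ + op₂) n j z = sface op₁ n j z + sface op₂ n j z := by
  suffices sface (op₁ + op₂) n j = sface op₁ n j + sface op₂ n j from LinearMap.congr_fun this z
  refine tpow_hom_ext fun w => ?_
  rw [LinearMap.add_apply, sface_word _ hj, sface_word _ hj, sface_word _ hj,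
    faceNat_eq_update (fun a b => (op₁ + op₂) a b) (fun a _ => a) n j,
    faceNat_eq_update (fun a b => op₁ a b) (fun a _ => a) n j,
    faceNat_eq_update (fun a b => op₂ a b) (fun a _ => a) n j, LinearMap.add_apply,
    LinearMap.add_apply, word_update_add (by split_ifs <;> omega), smul_add]

theorem sface_eq_zero {op : C →ₗ[k] C →ₗ[k] C} {n m : ℕ}
    {w : ℕ → C} (hm : m ≤ n + 1) (h : op (w m) (w (if m = n + 1 then 0 else m + 1)) = 0) :
    sface op n m (word k (n + 1) w) = 0 := by
  rw [sface_word _ hm, word_eq_zero (i := if m = n + 1 then 0 else m), smul_zero]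
  · split_ifs <;> omega
  · simp only [faceNat]
    by_cases h1 : m = n + 1
    · subst h1
      simpa using h
    · simpa [h1] using h

theorem sface_unitCons_zero_of_null {op : C →ₗ[k] C →ₗ[k] C}
    (h1 : ∀ a, op 1 a = 0) (n : ℕ) (z : TPow k C n) : sface op n 0 (unitCons k C n z) = 0 := by
  suffices sface op n 0 ∘ₗ unitCons k C n = 0 from LinearMap.congr_fun this z
  refine tpow_hom_ext fun w => ?_
  rw [LinearMap.comp_apply, unitCons_word]
  exact sface_eq_zero (Nat.zero_le _) (by simp [consNat, h1])

theorem sface_unitCons_last_of_null {op : C →ₗ[k] C →ₗ[k] C}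
    (h1 : ∀ a, op a 1 = 0) (n : ℕ) (z : TPow k C n) :
    sface op n (n + 1) (unitCons k C n z) = 0 := by
  suffices sface op n (n + 1) ∘ₗ unitCons k C n = 0 from LinearMap.congr_fun this z
  refine tpow_hom_ext fun w => ?_
  rw [LinearMap.comp_apply, unitCons_word]
  exact sface_eq_zero le_rfl (by simp [consNat, h1])

theorem IsBoundary.sum_unitCons_of_null {op : C →ₗ[k] C →ₗ[k] C} {D : Chains K →ₗ[k] Chains K}
    (hD : IsBoundary K op D) (h1 : ∀ a, op 1 a = 0) (h2 : ∀ a, op a 1 = 0) {n L : ℕ}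
    (hL : L ≤ n + 1) (z : TPow k C (n + 1)) :
    D (chain K (n + 2) (CleftHomology.unitCons k C (n + 1)
        (∑ l ∈ Finset.range (L + 1), (rot (n + 1) ^ l) z))) =
      -chain K (n + 1) (CleftHomology.unitCons k C n (∑ m ∈ Finset.range (n + 2),
        ∑ e ∈ Finset.range (if m < n + 1 - L then L + 1 else L), (rot n ^ e) (sface op n m z))) := by
  rw [hD.unitCons, sface_unitCons_zero_of_null h1, sface_unitCons_last_of_null h2, map_zero,
    add_zero, zero_sub, ← sum_sface_rot_pow op hL, Finset.sum_comm]
  simp only [map_sum]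

theorem IsBoundary.unitCons_zero_of_null {op : C →ₗ[k] C →ₗ[k] C} {D : Chains K →ₗ[k] Chains K}
    (hD : IsBoundary K op D) (h1 : ∀ a, op 1 a = 0) (h2 : ∀ a, op a 1 = 0) (z : TPow k C 0) :
    D (chain K 1 (CleftHomology.unitCons k C 0 z)) = 0 := by
  rw [hD.succ, Finset.sum_range_succ, Finset.sum_range_one, sface_unitCons_zero_of_null h1,
    sface_unitCons_last_of_null h2, add_zero, map_zero]

/-- For `L = n + 1` the telescoping term vanishes after a full turn, and every face, the last one
included, occurs under all `n + 1` rotations; this is the Connes operator of the boundary, with a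
minus sign. -/
theorem IsBoundary.connes {op : C →ₗ[k] C →ₗ[k] C} {D : Chains K →ₗ[k] Chains K}
    (hD : IsBoundary K op D) (h1 : ∀ a, op 1 a = a) (h2 : ∀ a, op a 1 = a) {x : Chains K}
    (hx : x ∈ finChains K) :
    D (CleftHomology.connes K x) + CleftHomology.connes K (D x) = 0 := by
  refine eq_of_mem_finChains (f := D ∘ₗ CleftHomology.connes K + CleftHomology.connes K ∘ₗ D)
    (g := 0) (fun n z => ?_) hx
  rw [LinearMap.add_apply, LinearMap.comp_apply, LinearMap.comp_apply, connes_chain]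
  cases n with
  | zero =>
    rw [hD.zero, map_zero, add_zero]
    simpa using hD.unitCons_zero h1 h2 z
  | succ n =>
    rw [hD.sum_unitCons h1 h2 le_rfl, hD.succ, connes_chain, rot_pow_card, sub_self, map_zero,
      zero_sub, LinearMap.zero_apply, neg_add_eq_zero]
    simp only [Nat.sub_self, Nat.not_lt_zero, if_false, map_sum]
    rw [Finset.sum_comm]

theorem isBoundary_hochB : IsBoundary K (LinearMap.mul k C) (hochB K) := isBoundary_lowering _ _

/-- The map of tensors induced by an algebra morphism, on classes. -/
theorem chainsMap_chain (f : C →ₐ[k] C') (hf : K.map f ≤ K') (n : ℕ) (w : ℕ → C) :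
    chainsMap f hf (chain K n (word k n w)) = chain K' n (word k n fun i => f (w i)) := by
  rw [chainsMap, preserving_chain, descend_mkQ, lift_word, rotWord_apply]
  exact single_cls n _ _ fun i => by simp

theorem chain_hom_ext {n : ℕ} {N : Type*} [AddCommGroup N] [Module k N] {f g : Chains K →ₗ[k] N}
    (h : ∀ w : ℕ → C, f (chain K n (word k n w)) = g (chain K n (word k n w))) (z : TPow k C n) :
    f (chain K n z) = g (chain K n z) := by
  have := tpow_hom_ext (f := f ∘ₗ chain K n) (g := g ∘ₗ chain K n) h
  exact LinearMap.congr_fun this z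

theorem chainsMap_hochB (f : C →ₐ[k] C') (hf : K.map f ≤ K') {x : Chains K}
    (hx : x ∈ finChains K) : chainsMap f hf (hochB K x) = hochB K' (chainsMap f hf x) := by
  refine eq_of_mem_finChains (f := chainsMap f hf ∘ₗ hochB K) (g := hochB K' ∘ₗ chainsMap f hf)
    (fun n => chain_hom_ext fun w => ?_) hx
  simp only [LinearMap.comp_apply, chainsMap_chain]
  cases n with
  | zero => rw [isBoundary_hochB.zero, isBoundary_hochB.zero, map_zero]
  | succ n =>
    rw [isBoundary_hochB.succ, isBoundary_hochB.succ]
    simp only [map_sum]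
    refine Finset.sum_congr rfl fun j hj => ?_
    rw [Finset.mem_range] at hj
    rw [sface_word _ (by omega), sface_word _ (by omega), map_smul, map_smul, map_smul,
      chainsMap_chain, word_congr fun i _ => ?_]
    simp only [faceNat, LinearMap.mul_apply']
    split_ifs <;> simp

theorem chainsMap_connes (f : C →ₐ[k] C') (hf : K.map f ≤ K') {x : Chains K}
    (hx : x ∈ finChains K) : chainsMap f hf (connes K x) = connes K' (chainsMap f hf x) := by
  refine eq_of_mem_finChains (f := chainsMap f hf ∘ₗ connes K) (g := connes K' ∘ₗ chainsMap f hf)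
    (fun n => chain_hom_ext fun w => ?_) hx
  simp only [LinearMap.comp_apply, chainsMap_chain, connes_chain, map_sum]
  refine Finset.sum_congr rfl fun l hl => ?_
  rw [Finset.mem_range] at hl
  rw [rot_pow_word _ _ hl.le, rot_pow_word _ _ hl.le]
  simp only [map_smul, unitCons_word, chainsMap_chain]
  rw [word_congr fun i _ => ?_]
  simp only [consNat, rotNat]
  split_ifs <;> simp

theorem mem_degreePart_iff {n : ℤ} {x : Chains K} :
    x ∈ degreePart K n ↔ (∃ (m : ℕ) (z : TPow k C m), (m : ℤ) = n ∧ x = chain K m z) ∨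
      (n < 0 ∧ x = 0) := by
  simp only [degreePart, Submodule.mem_pi, Set.mem_ofPred_eq, Submodule.mem_bot]
  constructor
  · intro h
    by_cases hn : n < 0
    · exact Or.inr ⟨hn, funext fun m => h m (by omega)⟩
    · obtain ⟨m, rfl⟩ : ∃ m : ℕ, n = m := ⟨n.toNat, by omega⟩
      obtain ⟨z, hz⟩ := (cyclicRel K m).mkQ_surjective (x m)
      refine Or.inl ⟨m, z, rfl, ?_⟩
      rw [chain_apply, hz]
      funext i
      by_cases hi : i = m
      · subst hi
        simp
      · rw [h i (by exact_mod_cast hi), Pi.single_eq_of_ne hi]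
  · rintro (⟨m, z, rfl, rfl⟩ | ⟨-, rfl⟩) i hi
    · rw [chain_apply, Pi.single_eq_of_ne (by exact_mod_cast hi)]
    · rfl

theorem chain_mem_degreePart (n : ℕ) (z : TPow k C n) : chain K n z ∈ degreePart K n :=
  mem_degreePart_iff.2 (Or.inl ⟨n, z, rfl, rfl⟩)

theorem degreePart_le_finChains (n : ℤ) : degreePart K n ≤ finChains K := by
  intro x hx
  rcases mem_degreePart_iff.1 hx with ⟨m, z, -, rfl⟩ | ⟨-, rfl⟩
  · exact chain_mem K m z
  · exact zero_mem _

theorem IsBoundary.mem_degreePart {op : C →ₗ[k] C →ₗ[k] C} {D : Chains K →ₗ[k] Chains K}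
    (hD : IsBoundary K op D) {n m : ℤ} (h : m + 1 = n) {x : Chains K} (hx : x ∈ degreePart K n) :
    D x ∈ degreePart K m := by
  rcases mem_degreePart_iff.1 hx with ⟨i, z, rfl, rfl⟩ | ⟨-, rfl⟩
  · cases i with
    | zero => rw [hD.zero]; exact zero_mem _
    | succ i =>
      rw [hD.succ]
      obtain rfl : m = i := by push_cast at h; omega
      exact chain_mem_degreePart _ _
  · rw [map_zero]; exact zero_mem _

theorem connes_mem_degreePart {n m : ℤ} (h : n + 1 = m) {x : Chains K}
    (hx : x ∈ degreePart K n) : CleftHomology.connes K x ∈ degreePart K m := by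
  rcases mem_degreePart_iff.1 hx with ⟨i, z, rfl, rfl⟩ | ⟨-, rfl⟩
  · rw [connes_chain]
    subst h
    exact_mod_cast chain_mem_degreePart (i + 1) _
  · rw [map_zero]; exact zero_mem _

theorem isMixedComplex_relativeMixed (f : C →ₐ[k] C') (hf : K.map f ≤ K') :
    (relativeMixed f hf).IsMixedComplex where
  b_mem h x hx := ⟨isBoundary_hochB.mem_degreePart h hx.1, by
    change chainsMap f hf (hochB K x) = 0
    rw [chainsMap_hochB f hf (degreePart_le_finChains _ hx.1), LinearMap.mem_ker.1 hx.2, map_zero]⟩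
  B_mem h x hx := ⟨connes_mem_degreePart h hx.1, by
    change chainsMap f hf (CleftHomology.connes K x) = 0
    rw [chainsMap_connes f hf (degreePart_le_finChains _ hx.1), LinearMap.mem_ker.1 hx.2, map_zero]⟩
  b_b _ x hx := isBoundary_hochB.sq (fun a b c => mul_assoc a b c) (degreePart_le_finChains _ hx.1)
  B_B _ x hx := connes_connes (degreePart_le_finChains _ hx.1)
  B_b _ _ x hx := by
    have := isBoundary_hochB.connes (fun a => one_mul a) (fun a => mul_one a)
      (degreePart_le_finChains _ hx.1)
    rw [add_comm] at this
    exact this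

end Quotient

/-! ### The operators of a cleft extension on words -/

section CleftWords

open MulOpposite CleftExt

variable {k : Type u} {A : Type v} {M : Type w} [CommRing k] [Ring A] [Algebra k A]
  [AddCommGroup M] [Module k M] [Module A M] [Module Aᵐᵒᵖ M]
  [SMulCommClass A Aᵐᵒᵖ M] [IsScalarTower k A M] [IsScalarTower k Aᵐᵒᵖ M]
variable (T : AssocBimoduleMap k A M) (K : Subalgebra k A)

theorem mem_subM {x : CleftExt T} : x ∈ subM T ↔ x.fst = 0 := Iff.rfl

theorem mem_subA {x : CleftExt T} : x ∈ subA T ↔ x.snd = 0 := by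
  constructor
  · rintro ⟨a, rfl⟩
    rfl
  · intro h
    exact ⟨x.fst, CleftExt.ext rfl h.symm⟩

theorem piM_mem (x : CleftExt T) : piM T x ∈ subM T := rfl

theorem piA_mem (x : CleftExt T) : piA T x ∈ subA T := (mem_subA T).2 rfl

theorem piA_add_piM (x : CleftExt T) : piA T x + piM T x = x := by
  apply CleftExt.ext <;> simp [piA, piM]

variable {T}

theorem piM_of_mem_subM {x : CleftExt T} (h : x ∈ subM T) : piM T x = x :=
  CleftExt.ext ((mem_subM T).1 h).symm rfl

theorem piA_of_mem_subM {x : CleftExt T} (h : x ∈ subM T) : piA T x = 0 :=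
  CleftExt.ext ((mem_subM T).1 h) rfl

theorem piA_of_mem_subA {x : CleftExt T} (h : x ∈ subA T) : piA T x = x :=
  CleftExt.ext rfl ((mem_subA T).1 h).symm

theorem piM_of_mem_subA {x : CleftExt T} (h : x ∈ subA T) : piM T x = 0 :=
  CleftExt.ext rfl ((mem_subA T).1 h : x.snd = 0)

@[simp] theorem fst_opMul (x y : CleftExt T) : (opMul T x y).fst = x.fst * y.fst := rfl
@[simp] theorem snd_opMul (x y : CleftExt T) :
    (opMul T x y).snd = x.fst • y.snd + op y.fst • x.snd := rfl
@[simp] theorem fst_opTri (x y : CleftExt T) : (opTri T x y).fst = 0 := rfl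
@[simp] theorem snd_opTri (x y : CleftExt T) : (opTri T x y).snd = T.toFun x.snd y.snd := rfl
@[simp] theorem fst_opAct (x y : CleftExt T) : (opAct T x y).fst = 0 := rfl
@[simp] theorem snd_opAct (x y : CleftExt T) : (opAct T x y).snd = x.fst • y.snd := rfl

/-- `opMul` is the product of the square-zero extension of `A` by `M`. -/
theorem opMul_assoc (x y z : CleftExt T) :
    opMul T (opMul T x y) z = opMul T x (opMul T y z) := by
  apply CleftExt.ext
  · simp [mul_assoc]
  · simp [mul_smul, smul_comm x.fst (op z.fst) y.snd, add_assoc]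

theorem opTri_assoc (x y z : CleftExt T) :
    opTri T (opTri T x y) z = opTri T x (opTri T y z) := by
  apply CleftExt.ext <;> simp [T.assoc]

theorem one_opMul (x : CleftExt T) : opMul T 1 x = x := by
  apply CleftExt.ext <;> simp

theorem opMul_one (x : CleftExt T) : opMul T x 1 = x := by
  apply CleftExt.ext <;> simp

/-- The splitting of the product of $E$ into the part that preserves the number of factors in `M`
and the part that lowers it by one. It is the reason why the Hochschild boundary is $b+d$. -/
theorem opMul_add_opTri : opMul T + opTri T = LinearMap.mul k (CleftExt T) := by
  refine LinearMap.ext₂ fun x y => ?_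
  simp only [LinearMap.add_apply, LinearMap.mul_apply']
  apply CleftExt.ext <;> simp

theorem opTri_of_left_mem {x : CleftExt T} (h : x ∈ subA T) (y : CleftExt T) :
    opTri T x y = 0 := by
  apply CleftExt.ext <;> simp [(mem_subA T).1 h]

theorem opTri_of_right_mem {y : CleftExt T} (h : y ∈ subA T) (x : CleftExt T) :
    opTri T x y = 0 := by
  apply CleftExt.ext <;> simp [(mem_subA T).1 h]

theorem one_mem_subA : (1 : CleftExt T) ∈ subA T := (mem_subA T).2 rfl

theorem opMul_mem_subM_left {x : CleftExt T} (h : x ∈ subM T) (y : CleftExt T) :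
    opMul T x y ∈ subM T := by
  rw [mem_subM] at h ⊢
  simp [h]

theorem opMul_mem_subM_right {y : CleftExt T} (h : y ∈ subM T) (x : CleftExt T) :
    opMul T x y ∈ subM T := by
  rw [mem_subM] at h ⊢
  simp [h]

theorem opMul_mem_subA {x y : CleftExt T} (hx : x ∈ subA T) (hy : y ∈ subA T) :
    opMul T x y ∈ subA T := by
  rw [mem_subA] at *
  simp [hx, hy]

theorem opMul_eq_zero {x y : CleftExt T} (hx : x ∈ subM T) (hy : y ∈ subM T) :
    opMul T x y = 0 := by
  rw [mem_subM] at *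
  apply CleftExt.ext <;> simp [hx, hy]

theorem opTri_mem_subM (x y : CleftExt T) : opTri T x y ∈ subM T := rfl

variable (T)

theorem isBoundary_muSum : IsBoundary (baseSub T K) (opMul T) (muSum T K) := isBoundary_lowering _ _

theorem isBoundary_rhoD : IsBoundary (baseSub T K) (opTri T) (rhoD T K) := isBoundary_lowering _ _

theorem rhoD'_chain_zero (z : TPow k (CleftExt T) 0) : rhoD' T K (chain (baseSub T K) 0 z) = 0 :=
  lowering_chain_zero _ z

theorem rhoD'_chain_succ (n : ℕ) (z : TPow k (CleftExt T) (n + 1)) :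
    rhoD' T K (chain (baseSub T K) (n + 1) z) =
      chain (baseSub T K) n (∑ j ∈ Finset.range (n + 1), sface (opTri T) n j z) := by
  rw [rhoD', lowering_chain_succ, descend_mkQ]
  suffices LinearMap.single k (fun n => NormChain (baseSub T K) n) n ∘ₗ
      PiTensorProduct.lift (∑ j : Fin (n + 1), (-1 : k) ^ (j : ℕ) •
        face (baseSub T K) (opTri T) j.castSucc) =
      chain (baseSub T K) n ∘ₗ ∑ j ∈ Finset.range (n + 1), sface (opTri T) n j by
    simpa using LinearMap.congr_fun this z
  refine tpow_hom_ext fun w => ?_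
  rw [LinearMap.comp_apply, lift_word, sum_apply, map_sum, LinearMap.comp_apply,
    LinearMap.sum_apply, map_sum, ← Fin.sum_univ_eq_sum_range
      (fun j => chain (baseSub T K) n (sface (opTri T) n j (word k (n + 1) w)))]
  exact Finset.sum_congr rfl fun j _ => single_face (K := baseSub T K) (opTri T) j.castSucc w

theorem hochB_eq {x : Chains (baseSub T K)} (hx : x ∈ finChains (baseSub T K)) :
    hochB (baseSub T K) x = muSum T K x + rhoD T K x := by
  refine eq_of_mem_finChains (g := muSum T K + rhoD T K) (fun n z => ?_) hx
  rw [LinearMap.add_apply]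
  cases n with
  | zero => rw [isBoundary_hochB.zero, (isBoundary_muSum T K).zero, (isBoundary_rhoD T K).zero,
      add_zero]
  | succ n =>
    rw [isBoundary_hochB.succ, (isBoundary_muSum T K).succ, (isBoundary_rhoD T K).succ, ← map_add,
      ← Finset.sum_add_distrib]
    congr 1
    refine Finset.sum_congr rfl fun j hj => ?_
    rw [← sface_add _ _ (Nat.lt_succ_iff.1 (Finset.mem_range.1 hj)), opMul_add_opTri]

theorem muSum_muSum {x : Chains (baseSub T K)} (hx : x ∈ finChains (baseSub T K)) :
    muSum T K (muSum T K x) = 0 := (isBoundary_muSum T K).sq opMul_assoc hx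

theorem rhoD_rhoD {x : Chains (baseSub T K)} (hx : x ∈ finChains (baseSub T K)) :
    rhoD T K (rhoD T K x) = 0 := (isBoundary_rhoD T K).sq opTri_assoc hx

/-- Expand the square of the Hochschild boundary $b+d$: the terms $b^2$ and $d^2$ vanish separately,
since `opMul` and `opTri` are each associative. -/
theorem rhoD_muSum {x : Chains (baseSub T K)} (hx : x ∈ finChains (baseSub T K)) :
    rhoD T K (muSum T K x) + muSum T K (rhoD T K x) = 0 := by
  have h1 := (isBoundary_muSum T K).chain_mem hx
  have h2 := (isBoundary_rhoD T K).chain_mem hx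
  have h := isBoundary_hochB.sq (fun a b c => mul_assoc a b c) hx
  rw [hochB_eq T K hx, map_add, hochB_eq T K h1, hochB_eq T K h2, muSum_muSum T K hx,
    rhoD_rhoD T K hx, zero_add, add_zero] at h
  exact h

theorem muSum_connes {x : Chains (baseSub T K)} (hx : x ∈ finChains (baseSub T K)) :
    muSum T K (connes _ x) + connes _ (muSum T K x) = 0 :=
  (isBoundary_muSum T K).connes one_opMul opMul_one hx

/-- `IsBoundary.connes` requires a unital product and does not apply to $\triangledown$; but it
applies to the product of $E$ and to `opMul`, whose boundaries differ by `rhoD`. -/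
theorem rhoD_connes {x : Chains (baseSub T K)} (hx : x ∈ finChains (baseSub T K)) :
    rhoD T K (connes _ x) + connes _ (rhoD T K x) = 0 := by
  have h := isBoundary_hochB.connes (fun a => one_mul a) (fun a => mul_one a) hx
  rw [hochB_eq T K (connes_mem hx), hochB_eq T K hx, map_add] at h
  have h' := muSum_connes T K hx
  rw [add_add_add_comm, h', zero_add] at h
  exact h

/-! ### Words with a known last factor in `M` -/

/-- `i` is the last index `≤ n` with `w i ∈ M`, and the later letters are in `A`. -/
structure IsLast (n i : ℕ) (w : ℕ → CleftExt T) : Prop where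
  le : i ≤ n
  mem : w i ∈ subM T
  after : ∀ r, i < r → r ≤ n → w r ∈ subA T

variable {T}

theorem IsLast.lastProj_self {n i : ℕ} {w : ℕ → CleftExt T} (h : IsLast T n i w)
    {i' : Fin (n + 1)} (hi : (i' : ℕ) = i) (r : Fin (n + 1)) :
    lastProj T i' r (w r) = w r := by
  unfold lastProj
  split_ifs with h1 h2
  · rfl
  · exact piM_of_mem_subM (by rw [h2, hi]; exact h.mem)
  · refine piA_of_mem_subA (h.after r ?_ (Nat.lt_succ_iff.1 r.2))
    rw [← hi]
    exact lt_of_le_of_ne (not_lt.1 h1) fun e => h2 (Fin.ext e.symm)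

/-- If the guessed index is too small, the true last factor in `M` is projected to `A`; if it is too
large, a factor in `A` is projected to `M`. -/
theorem IsLast.lastProj_ne {n i : ℕ} {w : ℕ → CleftExt T} (h : IsLast T n i w)
    {i' : Fin (n + 1)} (hi : (i' : ℕ) ≠ i) : ∃ r : Fin (n + 1), lastProj T i' r (w r) = 0 := by
  rcases lt_or_gt_of_ne hi with h1 | h1
  · have hle := h.le
    refine ⟨⟨i, by omega⟩, ?_⟩
    unfold lastProj
    rw [if_neg, if_neg]
    · exact piA_of_mem_subM h.mem
    · rw [Fin.ext_iff]; simp; omega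
    · rw [Fin.lt_def]; simp; omega
  · refine ⟨i', ?_⟩
    unfold lastProj
    rw [if_neg (lt_irrefl _), if_pos rfl]
    exact piM_of_mem_subA (h.after _ h1 (Nat.lt_succ_iff.1 i'.2))

/-- Only the summand of `tOp` that belongs to the true last index survives. So on words with a fixed
last index the operator $t$ is a power of $\mathfrak t$, and the cyclic relations apply. -/
theorem tOp_word {n i : ℕ} {w : ℕ → CleftExt T} (h : IsLast T n i w) :
    tOp T K (chain (baseSub T K) n (word k n w)) =
      chain (baseSub T K) n ((rot n ^ (n + 1 - i)) (word k n w)) := by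
  have hle := h.le
  rw [tOp, preserving_chain, descend_mkQ, lift_word, sum_apply,
    Finset.sum_eq_single (⟨i, by omega⟩ : Fin (n + 1))]
  · rw [smul_apply, rotWord_apply]
    refine ((LinearMap.single k (fun n => NormChain (baseSub T K) n) n).map_smul _ _).trans ?_
    exact single_rot w (⟨i, by omega⟩ : Fin (n + 1)) _ fun j => h.lastProj_self rfl _
  · intro i' _ hi'
    obtain ⟨r, hr⟩ := h.lastProj_ne (i' := i') fun e => hi' (Fin.ext e)
    rw [smul_apply, rotWord_apply, (cls _ n).map_coord_zero (r - i'), smul_zero]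
    simpa using hr
  · simp

/-- The exponents `0, …, n - i` are those for which only factors in `A` have been moved to the
front; one more rotation would bring the last factor in `M` to index `0`, which is `t`. -/
theorem varthetaOne_word {n i : ℕ} {w : ℕ → CleftExt T} (h : IsLast T n i w) :
    varthetaOne T K (chain (baseSub T K) n (word k n w)) =
      chain (baseSub T K) (n + 1) (unitCons k _ n
        (∑ l ∈ Finset.range (n - i + 1), (rot n ^ l) (word k n w))) := by
  have hle := h.le
  rw [varthetaOne, raising_chain, descend_mkQ, lift_word, sum_apply,
    Finset.sum_eq_single (⟨i, by omega⟩ : Fin (n + 1))]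
  · rw [sum_apply, map_sum, map_sum]
    refine (map_sum (LinearMap.single k (fun n => NormChain (baseSub T K) n) (n + 1)) _ _).trans ?_
    refine Finset.sum_congr rfl fun l hl => ?_
    simp only [Finset.mem_range] at hl
    rw [smul_apply, unitRotWord_apply]
    refine ((LinearMap.single k (fun n => NormChain (baseSub T K) n) (n + 1)).map_smul _ _).trans ?_
    refine single_cons_rot w (by omega) _ fun j => ?_
    rw [h.lastProj_self rfl, ← sub_eq_add_neg, val_sub, rotNat, Fin.val_ofNat,
      Nat.mod_eq_of_lt (by omega)]
    split_ifs <;> rfl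
  · intro i' _ hi'
    obtain ⟨r, hr⟩ := h.lastProj_ne (i' := i') fun e => hi' (Fin.ext e)
    rw [sum_apply]
    refine Finset.sum_eq_zero fun l _ => ?_
    rw [smul_apply, unitRotWord_apply,
      (cls _ (n + 1)).map_coord_zero (r - -Fin.ofNat (n + 1) l).succ, smul_zero]
    rw [Fin.cons_succ, sub_add_cancel]
    exact hr
  · simp

variable (T) in
/-- The span of the words whose last factor in `M` has index `i`. -/
def lastSub (n i : ℕ) : Submodule k (TPow k (CleftExt T) n) :=
  Submodule.span k {z | ∃ w, IsLast T n i w ∧ z = word k n w}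

theorem IsLast.word_mem {n i : ℕ} {w : ℕ → CleftExt T} (h : IsLast T n i w) :
    word k n w ∈ lastSub T n i := Submodule.subset_span ⟨w, h, rfl⟩

theorem tOp_of_mem {n i : ℕ} {z : TPow k (CleftExt T) n} (hz : z ∈ lastSub T n i) :
    tOp T K (chain (baseSub T K) n z) = chain (baseSub T K) n ((rot n ^ (n + 1 - i)) z) := by
  have : lastSub T n i ≤ LinearMap.eqLocus (tOp T K ∘ₗ chain (baseSub T K) n)
      (chain (baseSub T K) n ∘ₗ (rot n ^ (n + 1 - i))) := by
    refine Submodule.span_le.2 ?_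
    rintro _ ⟨w, h, rfl⟩
    exact tOp_word K h
  exact this hz

theorem varthetaOne_of_mem {n i : ℕ} {z : TPow k (CleftExt T) n} (hz : z ∈ lastSub T n i) :
    varthetaOne T K (chain (baseSub T K) n z) = chain (baseSub T K) (n + 1) (unitCons k _ n
        (∑ l ∈ Finset.range (n - i + 1), (rot n ^ l) z)) := by
  have : lastSub T n i ≤ LinearMap.eqLocus (varthetaOne T K ∘ₗ chain (baseSub T K) n)
      (chain (baseSub T K) (n + 1) ∘ₗ unitCons k _ n ∘ₗ
        ∑ l ∈ Finset.range (n - i + 1), (rot n ^ l)) := by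
    refine Submodule.span_le.2 ?_
    rintro _ ⟨w, h, rfl⟩
    simpa using varthetaOne_word K h
  simpa using this hz

/-- A face before the last factor in `M`. -/
theorem IsLast.sface_mem_of_lt {op : CleftExt T →ₗ[k] CleftExt T →ₗ[k] CleftExt T}
    (hop : ∀ x, ∀ y ∈ subM T, op x y ∈ subM T) {n i m : ℕ} {w : ℕ → CleftExt T}
    (h : IsLast T (n + 1) i w) (hm : m < i) :
    sface op n m (word k (n + 1) w) ∈ lastSub T n (i - 1) := by
  have hle := h.le
  rw [sface_word op (by omega)]
  refine Submodule.smul_mem _ _ (IsLast.word_mem ⟨by omega, ?_, fun r hr hr' => ?_⟩)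
  · simp only [faceNat]
    rw [if_neg (by omega), if_neg (by omega)]
    split_ifs with h1
    · rw [show m + 1 = i by omega]
      exact hop _ _ h.mem
    · rw [show i - 1 + 1 = i by omega]
      exact h.mem
  · simp only [faceNat]
    rw [if_neg (by omega), if_neg (by omega), if_neg (by omega)]
    exact h.after _ (by omega) (by omega)

/-- A face after the last factor in `M`. -/
theorem IsLast.sface_mem_of_ge {n i m : ℕ} {w : ℕ → CleftExt T}
    (h : IsLast T (n + 1) i w) (hi : i ≤ n) (hm : i ≤ m) (hm' : m ≤ n + 1) :
    sface (opMul T) n m (word k (n + 1) w) ∈ lastSub T n i := by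
  rw [sface_word _ hm']
  refine Submodule.smul_mem _ _ (IsLast.word_mem ⟨by omega, ?_, fun r hr hr' => ?_⟩)
  · simp only [faceNat]
    split_ifs with h1 h2 h3 h4
    · exact opMul_mem_subM_right (h2 ▸ h.mem) _
    · exact h.mem
    · exact h.mem
    · exact opMul_mem_subM_left (h4 ▸ h.mem) _
    · omega
  · simp only [faceNat]
    split_ifs with h1 h2 h3 h4
    · omega
    · exact h.after _ hr (by omega)
    · exact h.after _ hr (by omega)
    · exact opMul_mem_subA (h.after _ (by omega) (by omega)) (h.after _ (by omega) (by omega))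
    · exact h.after _ (by omega) (by omega)

/-- At or after the last factor in `M`, a contraction involves one of the later factors, all in `A`,
and $\triangledown$ vanishes on it. The exception is the wrap-around face when no later factor
exists. -/
theorem IsLast.sface_opTri_of_ge {n i m : ℕ} {w : ℕ → CleftExt T}
    (h : IsLast T (n + 1) i w) (hm : i ≤ m) (hm' : m ≤ n + 1) (h' : ¬(m = n + 1 ∧ i = n + 1)) :
    sface (opTri T) n m (word k (n + 1) w) = 0 := by
  refine sface_eq_zero hm' ?_
  split_ifs with h1
  · exact opTri_of_left_mem (h.after _ (by omega) hm') _
  · exact opTri_of_right_mem (h.after _ (by omega) (by omega)) _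

/-- A face before the last factor in `M` keeps the `n + 1 - i` factors after it, so `varthetaOne`
takes one rotation more than that number; a face at or after it removes one of these factors and one
rotation. These are the counts of `sum_sface_rot_pow` for `L = n + 1 - i`. In the excluded case the
last factor in `M` is merged into index `0` and its position is lost. -/
theorem IsLast.varthetaOne_muSum_face {n i m : ℕ} {w : ℕ → CleftExt T}
    (h : IsLast T (n + 1) i w) (hm' : m ≤ n + 1) (h' : ¬(m = n + 1 ∧ i = n + 1)) :
    varthetaOne T K (chain (baseSub T K) n (sface (opMul T) n m (word k (n + 1) w))) =
      chain (baseSub T K) (n + 1) (unitCons k _ n (∑ e ∈ Finset.range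
        (if m < n + 1 - (n + 1 - i) then n + 1 - i + 1 else n + 1 - i),
          (rot n ^ e) (sface (opMul T) n m (word k (n + 1) w)))) := by
  have hle := h.le
  by_cases hm : m < i
  · rw [varthetaOne_of_mem K (h.sface_mem_of_lt (fun _ _ hy => opMul_mem_subM_right hy _) hm),
      if_pos (by omega), show n - (i - 1) + 1 = n + 1 - i + 1 by omega]
  · rw [varthetaOne_of_mem K (h.sface_mem_of_ge (by omega) (not_lt.1 hm) hm'), if_neg (by omega),
      show n - i + 1 = n + 1 - i by omega]

theorem IsLast.varthetaOne_rhoD_face {n i m : ℕ} {w : ℕ → CleftExt T}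
    (h : IsLast T (n + 1) i w) (hm' : m ≤ n + 1) (h' : ¬(m = n + 1 ∧ i = n + 1)) :
    varthetaOne T K (chain (baseSub T K) n (sface (opTri T) n m (word k (n + 1) w))) =
      chain (baseSub T K) (n + 1) (unitCons k _ n (∑ e ∈ Finset.range
        (if m < n + 1 - (n + 1 - i) then n + 1 - i + 1 else n + 1 - i),
          (rot n ^ e) (sface (opTri T) n m (word k (n + 1) w)))) := by
  have hle := h.le
  by_cases hm : m < i
  · rw [varthetaOne_of_mem K (h.sface_mem_of_lt (fun _ _ _ => opTri_mem_subM _ _) hm),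
      if_pos (by omega), show n - (i - 1) + 1 = n + 1 - i + 1 by omega]
  · rw [h.sface_opTri_of_ge (not_lt.1 hm) hm' h']
    simp

theorem IsLast.muSum_varthetaOne {n i : ℕ} {w : ℕ → CleftExt T} (h : IsLast T (n + 1) i w) :
    muSum T K (varthetaOne T K (chain (baseSub T K) (n + 1) (word k (n + 1) w))) =
      chain (baseSub T K) (n + 1) (word k (n + 1) w) -
      tOp T K (chain (baseSub T K) (n + 1) (word k (n + 1) w)) -
      ∑ m ∈ Finset.range (n + 2), chain (baseSub T K) (n + 1) (unitCons k _ n (∑ e ∈ Finset.range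
        (if m < n + 1 - (n + 1 - i) then n + 1 - i + 1 else n + 1 - i),
          (rot n ^ e) (sface (opMul T) n m (word k (n + 1) w)))) := by
  have hle := h.le
  rw [varthetaOne_word K h, (isBoundary_muSum T K).sum_unitCons one_opMul opMul_one (by omega),
    tOp_word K h, map_sub, show n + 1 - i + 1 = n + 1 + 1 - i by omega, map_sum, map_sum]

theorem muSum_varthetaOne_zero {w : ℕ → CleftExt T} (h : w 0 ∈ subM T) :
    muSum T K (varthetaOne T K (chain (baseSub T K) 0 (word k 0 w))) = 0 := by
  have hl : IsLast T 0 0 w := ⟨le_rfl, h, fun r h1 h2 => by omega⟩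
  rw [varthetaOne_word K hl]
  exact (isBoundary_muSum T K).unitCons_zero one_opMul opMul_one _

theorem IsLast.rhoD_varthetaOne {n i : ℕ} {w : ℕ → CleftExt T} (h : IsLast T (n + 1) i w) :
    rhoD T K (varthetaOne T K (chain (baseSub T K) (n + 1) (word k (n + 1) w))) =
      -∑ m ∈ Finset.range (n + 2), chain (baseSub T K) (n + 1) (unitCons k _ n (∑ e ∈ Finset.range
        (if m < n + 1 - (n + 1 - i) then n + 1 - i + 1 else n + 1 - i),
          (rot n ^ e) (sface (opTri T) n m (word k (n + 1) w)))) := by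
  have hle := h.le
  rw [varthetaOne_word K h, (isBoundary_rhoD T K).sum_unitCons_of_null
    (opTri_of_left_mem one_mem_subA) (opTri_of_right_mem one_mem_subA) (by omega), map_sum, map_sum]

theorem rhoD_varthetaOne_zero {w : ℕ → CleftExt T} (h : w 0 ∈ subM T) :
    rhoD T K (varthetaOne T K (chain (baseSub T K) 0 (word k 0 w))) = 0 := by
  have hl : IsLast T 0 0 w := ⟨le_rfl, h, fun r h1 h2 => by omega⟩
  rw [varthetaOne_word K hl]
  exact (isBoundary_rhoD T K).unitCons_zero_of_null (opTri_of_left_mem one_mem_subA)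
    (opTri_of_right_mem one_mem_subA) _

end CleftWords

/-! ### Identities on words, according to whether the leading factor is in `M` or in `A` -/

section CleftIdentities

open MulOpposite CleftExt

variable {k : Type u} {A : Type v} {M : Type w} [CommRing k] [Ring A] [Algebra k A]
  [AddCommGroup M] [Module k M] [Module A M] [Module Aᵐᵒᵖ M]
  [SMulCommClass A Aᵐᵒᵖ M] [IsScalarTower k A M] [IsScalarTower k Aᵐᵒᵖ M]
variable {T : AssocBimoduleMap k A M} (K : Subalgebra k A)

theorem headM_word (n : ℕ) (w : ℕ → CleftExt T) :
    headM T K (chain (baseSub T K) n (word k n w)) =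
      chain (baseSub T K) n (word k n (Function.update w 0 (piM T (w 0)))) := by
  rw [headM, preserving_chain, descend_mkQ, lift_word, rotWord_apply]
  refine single_cls n _ _ fun i => ?_
  rw [add_zero, slotProj]
  split_ifs with h
  · subst h; simp
  · rw [Function.update_of_ne (by rwa [Ne, Fin.val_eq_zero_iff]), LinearMap.id_apply]

theorem headA_word (n : ℕ) (w : ℕ → CleftExt T) :
    headA T K (chain (baseSub T K) n (word k n w)) =
      chain (baseSub T K) n (word k n (Function.update w 0 (piA T (w 0)))) := by
  rw [headA, preserving_chain, descend_mkQ, lift_word, rotWord_apply]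
  refine single_cls n _ _ fun i => ?_
  rw [add_zero, slotProj]
  split_ifs with h
  · subst h; simp
  · rw [Function.update_of_ne (by rwa [Ne, Fin.val_eq_zero_iff]), LinearMap.id_apply]

theorem headA_add_headM {x : Chains (baseSub T K)} (hx : x ∈ finChains (baseSub T K)) :
    headA T K x + headM T K x = x := by
  refine eq_of_mem_finChains (f := headA T K + headM T K) (g := LinearMap.id)
    (fun n => chain_hom_ext fun w => ?_) hx
  rw [LinearMap.add_apply, headA_word, headM_word, ← map_add,
    ← word_update_add (Nat.zero_le _), piA_add_piM, Function.update_eq_self, LinearMap.id_apply]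

theorem headM_word_of_subM {n : ℕ} {w : ℕ → CleftExt T} (h : w 0 ∈ subM T) :
    headM T K (chain (baseSub T K) n (word k n w)) = chain (baseSub T K) n (word k n w) := by
  rw [headM_word, piM_of_mem_subM h, Function.update_eq_self]

theorem headM_word_of_subA {n : ℕ} {w : ℕ → CleftExt T} (h : w 0 ∈ subA T) :
    headM T K (chain (baseSub T K) n (word k n w)) = 0 := by
  rw [headM_word, piM_of_mem_subA h, word_eq_zero (Nat.zero_le _) (by simp), map_zero]

theorem headA_word_of_subM {n : ℕ} {w : ℕ → CleftExt T} (h : w 0 ∈ subM T) :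
    headA T K (chain (baseSub T K) n (word k n w)) = 0 := by
  rw [headA_word, piA_of_mem_subM h, word_eq_zero (Nat.zero_le _) (by simp), map_zero]

theorem muZeroM_chain_zero (z : TPow k (CleftExt T) 0) :
    muZeroM T K (chain (baseSub T K) 0 z) = 0 := lowering_chain_zero _ z

theorem muZeroM_chain_succ (n : ℕ) (z : TPow k (CleftExt T) (n + 1)) :
    muZeroM T K (chain (baseSub T K) (n + 1) z) =
      chain (baseSub T K) n (sface (opAct T) n 0 z) := by
  rw [muZeroM, lowering_chain_succ, descend_mkQ]
  suffices LinearMap.single k (fun n => NormChain (baseSub T K) n) n ∘ₗ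
      PiTensorProduct.lift (face (baseSub T K) (opAct T) (0 : Fin (n + 2))) =
      chain (baseSub T K) n ∘ₗ sface (opAct T) n 0 from LinearMap.congr_fun this z
  refine tpow_hom_ext fun w => ?_
  rw [LinearMap.comp_apply, lift_word, LinearMap.comp_apply]
  have := single_face (K := baseSub T K) (opAct T) (0 : Fin (n + 2)) w
  rw [Fin.val_zero, pow_zero, one_smul] at this
  exact this

theorem lastProj_zero_one {n : ℕ} (i : Fin (n + 1)) :
    lastProj T i 0 1 ∈ baseSub T K ∧ (i = 0 → lastProj T i 0 1 = 0) := by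
  have := lastProj_mem T K i 0 (one_mem (baseSub T K))
  exact ⟨this.1, fun h => this.2 h.symm⟩

/-- If the last factor in `M` has positive index, rotating moves the unit to a positive index, where
it is degenerate. The summand with last index `0` projects the unit to `M` and vanishes. -/
theorem tOp_unitCons (n : ℕ) (z : TPow k (CleftExt T) n) :
    tOp T K (chain (baseSub T K) (n + 1) (unitCons k _ n z)) = 0 := by
  suffices tOp T K ∘ₗ chain (baseSub T K) (n + 1) ∘ₗ unitCons k _ n = 0 from
    LinearMap.congr_fun this z
  refine tpow_hom_ext fun w => ?_
  rw [LinearMap.comp_apply, LinearMap.comp_apply, unitCons_word, tOp, preserving_chain,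
    descend_mkQ, lift_word, sum_apply, Finset.sum_eq_zero, Pi.single_zero, LinearMap.zero_apply]
  intro i _
  rw [smul_apply, rotWord_apply]
  by_cases hi : i = 0
  · rw [(cls _ (n + 1)).map_coord_zero 0, smul_zero]
    subst hi
    simpa [consNat] using (lastProj_zero_one K (0 : Fin (n + 2))).2 rfl
  · rw [cls_degenerate _ _ (i := -i) (neg_ne_zero.2 hi), smul_zero]
    simpa [consNat] using (lastProj_zero_one K i).1

theorem varthetaOne_unitCons (n : ℕ) (z : TPow k (CleftExt T) n) :
    varthetaOne T K (chain (baseSub T K) (n + 1) (unitCons k _ n z)) = 0 := by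
  suffices varthetaOne T K ∘ₗ chain (baseSub T K) (n + 1) ∘ₗ unitCons k _ n = 0 from
    LinearMap.congr_fun this z
  refine tpow_hom_ext fun w => ?_
  rw [LinearMap.comp_apply, LinearMap.comp_apply, unitCons_word, varthetaOne, raising_chain,
    descend_mkQ, lift_word, sum_apply, Finset.sum_eq_zero, Pi.single_zero, LinearMap.zero_apply]
  intro i _
  rw [sum_apply]
  refine Finset.sum_eq_zero fun l _ => ?_
  rw [smul_apply, unitRotWord_apply,
    cls_degenerate _ _ (i := (0 - -Fin.ofNat (n + 1 + 1) l).succ) (Fin.succ_ne_zero _), smul_zero]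
  rw [Fin.cons_succ, sub_add_cancel]
  simpa [consNat] using (lastProj_zero_one K i).1

theorem varthetaOne_connes {x : Chains (baseSub T K)} (hx : x ∈ finChains (baseSub T K)) :
    varthetaOne T K (connes _ x) = 0 := by
  refine eq_of_mem_finChains (f := varthetaOne T K ∘ₗ connes _) (g := 0) (fun n z => ?_) hx
  rw [LinearMap.comp_apply, connes_chain, varthetaOne_unitCons, LinearMap.zero_apply]

section Word

variable {n i : ℕ} {w : ℕ → CleftExt T}

theorem connes_varthetaOne_word (h : IsLast T n i w) :
    connes _ (varthetaOne T K (chain (baseSub T K) n (word k n w))) = 0 := by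
  rw [varthetaOne_word K h, connes_unitCons]

theorem tOp_varthetaOne_word (h : IsLast T n i w) :
    tOp T K (varthetaOne T K (chain (baseSub T K) n (word k n w))) = 0 := by
  rw [varthetaOne_word K h, tOp_unitCons]

/-- After at least one rotation the factor next to the inserted unit lies in `A` and has no
component in `M`. Only the unrotated summand survives, and its factor next to the unit is $x_0\in
M$. -/
theorem muZeroM_varthetaOne_word (h : IsLast T n i w) (h0 : w 0 ∈ subM T) :
    muZeroM T K (varthetaOne T K (chain (baseSub T K) n (word k n w))) =
      chain (baseSub T K) n (word k n w) := by
  have hle := h.le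
  rw [varthetaOne_word K h, muZeroM_chain_succ]
  congr 1
  rw [map_sum, map_sum, Finset.sum_range_succ', Finset.sum_eq_zero, zero_add, pow_zero,
    Module.End.one_apply, unitCons_word, sface_word _ (Nat.zero_le _), pow_zero, one_smul]
  · refine word_congr fun r hr => ?_
    simp only [faceNat]
    rw [if_neg (by omega), if_neg (by omega)]
    split_ifs with hr0
    · subst hr0
      apply CleftExt.ext <;> simp [consNat, (mem_subM T).1 h0]
    · simp [consNat]
  · intro l hl
    rw [Finset.mem_range] at hl
    rw [rot_pow_word _ _ (by omega), map_smul, map_smul, unitCons_word,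
      sface_eq_zero (Nat.zero_le _), smul_zero]
    have : w (n + 1 - (l + 1) + 0) ∈ subA T := h.after _ (by omega) (by omega)
    rw [mem_subA] at this
    apply CleftExt.ext
    · simp
    · simpa [consNat, rotNat] using this

/-- All faces match by `varthetaOne_muSum_face` except the wrap-around face with the final factor in
`M`; there two factors in `M` are multiplied and the face vanishes. -/
theorem muSum_varthetaOne_of_subM (h : IsLast T n i w) (h0 : w 0 ∈ subM T) :
    muSum T K (varthetaOne T K (chain (baseSub T K) n (word k n w))) +
      varthetaOne T K (muSum T K (chain (baseSub T K) n (word k n w))) =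
    chain (baseSub T K) n (word k n w) - tOp T K (chain (baseSub T K) n (word k n w)) := by
  cases n with
  | zero =>
    obtain rfl : i = 0 := Nat.le_zero.1 h.le
    -- In degree `0` the operator `t` is a full turn, hence the identity, and both sides are zero.
    rw [muSum_varthetaOne_zero K h0, (isBoundary_muSum T K).zero, tOp_word K h, rot_pow_card]
    simp
  | succ n =>
    rw [h.muSum_varthetaOne K, (isBoundary_muSum T K).succ, map_sum, map_sum,
      Finset.sum_congr rfl fun m hm => ?_, sub_add_cancel]
    rw [Finset.mem_range] at hm
    by_cases h' : m = n + 1 ∧ i = n + 1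
    · obtain ⟨rfl, rfl⟩ := h'
      rw [sface_eq_zero le_rfl (by simpa using opMul_eq_zero h.mem h0)]
      simp
    · exact (h.varthetaOne_muSum_face K (by omega) h').symm

/-- The origin of $d'$: for a final factor in `M`, the wrap-around face $x_n\triangledown x_0$ need
not vanish but occurs with no rotation at all in the boundary of $\vartheta$. So $\varrho_n$ has to
be left out on the right. If the final factor is in `A`, then $\varrho_n$ is zero anyway. -/
theorem rhoD_varthetaOne_of_subM (h : IsLast T n i w) (h0 : w 0 ∈ subM T) :
    rhoD T K (varthetaOne T K (chain (baseSub T K) n (word k n w))) =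
      -varthetaOne T K (rhoD' T K (chain (baseSub T K) n (word k n w))) := by
  cases n with
  | zero => rw [rhoD_varthetaOne_zero K h0, rhoD'_chain_zero, map_zero, neg_zero]
  | succ n =>
    rw [h.rhoD_varthetaOne K, rhoD'_chain_succ, map_sum, map_sum, Finset.sum_range_succ,
      Finset.sum_congr rfl fun m hm => ?_, add_eq_left.2]
    · have hle := h.le
      by_cases hi : i = n + 1
      · subst hi
        simp
      · rw [h.sface_opTri_of_ge hle le_rfl (by tauto)]
        simp
    · rw [Finset.mem_range] at hm
      exact (h.varthetaOne_rhoD_face K (by omega) (by omega)).symm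

theorem rhoD_varthetaOne_of_subA (h : IsLast T (n + 1) i w) (h0 : w 0 ∈ subA T) :
    rhoD T K (varthetaOne T K (chain (baseSub T K) (n + 1) (word k (n + 1) w))) =
      -varthetaOne T K (rhoD T K (chain (baseSub T K) (n + 1) (word k (n + 1) w))) := by
  rw [h.rhoD_varthetaOne K, (isBoundary_rhoD T K).succ, map_sum, map_sum,
    Finset.sum_congr rfl fun m hm => ?_]
  rw [Finset.mem_range] at hm
  by_cases h' : m = n + 1 ∧ i = n + 1
  · obtain ⟨rfl, rfl⟩ := h'
    rw [sface_eq_zero le_rfl (by simpa using opTri_of_right_mem h0 _)]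
    simp
  · exact (h.varthetaOne_rhoD_face K (by omega) h').symm

/-- When $x_0\in A$, only the two faces that involve $x_0$ can put a factor of `M` at index `0`:
face `0` contributes $\mu_0^M$, and the wrap-around face contributes when the final factor is in
`M`. -/
theorem headM_muSum_of_subA (h : IsLast T (n + 1) i w) (h0 : w 0 ∈ subA T) :
    headM T K (muSum T K (chain (baseSub T K) (n + 1) (word k (n + 1) w))) =
      muZeroM T K (chain (baseSub T K) (n + 1) (word k (n + 1) w)) +
      if i = n + 1 then chain (baseSub T K) n (sface (opMul T) n (n + 1) (word k (n + 1) w))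
      else 0 := by
  rw [(isBoundary_muSum T K).succ, map_sum, map_sum, Finset.sum_range_succ,
    Finset.sum_range_succ', Finset.sum_eq_zero, zero_add]
  · congr 1
    · rw [muZeroM_chain_succ, sface_word _ (Nat.zero_le _), sface_word _ (Nat.zero_le _), pow_zero,
        one_smul, one_smul, headM_word]
      congr 1
      refine word_congr fun r hr => ?_
      rw [mem_subA] at h0
      simp only [faceNat, Function.update_apply]
      by_cases hr0 : r = 0
      · subst hr0
        apply CleftExt.ext <;> simp [piM, h0]
      · simp [hr0]
    · rw [sface_word _ le_rfl, map_smul, map_smul]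
      split_ifs with hi
      · subst hi
        rw [headM_word_of_subM]
        simpa [faceNat] using opMul_mem_subM_left h.mem _
      · rw [headM_word_of_subA, smul_zero]
        have hle := h.le
        simpa [faceNat] using opMul_mem_subA (h.after (n + 1) (by omega) le_rfl) h0
  · intro j hj
    rw [Finset.mem_range] at hj
    rw [sface_word _ (by omega), map_smul, map_smul, headM_word_of_subA, smul_zero]
    simp only [faceNat]
    rw [if_neg (by omega), if_pos (by omega)]
    exact h0

/-- Passing from $b$ to $b^1$ removes $\mu_n^M$, which is the face that `varthetaOne` cannot match,
and also $\mu_0^M$, which it does match. The correction $\vartheta\mu_0^M$ on the right makes up for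
the latter. -/
theorem muSum_varthetaOne_of_subA (h : IsLast T (n + 1) i w) (h0 : w 0 ∈ subA T) :
    muSum T K (varthetaOne T K (chain (baseSub T K) (n + 1) (word k (n + 1) w))) +
      varthetaOne T K (headA T K (muSum T K (chain (baseSub T K) (n + 1) (word k (n + 1) w)))) =
    chain (baseSub T K) (n + 1) (word k (n + 1) w) -
      tOp T K (chain (baseSub T K) (n + 1) (word k (n + 1) w)) -
      varthetaOne T K (muZeroM T K (chain (baseSub T K) (n + 1) (word k (n + 1) w))) := by
  have hA := headA_add_headM K ((isBoundary_muSum T K).chain_mem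
    (chain_mem (baseSub T K) (n + 1) (word k (n + 1) w)))
  rw [headM_muSum_of_subA K h h0] at hA
  rw [eq_sub_of_add_eq hA, (isBoundary_muSum T K).succ, h.muSum_varthetaOne K, map_sub, map_add]
  rw [map_sum, map_sum, Finset.sum_range_succ, Finset.sum_range_succ _ (n + 1),
    Finset.sum_congr rfl fun m hm => (h.varthetaOne_muSum_face K
      (Finset.mem_range.1 hm).le (fun e => (Finset.mem_range.1 hm).ne e.1))]
  -- If the final factor is in `M`, there are no later factors, so the wrap-around face carries an
  -- empty sum of rotations on one side and is cancelled by the `if` term on the other.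
  by_cases hi : i = n + 1
  · subst hi
    rw [if_pos rfl, Nat.sub_self, Nat.sub_zero, if_neg (lt_irrefl _), Finset.range_zero,
      Finset.sum_empty, map_zero, map_zero, add_zero]
    abel
  · rw [if_neg hi, h.varthetaOne_muSum_face K le_rfl (by tauto), map_zero]
    abel

end Word

/-- Starting from the last letter in `M`, repeated application of `t` runs through the rotations
that start with a letter in `M`. -/
theorem exists_tOp_pow_word {n : ℕ} {w : ℕ → CleftExt T} (S : ℕ → Prop) [DecidablePred S]
    (hM : ∀ r ≤ n, S r → w r ∈ subM T) (hA : ∀ r ≤ n, ¬S r → w r ∈ subA T) {s : ℕ}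
    (hs : s ≤ n + 1) :
    ∃ q, n + 1 - s ≤ q ∧ q ≤ n + 1 ∧ (∀ r, n + 1 - s ≤ r → r < q → ¬S r) ∧
      (tOp T K ^ ((Finset.Ico (n + 1 - s) (n + 1)).filter S).card)
        (chain (baseSub T K) n (word k n w)) =
        chain (baseSub T K) n ((rot n ^ (n + 1 - q)) (word k n w)) ∧
      ∑ l ∈ Finset.range ((Finset.Ico (n + 1 - s) (n + 1)).filter S).card,
        varthetaOne T K ((tOp T K ^ l) (chain (baseSub T K) n (word k n w))) =
        chain (baseSub T K) (n + 1) (unitCons k _ n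
          (∑ l ∈ Finset.range (n + 1 - q), (rot n ^ l) (word k n w))) := by
  -- The letters are read from the end. The index `q` is that of the leftmost letter in `M` among
  -- the last `s`, or `n + 1` if there is none; the powers of `t` used so far have rotated exactly
  -- the letters from `q` on to the front.
  induction s with
  | zero => exact ⟨n + 1, by omega, le_rfl, fun r _ _ => by omega, by simp, by simp⟩
  | succ s ih =>
    obtain ⟨q, hq1, hq2, hq3, ht, hV⟩ := ih (by omega)
    have hI : Finset.Ico (n + 1 - (s + 1)) (n + 1) =
        insert (n - s) (Finset.Ico (n + 1 - s) (n + 1)) := by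
      ext r
      simp only [Finset.mem_Ico, Finset.mem_insert]
      omega
    by_cases hS : S (n - s)
    · have hc : ((Finset.Ico (n + 1 - (s + 1)) (n + 1)).filter S).card =
          ((Finset.Ico (n + 1 - s) (n + 1)).filter S).card + 1 := by
        rw [hI, Finset.filter_insert, if_pos hS, Finset.card_insert_of_notMem]
        simp only [Finset.mem_filter, Finset.mem_Ico]
        omega
      -- The letters strictly between `n - s` and `q` are in `A`, and those from `q` on are now in
      -- front. So the last factor in `M` of the rotated word is the new letter `n - s`.
      have hl : (rot n ^ (n + 1 - q)) (word k n w) ∈ lastSub T n (n - s + (n + 1 - q)) := by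
        rw [rot_pow_word _ _ (by omega)]
        refine Submodule.smul_mem _ _ (IsLast.word_mem ⟨by omega, ?_, fun r hr hr' => ?_⟩)
        · rw [rotNat, if_neg (by omega), Nat.add_sub_cancel]
          exact hM _ (by omega) hS
        · rw [rotNat, if_neg (by omega)]
          exact hA _ (by omega) (hq3 _ (by omega) (by omega))
      refine ⟨n - s, by omega, by omega, fun r _ _ => by omega, ?_, ?_⟩
      · rw [hc, pow_succ', Module.End.mul_apply, ht, tOp_of_mem K hl, ← Module.End.mul_apply,
          ← pow_add]
        congr 3
        omega
      -- The next application of `varthetaOne` contributes the rotations with exponents from `n + 1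
      -- - q` up to `s`, directly after those already collected.
      · rw [hc, Finset.sum_range_succ, hV, ht, varthetaOne_of_mem K hl, ← map_add, ← map_add,
          show n + 1 - (n - s) = (n + 1 - q) + (n - (n - s + (n + 1 - q)) + 1) by omega,
          Finset.sum_range_add _ (n + 1 - q)]
        congr 3
        refine Finset.sum_congr rfl fun l _ => ?_
        rw [← Module.End.mul_apply, ← pow_add, add_comm l]
    · have hc : (Finset.Ico (n + 1 - (s + 1)) (n + 1)).filter S =
          (Finset.Ico (n + 1 - s) (n + 1)).filter S := by
        rw [hI, Finset.filter_insert, if_neg hS]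
      refine ⟨q, by omega, hq2, fun r hr hr' => ?_, by rw [hc, ht], by rw [hc, hV]⟩
      by_cases hr2 : r = n - s
      · rwa [hr2]
      · exact hq3 r (by omega) hr'

/-- The Connes operator on a word that starts in `M`. -/
theorem sum_varthetaOne_tOp_pow {n : ℕ} {w : ℕ → CleftExt T} (S : ℕ → Prop) [DecidablePred S]
    (hM : ∀ r ≤ n, S r → w r ∈ subM T) (hA : ∀ r ≤ n, ¬S r → w r ∈ subA T) (h0 : S 0) :
    ∑ l ∈ Finset.range ((Finset.range (n + 1)).filter S).card,
        varthetaOne T K ((tOp T K ^ l) (chain (baseSub T K) n (word k n w))) =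
      connes _ (chain (baseSub T K) n (word k n w)) := by
  obtain ⟨q, hq1, hq2, hq3, -, hV⟩ := exists_tOp_pow_word K S hM hA (le_refl (n + 1))
  -- Since the word starts in `M`, reading all letters ends at index `0`; all `n + 1` rotations have
  -- been collected, as in the Connes operator.
  obtain rfl : q = 0 := by
    by_contra hq
    exact hq3 0 (by omega) (by omega) h0
  rw [Nat.sub_self, Nat.sub_zero, ← Finset.range_eq_Ico] at hV
  rw [hV, connes_chain]

end CleftIdentities

/-! ### Homotopies of mixed complexes -/

section ChainHomotopy

variable {k : Type u} [CommRing k] {V : Type w} [AddCommGroup V] [Module k V]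
  {V' : Type w} [AddCommGroup V'] [Module k V']

/-- `s` is a homotopy between `f` and the identity of `(X, d)`. -/
structure IsChainHomotopy (X : ℤ → Submodule k V) (d f s : ℤ → V →ₗ[k] V) : Prop where
  mem : ∀ {n m : ℤ}, n + 1 = m → ∀ x ∈ X n, s n x ∈ X m
  comm : ∀ {l n m : ℤ}, l + 1 = n → n + 1 = m → ∀ x ∈ X n, d m (s n x) + s l (d n x) = x - f n x

theorem chainComplex_d_apply {X : ℤ → Submodule k V} {d : ℤ → V →ₗ[k] V} (h : IsChain X d)
    {i j : ℤ} (hij : j + 1 = i) (x : X i) :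
    (((chainComplex X d h).d i j).hom x : X j) = (⟨d i x, h.mem hij x x.2⟩ : X j) := by
  dsimp only [chainComplex]
  rw [dif_pos hij]
  rfl

theorem IsChainHomotopy.nonempty_homotopy {X : ℤ → Submodule k V} {d f s : ℤ → V →ₗ[k] V}
    (hs : IsChainHomotopy X d f s) (h : IsChain X d)
    (φ : chainComplex X d h ⟶ chainComplex X d h)
    (hφ : ∀ (n : ℤ) (x : X n),
      Subtype.val (p := fun y => y ∈ X n) ((φ.f n).hom x) = f n (x : V)) :
    Nonempty (Homotopy φ (𝟙 (chainComplex X d h))) := by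
  -- A `Homotopy` from `φ` to the identity expresses `φ` minus the identity, whereas `s` expresses
  -- the identity minus `f`. Hence the minus sign.
  let H : ∀ i j, (chainComplex X d h).X i ⟶ (chainComplex X d h).X j := fun i j =>
    if hij : i + 1 = j then
      -ModuleCat.ofHom ((s i).restrict (p := X i) (q := X j) (hs.mem hij)) else 0
  have hH : ∀ {i j : ℤ} (hij : i + 1 = j) (x : X i),
      ((H i j).hom x : X j) = -(⟨s i x, hs.mem hij x x.2⟩ : X j) := by
    intro i j hij x
    have e : H i j = -ModuleCat.ofHom ((s i).restrict (p := X i) (q := X j) (hs.mem hij)) :=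
      dif_pos hij
    rw [e]
    rfl
  refine ⟨⟨H, fun i j hij => dif_neg hij, fun i => ?_⟩⟩
  have r1 : (ComplexShape.down ℤ).Rel i (i - 1) := by simp
  have r2 : (ComplexShape.down ℤ).Rel (i + 1) i := by simp
  rw [dNext_eq H r1, prevD_eq H r2]
  refine ModuleCat.hom_ext (LinearMap.ext fun (x : X i) => ?_)
  have e1 := chainComplex_d_apply h (show i - 1 + 1 = i by ring) x
  have e2 := hH (show i - 1 + 1 = i by ring)
    ⟨d i x, h.mem (show i - 1 + 1 = i by ring) _ x.2⟩
  have e3 := hH (rfl : i + 1 = i + 1) x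
  have e4 := chainComplex_d_apply h (rfl : i + 1 = i + 1)
    (-(⟨s i x, hs.mem rfl x x.2⟩ : X (i + 1)))
  have key := hs.comm (show i - 1 + 1 = i by ring) (rfl : i + 1 = i + 1) x x.2
  refine Subtype.ext ((hφ i x).trans ?_)
  refine Eq.trans ?_ (congrArg (Subtype.val : X i → V)
    (congrArg₂ (fun a b : X i => a + b + x) ((congrArg (H (i - 1) i).hom e1).trans e2)
      ((congrArg ((chainComplex X d h).d (i + 1) i).hom e3).trans e4))).symm
  simp only [Submodule.coe_add, Submodule.coe_neg, map_neg]
  rw [← neg_add, add_comm (s (i - 1) _), key]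
  abel

theorem isIso_chainMap {X : ℤ → Submodule k V} {d : ℤ → V →ₗ[k] V} {X' : ℤ → Submodule k V'}
    {d' : ℤ → V' →ₗ[k] V'} (h : IsChain X d) (h' : IsChain X' d') {f : ℤ → V →ₗ[k] V'}
    (hf : IsChainMap X d X' d' f) (hb : ∀ n, Set.BijOn (f n) (X n) (X' n)) :
    IsIso (chainMap h h' hf) := by
  have : ∀ n, IsIso ((chainMap h h' hf).f n) := by
    intro n
    refine (ConcreteCategory.isIso_iff_bijective _).2 ⟨fun x y e => ?_, fun y => ?_⟩
    · exact Subtype.ext ((hb n).injOn x.2 y.2 (congrArg Subtype.val e))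
    · obtain ⟨x, hx, e⟩ := (hb n).surjOn y.2
      exact ⟨⟨x, hx⟩, Subtype.ext e⟩
  exact HomologicalComplex.Hom.isIso_of_components _

theorem isIso_homologyMap_chainMap {X : ℤ → Submodule k V} {d : ℤ → V →ₗ[k] V}
    {X' : ℤ → Submodule k V'} {d' : ℤ → V' →ₗ[k] V'} (h : IsChain X d) (h' : IsChain X' d')
    {f : ℤ → V →ₗ[k] V'} {g : ℤ → V' →ₗ[k] V} (hf : IsChainMap X d X' d' f)
    (hg : IsChainMap X' d' X d g) (hgf : ∀ n, ∀ x ∈ X n, g n (f n x) = x)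
    {s : ℤ → V' →ₗ[k] V'} (hs : IsChainHomotopy X' d' (fun n => f n ∘ₗ g n) s) (n : ℤ) :
    IsIso (HomologicalComplex.homologyMap (chainMap h h' hf) n) := by
  have e : chainMap h h' hf ≫ chainMap h' h hg = 𝟙 _ := by
    refine HomologicalComplex.Hom.ext (funext fun n => ModuleCat.hom_ext
      (LinearMap.ext fun x => Subtype.ext (hgf n x.1 x.2)))
  obtain ⟨H⟩ := hs.nonempty_homotopy h' (chainMap h' h hg ≫ chainMap h h' hf) fun n x => rfl
  refine ⟨HomologicalComplex.homologyMap (chainMap h' h hg) n, ?_, ?_⟩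
  · rw [← HomologicalComplex.homologyMap_comp, e, HomologicalComplex.homologyMap_id]
  · rw [← HomologicalComplex.homologyMap_comp, H.homologyMap_eq, HomologicalComplex.homologyMap_id]

namespace MixedDiagram

/-- `s` is a homotopy between `f` and the identity that anticommutes with `B`. -/
structure IsHomotopy (D : MixedDiagram k V) (f s : ℤ → V →ₗ[k] V) : Prop where
  mem : ∀ {n m : ℤ}, n + 1 = m → ∀ x ∈ D.X n, s n x ∈ D.X m
  comm_b : ∀ {l n m : ℤ}, l + 1 = n → n + 1 = m → ∀ x ∈ D.X n,
    D.b m (s n x) + s l (D.b n x) = x - f n x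
  comm_B : ∀ {n m : ℤ}, n + 1 = m → ∀ x ∈ D.X n, D.B m (s n x) + s m (D.B n x) = 0

theorem IsHomotopy.isChainHomotopy {D : MixedDiagram k V} {f s : ℤ → V →ₗ[k] V}
    (h : D.IsHomotopy f s) : IsChainHomotopy D.X D.b f s := ⟨h.mem, h.comm_b⟩

/-- The homotopy acts in each column; anticommutation with `B` cancels the terms that change the
column. As this holds for any set of columns, cyclic, periodic and negative homology are treated
together. -/
theorem IsHomotopy.isChainHomotopy_tot {D : MixedDiagram k V} {f s : ℤ → V →ₗ[k] V}
    (h : D.IsHomotopy f s) (P : Set ℤ) :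
    IsChainHomotopy (D.totX P) (D.totD P) (totMap f) (totMap s) where
  mem {n m} hnm x hx := by
    rw [mem_totX] at hx ⊢
    refine fun p => ⟨fun hp => h.mem (by lia) _ ((hx p).1 hp), fun hp => ?_⟩
    simp [totMap, (hx p).2 hp]
  comm {l n m} hl hm x hx := by
    rw [mem_totX] at hx
    funext p
    change D.totD P m (totMap s n x) p + s (l - 2 * p) (D.totD P n x p) =
      x p - f (n - 2 * p) (x p)
    by_cases hp : p ∈ P
    · rw [totD_pos _ hp, totD_pos _ hp, map_add, add_add_add_comm]
      have h1 := h.comm_b (l := l - 2 * p) (m := m - 2 * p) (by lia) (by lia) _ ((hx p).1 hp)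
      have h2 : D.B (m - 2 * (p + 1)) (s (n - 2 * (p + 1)) (x (p + 1))) +
          s (l - 2 * p) (D.B (n - 2 * (p + 1)) (x (p + 1))) = 0 := by
        by_cases hp' : p + 1 ∈ P
        · rw [show l - 2 * p = m - 2 * (p + 1) by lia]
          exact h.comm_B (by lia) _ ((hx _).1 hp')
        · rw [(hx _).2 hp']
          simp
      refine (congrArg₂ (· + ·) h1 h2).trans (add_zero _)
    · rw [totD_neg _ hp, totD_neg _ hp, (hx p).2 hp]
      simp

section
variable {D : MixedDiagram k V} {D' : MixedDiagram k V'} (h : D.IsMixedComplex)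
  (h' : D'.IsMixedComplex) {f : ℤ → V →ₗ[k] V'} {g : ℤ → V' →ₗ[k] V} (hf : IsHom D D' f)

theorem isIso_homologyMap_hochMap (hg : IsHom D' D g) (hgf : ∀ n, ∀ x ∈ D.X n, g n (f n x) = x)
    {s : ℤ → V' →ₗ[k] V'} (hs : D'.IsHomotopy (fun n => f n ∘ₗ g n) s) (n : ℤ) :
    IsIso (HomologicalComplex.homologyMap (hochMap h h' hf) n) :=
  isIso_homologyMap_chainMap _ _ _ hg.isChainMap hgf hs.isChainHomotopy n

theorem isIso_homologyMap_colMap (hg : IsHom D' D g) (hgf : ∀ n, ∀ x ∈ D.X n, g n (f n x) = x)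
    {s : ℤ → V' →ₗ[k] V'} (hs : D'.IsHomotopy (fun n => f n ∘ₗ g n) s) (P : Set ℤ) (n : ℤ) :
    IsIso (HomologicalComplex.homologyMap (colMap h h' hf P) n) := by
  refine isIso_homologyMap_chainMap _ _ _ (hg.isChainMap_tot P) (fun n x hx => ?_)
    (hs.isChainHomotopy_tot P) n
  rw [mem_totX] at hx
  funext p
  change g _ (f _ (x p)) = x p
  by_cases hp : p ∈ P
  · exact hgf _ _ ((hx p).1 hp)
  · rw [(hx p).2 hp, map_zero, map_zero]

theorem isIso_hochMap (hb : ∀ n, Set.BijOn (f n) (D.X n) (D'.X n)) : IsIso (hochMap h h' hf) :=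
  isIso_chainMap _ _ _ hb

theorem isIso_colMap (hb : ∀ n, Set.BijOn (f n) (D.X n) (D'.X n)) (P : Set ℤ) :
    IsIso (colMap h h' hf P) := by
  refine isIso_chainMap _ _ _ fun n => ⟨(hf.isChainMap_tot P).mem n, ?_, ?_⟩
  · intro x hx y hy e
    have hx := mem_totX.1 hx
    have hy := mem_totX.1 hy
    funext p
    by_cases hp : p ∈ P
    · exact (hb _).injOn ((hx p).1 hp) ((hy p).1 hp) (congrFun e p)
    · rw [(hx p).2 hp, (hy p).2 hp]
  · intro y hy
    have hy := mem_totX.1 hy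
    have : ∀ p, ∃ x, (p ∈ P → x ∈ D.X (n - 2 * p)) ∧ (p ∉ P → x = 0) ∧ f (n - 2 * p) x = y p := by
      intro p
      by_cases hp : p ∈ P
      · obtain ⟨x, hx, e⟩ := (hb _).surjOn ((hy p).1 hp)
        exact ⟨x, fun _ => hx, fun h => (h hp).elim, e⟩
      · exact ⟨0, fun h => (hp h).elim, fun _ => rfl, by rw [map_zero, (hy p).2 hp]⟩
    choose x hx1 hx2 hx3 using this
    exact ⟨x, mem_totX.2 fun p => ⟨hx1 p, hx2 p⟩, funext hx3⟩

end

end MixedDiagram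

namespace DoubleMixedDiagram

/-- `s` is a homotopy between `f` and the identity of the rows that anticommutes with `β` and `B`. -/
structure IsHomotopy (D : DoubleMixedDiagram k V) (f s : ℤ → ℤ → V →ₗ[k] V) : Prop where
  mem : ∀ {v v' : ℤ} (w : ℤ), v + 1 = v' → ∀ x ∈ D.X v w, s v w x ∈ D.X v' w
  comm_b : ∀ {v₁ v v₂ : ℤ} (w : ℤ), v₁ + 1 = v → v + 1 = v₂ → ∀ x ∈ D.X v w,
    D.b v₂ w (s v w x) + s v₁ w (D.b v w x) = x - f v w x
  comm_β : ∀ {v v' w w' : ℤ}, v + 1 = v' → w' + 1 = w → ∀ x ∈ D.X v w,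
    D.β v' w (s v w x) + s v w' (D.β v w x) = 0
  comm_B : ∀ {v v' : ℤ} (w : ℤ), v + 1 = v' → ∀ x ∈ D.X v w,
    D.B v' w (s v w x) + s v' w (D.B v w x) = 0

/-- The operator of total degree `1` with components `s v w`. -/
def totalHomotopy (s : ℤ → ℤ → V →ₗ[k] V) (n : ℤ) : (ℤ → V) →ₗ[k] (ℤ → V) :=
  LinearMap.pi fun p => s (p - 1) (n - (p - 1)) ∘ₗ LinearMap.proj (p - 1)

theorem totalHomotopy_apply (s : ℤ → ℤ → V →ₗ[k] V) (n : ℤ) (x : ℤ → V) (p : ℤ) :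
    totalHomotopy s n x p = s (p - 1) (n - (p - 1)) (x (p - 1)) := rfl

theorem IsHomotopy.total {D : DoubleMixedDiagram k V} {f s : ℤ → ℤ → V →ₗ[k] V}
    (h : D.IsHomotopy f s) : D.total.IsHomotopy (totalMap f) (totalHomotopy s) where
  mem {n m} e x hx := by
    subst e
    rw [mem_total] at hx ⊢
    intro p
    have := h.mem (v' := p) _ (by lia) _ (hx (p - 1))
    rw [totalHomotopy_apply]
    rwa [show n - (p - 1) = n + 1 - p by ring] at this ⊢
  comm_b {l n m} hl hm x hx := by
    subst hl
    subst hm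
    rw [mem_total] at hx
    funext p
    have h1 := h.comm_b (v₁ := p - 1) (v₂ := p + 1) _ (by lia) rfl _ (hx p)
    have h2 := h.comm_β (v' := p) (w' := l + 1 - p) (by lia) (by lia) _ (hx (p - 1))
    change D.total.b _ _ p + totalHomotopy s l _ p = x p - f p (l + 1 - p) (x p)
    simp only [total_b, totalHomotopy_apply, map_add]
    rw [show p - 1 + 1 = p by ring, show p + 1 - 1 = p by ring,
      show l - (p - 1) = l + 1 - p by ring, show l + 1 + 1 - (p + 1) = l + 1 - p by ring,
      show l + 1 + 1 - p = l + 1 - (p - 1) by ring, add_add_add_comm, h1, h2, add_zero]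
  comm_B {n m} e x hx := by
    subst e
    rw [mem_total] at hx
    funext p
    have h1 := h.comm_B (v' := p - 1) _ (by lia) _ (hx (p - 1 - 1))
    change D.total.B _ _ p + totalHomotopy s _ _ p = 0
    simp only [total_B, totalHomotopy_apply]
    rw [show n + 1 - (p - 1) = n - (p - 1 - 1) by ring]
    exact h1

end DoubleMixedDiagram

end ChainHomotopy

/-! ### The weight grading -/

section Weight

open MulOpposite CleftExt

variable {k : Type u} {A : Type v} {M : Type w} [CommRing k] [Ring A] [Algebra k A]
  [AddCommGroup M] [Module k M] [Module A M] [Module Aᵐᵒᵖ M]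
  [SMulCommClass A Aᵐᵒᵖ M] [IsScalarTower k A M] [IsScalarTower k Aᵐᵒᵖ M]
variable (T : AssocBimoduleMap k A M) (K : Subalgebra k A)

/-- `A` in weight `0` and `M` in weight `1`. -/
def gradeSub (j : ℤ) : Submodule k (CleftExt T) :=
  if j = 0 then subA T else if j = 1 then subM T else ⊥

variable {T}

theorem gradeSub_cases {j : ℤ} {x : CleftExt T} (h : x ∈ gradeSub T j) :
    (j = 0 ∧ x ∈ subA T) ∨ (j = 1 ∧ x ∈ subM T) ∨ x = 0 := by
  unfold gradeSub at h
  split_ifs at h with h0 h1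
  exacts [Or.inl ⟨h0, h⟩, Or.inr (Or.inl ⟨h1, h⟩), Or.inr (Or.inr h)]

/-- The summand `0` is the shift `δ` of the general form used in `IsHomogeneous.faceNat`; it is `0`
for `opMul` and `opAct`, and `-1` for `opTri`. -/
theorem opMul_mem_gradeSub {a b : ℤ} {x y : CleftExt T} (hx : x ∈ gradeSub T a)
    (hy : y ∈ gradeSub T b) : opMul T x y ∈ gradeSub T (a + b + 0) := by
  rcases gradeSub_cases hx with ⟨rfl, h⟩ | ⟨rfl, h⟩ | rfl
  · rcases gradeSub_cases hy with ⟨rfl, h'⟩ | ⟨rfl, h'⟩ | rfl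
    · exact opMul_mem_subA h h'
    · exact opMul_mem_subM_right h' _
    · rw [map_zero]; exact zero_mem _
  · rcases gradeSub_cases hy with ⟨rfl, h'⟩ | ⟨rfl, h'⟩ | rfl
    · exact opMul_mem_subM_left h _
    · rw [opMul_eq_zero h h']; exact zero_mem _
    · rw [map_zero]; exact zero_mem _
  · rw [map_zero]; exact zero_mem _

theorem opAct_mem_gradeSub {a b : ℤ} {x y : CleftExt T} (hx : x ∈ gradeSub T a)
    (hy : y ∈ gradeSub T b) : opAct T x y ∈ gradeSub T (a + b + 0) := by
  have key : ∀ {x y : CleftExt T}, x ∈ subM T ∨ y ∈ subA T → opAct T x y = 0 := by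
    rintro x y (h | h)
    · rw [mem_subM] at h; apply CleftExt.ext <;> simp [h]
    · rw [mem_subA] at h; apply CleftExt.ext <;> simp [h]
  rcases gradeSub_cases hx with ⟨rfl, h⟩ | ⟨rfl, h⟩ | rfl
  · rcases gradeSub_cases hy with ⟨rfl, h'⟩ | ⟨rfl, h'⟩ | rfl
    · rw [key (Or.inr h')]; exact zero_mem _
    · exact (mem_subM T).2 rfl
    · rw [map_zero]; exact zero_mem _
  · rw [key (Or.inl h)]; exact zero_mem _
  · rw [map_zero]; exact zero_mem _

theorem opTri_mem_gradeSub {a b : ℤ} {x y : CleftExt T} (hx : x ∈ gradeSub T a)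
    (hy : y ∈ gradeSub T b) : opTri T x y ∈ gradeSub T (a + b + -1) := by
  rcases gradeSub_cases hx with ⟨rfl, h⟩ | ⟨rfl, h⟩ | rfl
  · rw [opTri_of_left_mem h]; exact zero_mem _
  · rcases gradeSub_cases hy with ⟨rfl, h'⟩ | ⟨rfl, h'⟩ | rfl
    · rw [opTri_of_right_mem h']; exact zero_mem _
    · exact opTri_mem_subM x y
    · rw [map_zero]; exact zero_mem _
  · rw [map_zero]; exact zero_mem _

theorem piM_mem_gradeSub {a : ℤ} {x : CleftExt T} (hx : x ∈ gradeSub T a) :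
    piM T x ∈ gradeSub T a := by
  rcases gradeSub_cases hx with ⟨rfl, h⟩ | ⟨rfl, h⟩ | rfl
  · rw [piM_of_mem_subA h]; exact zero_mem _
  · exact piM_mem T x
  · rw [map_zero]; exact zero_mem _

theorem piA_mem_gradeSub {a : ℤ} {x : CleftExt T} (hx : x ∈ gradeSub T a) :
    piA T x ∈ gradeSub T a := by
  rcases gradeSub_cases hx with ⟨rfl, h⟩ | ⟨rfl, h⟩ | rfl
  · exact piA_mem T x
  · rw [piA_of_mem_subM h]; exact zero_mem _
  · rw [map_zero]; exact zero_mem _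

variable (T)

/-- The letters `w 0, …, w n` are homogeneous, of total weight `W`. -/
def IsHomogeneous (n : ℕ) (W : ℤ) (w : ℕ → CleftExt T) : Prop :=
  ∃ σ : ℕ → ℤ, (∀ i ≤ n, w i ∈ gradeSub T (σ i)) ∧ ∑ i ∈ Finset.range (n + 1), σ i = W

variable {T}

theorem sum_faceNat (δ : ℤ) {n j : ℕ} (hj : j ≤ n + 1) (σ : ℕ → ℤ) :
    ∑ i ∈ Finset.range (n + 1), faceNat (fun a b => a + b + δ) n j σ i =
      ∑ i ∈ Finset.range (n + 2), σ i + δ := by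
  rcases Nat.lt_or_ge j (n + 1) with h | h
  · obtain ⟨r, rfl⟩ : ∃ r, n = j + r := ⟨n - j, by omega⟩
    rw [show j + r + 1 = j + (r + 1) by ring, show j + r + 2 = j + (r + 2) by ring,
      Finset.sum_range_add _ j, Finset.sum_range_add _ j, Finset.sum_range_succ' _ r,
      Finset.sum_range_succ' _ (r + 1), Finset.sum_range_succ' _ r]
    have e1 : ∀ i ∈ Finset.range j, faceNat (fun a b => a + b + δ) (j + r) j σ i = σ i := by
      intro i hi
      rw [Finset.mem_range] at hi
      simp only [faceNat]
      rw [if_neg (by omega), if_pos hi]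
    have e2 : ∀ i ∈ Finset.range r,
        faceNat (fun a b => a + b + δ) (j + r) j σ (j + (i + 1)) = σ (j + (i + 1 + 1)) := by
      intro i hi
      simp only [faceNat]
      rw [if_neg (by omega), if_neg (by omega), if_neg (by omega)]
      rfl
    have e3 : faceNat (fun a b => a + b + δ) (j + r) j σ (j + 0) = σ j + σ (j + 1) + δ := by
      simp only [faceNat]
      rw [if_neg (by omega), if_neg (by omega), if_pos (add_zero j)]
    rw [Finset.sum_congr rfl e1, Finset.sum_congr rfl e2, e3]
    simp only [add_zero, zero_add]
    ring
  · obtain rfl : j = n + 1 := by omega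
    rw [Finset.sum_range_succ', Finset.sum_range_succ, Finset.sum_range_succ']
    have e1 : ∀ i ∈ Finset.range n,
        faceNat (fun a b => a + b + δ) n (n + 1) σ (i + 1) = σ (i + 1) := by
      intro i hi
      simp [faceNat]
    rw [Finset.sum_congr rfl e1]
    simp only [faceNat, if_true]
    ring

theorem IsHomogeneous.faceNat {op : CleftExt T →ₗ[k] CleftExt T →ₗ[k] CleftExt T} {δ : ℤ}
    (hop : ∀ {a b : ℤ} {x y : CleftExt T}, x ∈ gradeSub T a → y ∈ gradeSub T b →
      op x y ∈ gradeSub T (a + b + δ)) {n j : ℕ} (hj : j ≤ n + 1) {W : ℤ} {w : ℕ → CleftExt T}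
    (h : IsHomogeneous T (n + 1) W w) :
    IsHomogeneous T n (W + δ) (faceNat (fun a b => op a b) n j w) := by
  obtain ⟨σ, hσ, rfl⟩ := h
  refine ⟨CleftHomology.faceNat (fun a b => a + b + δ) n j σ, fun i hi => ?_, sum_faceNat δ hj σ⟩
  simp only [CleftHomology.faceNat]
  split_ifs with h1 h2 h3 h4
  · exact hop (hσ _ le_rfl) (hσ _ (by omega))
  · exact hσ _ (by omega)
  · exact hσ _ (by omega)
  · exact hop (hσ _ (by omega)) (hσ _ (by omega))
  · exact hσ _ (by omega)

theorem IsHomogeneous.congr {n : ℕ} {W : ℤ} {w w' : ℕ → CleftExt T} (h : IsHomogeneous T n W w)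
    (e : ∀ i ≤ n, w' i = w i) : IsHomogeneous T n W w' := by
  obtain ⟨σ, hσ, hW⟩ := h
  exact ⟨σ, fun i hi => by rw [e i hi]; exact hσ i hi, hW⟩

theorem IsHomogeneous.rotNat {n l : ℕ} (hl : l ≤ n + 1) {W : ℤ} {w : ℕ → CleftExt T}
    (h : IsHomogeneous T n W w) : IsHomogeneous T n W (rotNat n l w) := by
  induction l with
  | zero => exact h.congr fun i _ => by simp [CleftHomology.rotNat]
  | succ l ih =>
    obtain ⟨σ, hσ, hW⟩ := ih (by omega)
    refine IsHomogeneous.congr ⟨CleftHomology.rotNat n 1 σ, fun i hi => ?_, ?_⟩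
      fun i _ => (rotNat_rotNat (by omega) w i).symm
    · rw [CleftHomology.rotNat, CleftHomology.rotNat]
      split_ifs
      exacts [hσ _ (by omega), hσ _ (by omega)]
    · rw [← hW, Finset.sum_range_succ', Finset.sum_range_succ]
      simp [CleftHomology.rotNat]

theorem IsHomogeneous.consNat {n : ℕ} {W : ℤ} {w : ℕ → CleftExt T}
    (h : IsHomogeneous T n W w) : IsHomogeneous T (n + 1) W (consNat 1 w) := by
  obtain ⟨σ, hσ, rfl⟩ := h
  refine ⟨CleftHomology.consNat 0 σ, fun i hi => ?_, ?_⟩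
  · rw [CleftHomology.consNat, CleftHomology.consNat]
    split_ifs
    exacts [one_mem_subA, hσ _ (by omega)]
  · rw [Finset.sum_range_succ']
    simp [CleftHomology.consNat]

theorem IsHomogeneous.update {n : ℕ} {W : ℤ} {w : ℕ → CleftExt T}
    (h : IsHomogeneous T n W w) {f : CleftExt T →ₗ[k] CleftExt T}
    (hf : ∀ {a : ℤ} {x : CleftExt T}, x ∈ gradeSub T a → f x ∈ gradeSub T a) :
    IsHomogeneous T n W (Function.update w 0 (f (w 0))) := by
  obtain ⟨σ, hσ, hW⟩ := h
  refine ⟨σ, fun i hi => ?_, hW⟩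
  by_cases h0 : i = 0
  · subst h0
    rw [Function.update_self]
    exact hf (hσ _ hi)
  · rw [Function.update_of_ne h0]
    exact hσ _ hi

/-- A homogeneous word is zero, or its letters in `M` are those with index in a set of `W` elements. -/
theorem IsHomogeneous.exists_finset {n : ℕ} {W : ℤ} {w : ℕ → CleftExt T}
    (h : IsHomogeneous T n W w) : word k n w = 0 ∨ ∃ S ⊆ Finset.range (n + 1), (S.card : ℤ) = W ∧
      (∀ i ∈ S, w i ∈ subM T) ∧ ∀ i ≤ n, i ∉ S → w i ∈ subA T := by
  obtain ⟨σ, hσ, hW⟩ := h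
  -- A zero letter may be assigned any weight. Once such words are set aside, every letter has
  -- weight `0` or `1` and the total weight counts the letters in `M`.
  by_cases hz : ∃ i ≤ n, w i = 0
  · obtain ⟨i, hi, h0⟩ := hz
    exact Or.inl (word_eq_zero hi h0)
  · push Not at hz
    refine Or.inr ⟨(Finset.range (n + 1)).filter fun i => σ i = 1, Finset.filter_subset _ _, ?_,
      fun i hi => ?_, fun i hi hS => ?_⟩
    · rw [← hW, Finset.card_filter, Nat.cast_sum]
      refine Finset.sum_congr rfl fun i hi => ?_
      have hi : i ≤ n := Nat.lt_succ_iff.1 (Finset.mem_range.1 hi)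
      rcases gradeSub_cases (hσ i hi) with ⟨h0, -⟩ | ⟨h1, -⟩ | h
      · simp [h0]
      · simp [h1]
      · exact (hz i hi h).elim
    · rw [Finset.mem_filter, Finset.mem_range] at hi
      have := hσ i (by omega)
      rwa [hi.2] at this
    · rcases gradeSub_cases (hσ i hi) with ⟨-, h⟩ | ⟨h1, -⟩ | h
      · exact h
      · simp only [Finset.mem_filter, Finset.mem_range, h1, and_true, not_lt] at hS
        omega
      · exact (hz i hi h).elim

theorem isHomogeneous_of_finset {n : ℕ} {w : ℕ → CleftExt T} {S : Finset ℕ}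
    (hS : S ⊆ Finset.range (n + 1)) (hM : ∀ i ∈ S, w i ∈ subM T)
    (hA : ∀ i ≤ n, i ∉ S → w i ∈ subA T) : IsHomogeneous T n S.card w := by
  refine ⟨fun i => if i ∈ S then 1 else 0, fun i hi => ?_, ?_⟩
  · by_cases h : i ∈ S
    · simpa [if_pos h] using (show w i ∈ gradeSub T 1 from hM i h)
    · simpa [if_neg h] using (show w i ∈ gradeSub T 0 from hA i hi h)
  · rw [Finset.sum_ite_mem, Finset.inter_eq_right.2 hS]
    simp

/-- A set of letters in `M` with a maximal element. -/
theorem exists_isLast {n : ℕ} {w : ℕ → CleftExt T} {S : Finset ℕ}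
    (hS : S ⊆ Finset.range (n + 1)) (hM : ∀ i ∈ S, w i ∈ subM T)
    (hA : ∀ i ≤ n, i ∉ S → w i ∈ subA T) (hne : S.Nonempty) : ∃ i, IsLast T n i w := by
  refine ⟨S.max' hne, ?_, hM _ (S.max'_mem hne), fun r hr hrn => hA r hrn fun h => ?_⟩
  · exact Nat.lt_succ_iff.1 (Finset.mem_range.1 (hS (S.max'_mem hne)))
  · exact absurd (S.le_max' r h) (not_le.2 hr)

theorem IsHomogeneous.exists_isLast {n : ℕ} {W : ℤ} (hW : 1 ≤ W) {w : ℕ → CleftExt T}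
    (h : IsHomogeneous T n W w) : word k n w = 0 ∨ ∃ i, IsLast T n i w := by
  rcases h.exists_finset with h0 | ⟨S, hS, hc, hM, hA⟩
  · exact Or.inl h0
  · exact Or.inr (CleftHomology.exists_isLast hS hM hA (Finset.card_pos.1 (by omega)))

variable (T)

/-- The span of the homogeneous words of degree `n` and total weight `W`. -/
def weightPart (n W : ℤ) : Submodule k (Chains (baseSub T K)) :=
  Submodule.span k {z | ∃ (m : ℕ) (w : ℕ → CleftExt T), (m : ℤ) = n ∧ IsHomogeneous T m W w ∧
    z = chain (baseSub T K) m (word k m w)}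

variable {T} {K}

theorem IsHomogeneous.mem_weightPart {m : ℕ} {n W : ℤ} {w : ℕ → CleftExt T}
    (h : IsHomogeneous T m W w) (e : (m : ℤ) = n) :
    chain (baseSub T K) m (word k m w) ∈ weightPart T K n W :=
  Submodule.subset_span ⟨m, w, e, h, rfl⟩

theorem weightPart_le {n W : ℤ} {Q : Submodule k (Chains (baseSub T K))}
    (h : ∀ (m : ℕ) (w : ℕ → CleftExt T), (m : ℤ) = n → IsHomogeneous T m W w →
      chain (baseSub T K) m (word k m w) ∈ Q) : weightPart T K n W ≤ Q := by
  refine Submodule.span_le.2 ?_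
  rintro _ ⟨m, w, e, hw, rfl⟩
  exact h m w e hw

theorem weightPart_le_degreePart (n W : ℤ) :
    weightPart T K n W ≤ degreePart (baseSub T K) n :=
  weightPart_le fun m w e _ => by
    subst e
    exact chain_mem_degreePart m _

theorem weightPart_le_finChains (n W : ℤ) : weightPart T K n W ≤ finChains (baseSub T K) :=
  (weightPart_le_degreePart n W).trans (degreePart_le_finChains n)

variable (T K)

/-- The part of degree `n` and total weight `W` with the factor of index `0` in `M`. -/
def weightM (n W : ℤ) : Submodule k (Chains (baseSub T K)) :=
  weightPart T K n W ⊓ LinearMap.ker (headA T K)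

/-- The part of degree `n` and total weight `W` with the factor of index `0` in `A`. -/
def weightA (n W : ℤ) : Submodule k (Chains (baseSub T K)) :=
  weightPart T K n W ⊓ LinearMap.ker (headM T K)

variable {T K}

/-- On the kernel of `headA` the projection `headM` is the identity, and it carries the spanning
words to words that start in `M`. So `weightM`, defined as an intersection, is also spanned by such
words. -/
theorem weightM_le {n W : ℤ} {Q : Submodule k (Chains (baseSub T K))}
    (h : ∀ (m : ℕ) (w : ℕ → CleftExt T), (m : ℤ) = n → IsHomogeneous T m W w → w 0 ∈ subM T →
      chain (baseSub T K) m (word k m w) ∈ Q) : weightM T K n W ≤ Q := by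
  rintro x ⟨hx, h0⟩
  have e := headA_add_headM K (weightPart_le_finChains n W hx)
  rw [LinearMap.mem_ker.1 h0, zero_add] at e
  rw [← e]
  refine weightPart_le (Q := Q.comap (headM T K)) (fun m w e hw => ?_) hx
  rw [Submodule.mem_comap, headM_word]
  exact h m _ e (hw.update piM_mem_gradeSub) (by rw [Function.update_self]; exact piM_mem T _)

theorem weightA_le {n W : ℤ} {Q : Submodule k (Chains (baseSub T K))}
    (h : ∀ (m : ℕ) (w : ℕ → CleftExt T), (m : ℤ) = n → IsHomogeneous T m W w → w 0 ∈ subA T →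
      chain (baseSub T K) m (word k m w) ∈ Q) : weightA T K n W ≤ Q := by
  rintro x ⟨hx, h0⟩
  have e := headA_add_headM K (weightPart_le_finChains n W hx)
  rw [LinearMap.mem_ker.1 h0, add_zero] at e
  rw [← e]
  refine weightPart_le (Q := Q.comap (headA T K)) (fun m w e hw => ?_) hx
  rw [Submodule.mem_comap, headA_word]
  exact h m _ e (hw.update piA_mem_gradeSub) (by rw [Function.update_self]; exact piA_mem T _)

theorem word_mem_weightM {m : ℕ} {n W : ℤ} {w : ℕ → CleftExt T} (h : IsHomogeneous T m W w)
    (e : (m : ℤ) = n) (h0 : w 0 ∈ subM T) :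
    chain (baseSub T K) m (word k m w) ∈ weightM T K n W :=
  ⟨h.mem_weightPart e, headA_word_of_subM K h0⟩

theorem word_mem_weightA {m : ℕ} {n W : ℤ} {w : ℕ → CleftExt T} (h : IsHomogeneous T m W w)
    (e : (m : ℤ) = n) (h0 : w 0 ∈ subA T) :
    chain (baseSub T K) m (word k m w) ∈ weightA T K n W :=
  ⟨h.mem_weightPart e, headM_word_of_subA K h0⟩

theorem headM_mem_weightM {n W : ℤ} {x : Chains (baseSub T K)} (hx : x ∈ weightPart T K n W) :
    headM T K x ∈ weightM T K n W := by
  refine weightPart_le (Q := (weightM T K n W).comap (headM T K)) (fun m w e h => ?_) hx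
  rw [Submodule.mem_comap, headM_word]
  exact word_mem_weightM (h.update piM_mem_gradeSub) e (by simpa using piM_mem T _)

theorem headA_mem_weightA {n W : ℤ} {x : Chains (baseSub T K)} (hx : x ∈ weightPart T K n W) :
    headA T K x ∈ weightA T K n W := by
  refine weightPart_le (Q := (weightA T K n W).comap (headA T K)) (fun m w e h => ?_) hx
  rw [Submodule.mem_comap, headA_word]
  exact word_mem_weightA (h.update piA_mem_gradeSub) e (by simpa using piA_mem T _)

/-! ### The operators and the weight grading -/

theorem sface_mem_weightPart {op : CleftExt T →ₗ[k] CleftExt T →ₗ[k] CleftExt T} {δ : ℤ}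
    (hop : ∀ {a b : ℤ} {x y : CleftExt T}, x ∈ gradeSub T a → y ∈ gradeSub T b →
      op x y ∈ gradeSub T (a + b + δ)) {m j : ℕ} (hj : j ≤ m + 1) {n W : ℤ} {w : ℕ → CleftExt T}
    (h : IsHomogeneous T (m + 1) W w) (e : (m : ℤ) = n) :
    chain (baseSub T K) m (sface op m j (word k (m + 1) w)) ∈ weightPart T K n (W + δ) := by
  rw [sface_word _ hj, map_smul]
  exact Submodule.smul_mem _ _ ((h.faceNat hop hj).mem_weightPart e)

theorem IsBoundary.mem_weightPart {op : CleftExt T →ₗ[k] CleftExt T →ₗ[k] CleftExt T} {δ : ℤ}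
    (hop : ∀ {a b : ℤ} {x y : CleftExt T}, x ∈ gradeSub T a → y ∈ gradeSub T b →
      op x y ∈ gradeSub T (a + b + δ)) {D : Chains (baseSub T K) →ₗ[k] Chains (baseSub T K)}
    (hD : IsBoundary (baseSub T K) op D) {n n' W : ℤ} (hn : n' + 1 = n)
    {x : Chains (baseSub T K)} (hx : x ∈ weightPart T K n W) :
    D x ∈ weightPart T K n' (W + δ) := by
  refine weightPart_le (Q := (weightPart T K n' (W + δ)).comap D) (fun m w e h => ?_) hx
  rw [Submodule.mem_comap]
  cases m with
  | zero => rw [hD.zero]; exact zero_mem _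
  | succ m =>
    rw [hD.succ, map_sum]
    push_cast at e
    exact sum_mem fun j hj => sface_mem_weightPart hop
      (Nat.lt_succ_iff.1 (Finset.mem_range.1 hj)) h (by omega)

theorem muSum_mem_weightPart {n n' W : ℤ} (hn : n' + 1 = n) {x : Chains (baseSub T K)}
    (hx : x ∈ weightPart T K n W) : muSum T K x ∈ weightPart T K n' W := by
  simpa using (isBoundary_muSum T K).mem_weightPart opMul_mem_gradeSub hn hx

theorem rhoD_mem_weightPart {n n' W W' : ℤ} (hn : n' + 1 = n) (hW : W' + 1 = W)
    {x : Chains (baseSub T K)} (hx : x ∈ weightPart T K n W) :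
    rhoD T K x ∈ weightPart T K n' W' := by
  rw [show W' = W + -1 by omega]
  exact (isBoundary_rhoD T K).mem_weightPart opTri_mem_gradeSub hn hx

/-- Since `M` absorbs `op` on both sides, every face of a word that starts in `M` starts in `M`
again. -/
theorem headA_sface_of_subM {op : CleftExt T →ₗ[k] CleftExt T →ₗ[k] CleftExt T}
    (hl : ∀ x ∈ subM T, ∀ y, op x y ∈ subM T) (hr : ∀ x, ∀ y ∈ subM T, op x y ∈ subM T)
    {n j : ℕ} (hj : j ≤ n + 1) {w : ℕ → CleftExt T} (h0 : w 0 ∈ subM T) :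
    headA T K (chain (baseSub T K) n (sface op n j (word k (n + 1) w))) = 0 := by
  rw [sface_word _ hj, map_smul, map_smul, headA_word_of_subM, smul_zero]
  simp only [faceNat]
  split_ifs with h1 h3 h4
  · exact hr _ _ h0
  · exact h0
  · exact hl _ (h4 ▸ h0) _
  · omega

theorem muSum_mem_weightM {n n' W : ℤ} (hn : n' + 1 = n) {x : Chains (baseSub T K)}
    (hx : x ∈ weightM T K n W) : muSum T K x ∈ weightM T K n' W := by
  refine ⟨muSum_mem_weightPart hn hx.1, ?_⟩
  refine weightM_le (Q := (LinearMap.ker (headA T K)).comap (muSum T K)) (fun m w e h h0 => ?_) hx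
  rw [Submodule.mem_comap, LinearMap.mem_ker]
  cases m with
  | zero => rw [(isBoundary_muSum T K).zero, map_zero]
  | succ m =>
    rw [(isBoundary_muSum T K).succ, map_sum, map_sum]
    exact Finset.sum_eq_zero fun j hj => headA_sface_of_subM
      (fun _ h _ => opMul_mem_subM_left h _) (fun _ _ h => opMul_mem_subM_right h _)
      (Nat.lt_succ_iff.1 (Finset.mem_range.1 hj)) h0

theorem rhoD_mem_weightM {n n' W W' : ℤ} (hn : n' + 1 = n) (hW : W' + 1 = W)
    {x : Chains (baseSub T K)} (hx : x ∈ weightM T K n W) : rhoD T K x ∈ weightM T K n' W' := by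
  refine ⟨rhoD_mem_weightPart hn hW hx.1, ?_⟩
  refine weightM_le (Q := (LinearMap.ker (headA T K)).comap (rhoD T K)) (fun m w e h h0 => ?_) hx
  rw [Submodule.mem_comap, LinearMap.mem_ker]
  cases m with
  | zero => rw [(isBoundary_rhoD T K).zero, map_zero]
  | succ m =>
    rw [(isBoundary_rhoD T K).succ, map_sum, map_sum]
    exact Finset.sum_eq_zero fun j hj => headA_sface_of_subM
      (fun _ _ _ => opTri_mem_subM _ _) (fun _ _ _ => opTri_mem_subM _ _)
      (Nat.lt_succ_iff.1 (Finset.mem_range.1 hj)) h0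

theorem rhoD'_mem_weightM {n n' W W' : ℤ} (hn : n' + 1 = n) (hW : W' + 1 = W)
    {x : Chains (baseSub T K)} (hx : x ∈ weightM T K n W) : rhoD' T K x ∈ weightM T K n' W' := by
  refine weightM_le (Q := (weightM T K n' W').comap (rhoD' T K)) (fun m w e h h0 => ?_) hx
  rw [Submodule.mem_comap]
  cases m with
  | zero => rw [rhoD'_chain_zero]; exact zero_mem _
  | succ m =>
    rw [rhoD'_chain_succ, map_sum]
    push_cast at e
    refine sum_mem fun j hj => ?_
    rw [Finset.mem_range] at hj
    refine ⟨?_, headA_sface_of_subM (fun _ _ _ => opTri_mem_subM _ _)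
      (fun _ _ _ => opTri_mem_subM _ _) (by omega) h0⟩
    rw [show W' = W + -1 by omega]
    exact sface_mem_weightPart opTri_mem_gradeSub (by omega) h (by omega)

theorem rhoD_mem_weightA {n n' W W' : ℤ} (hn : n' + 1 = n) (hW : W' + 1 = W)
    {x : Chains (baseSub T K)} (hx : x ∈ weightA T K n W) : rhoD T K x ∈ weightA T K n' W' := by
  refine ⟨rhoD_mem_weightPart hn hW hx.1, ?_⟩
  refine weightA_le (Q := (LinearMap.ker (headM T K)).comap (rhoD T K)) (fun m w e h h0 => ?_) hx
  rw [Submodule.mem_comap, LinearMap.mem_ker]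
  cases m with
  | zero => rw [(isBoundary_rhoD T K).zero, map_zero]
  | succ m =>
    rw [(isBoundary_rhoD T K).succ, map_sum, map_sum]
    refine Finset.sum_eq_zero fun j hj => ?_
    rw [Finset.mem_range] at hj
    by_cases h1 : j = 0
    · subst h1
      rw [sface_eq_zero (Nat.zero_le _) (opTri_of_left_mem h0 _), map_zero, map_zero]
    · by_cases h2 : j = m + 1
      · subst h2
        rw [sface_eq_zero le_rfl (by simpa using opTri_of_right_mem h0 _), map_zero, map_zero]
      · rw [sface_word _ (by omega), map_smul, map_smul, headM_word_of_subA, smul_zero]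
        simp only [faceNat]
        rw [if_neg (by omega), if_pos (by omega)]
        exact h0

theorem sface_opTri_of_weight_one {n j : ℕ} (hj : j ≤ n + 1) {w : ℕ → CleftExt T}
    (h : IsHomogeneous T (n + 1) 1 w) : sface (opTri T) n j (word k (n + 1) w) = 0 := by
  rcases h.exists_finset with h0 | ⟨S, hS, hc, hM, hA⟩
  · rw [h0, map_zero]
  · obtain ⟨i, rfl⟩ := Finset.card_eq_one.1 (by exact_mod_cast hc : S.card = 1)
    refine sface_eq_zero hj ?_
    by_cases hi : j = i
    · refine opTri_of_right_mem (hA _ (by split_ifs <;> omega) ?_) _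
      rw [Finset.mem_singleton]
      split_ifs <;> omega
    · exact opTri_of_left_mem (hA _ hj (by rwa [Finset.mem_singleton])) _

/-- $\triangledown$ needs two factors in `M`, and in weight one there is a single one. The vanishing
is required in row `w = 0`, where the target of `d` is zero by definition. -/
theorem rhoD_eq_zero {n : ℤ} {x : Chains (baseSub T K)} (hx : x ∈ weightPart T K n 1) :
    rhoD T K x = 0 := by
  refine weightPart_le (Q := LinearMap.ker (rhoD T K)) (fun m w e h => ?_) hx
  rw [LinearMap.mem_ker]
  cases m with
  | zero => exact (isBoundary_rhoD T K).zero _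
  | succ m =>
    rw [(isBoundary_rhoD T K).succ, Finset.sum_eq_zero, map_zero]
    exact fun j hj => sface_opTri_of_weight_one (Nat.lt_succ_iff.1 (Finset.mem_range.1 hj)) h

theorem rhoD'_eq_zero {n : ℤ} {x : Chains (baseSub T K)} (hx : x ∈ weightPart T K n 1) :
    rhoD' T K x = 0 := by
  refine weightPart_le (Q := LinearMap.ker (rhoD' T K)) (fun m w e h => ?_) hx
  rw [LinearMap.mem_ker]
  cases m with
  | zero => exact rhoD'_chain_zero T K _
  | succ m =>
    rw [rhoD'_chain_succ, Finset.sum_eq_zero, map_zero]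
    exact fun j hj => sface_opTri_of_weight_one (Finset.mem_range.1 hj).le h

theorem muZeroM_mem_weightM {n n' W : ℤ} (hn : n' + 1 = n) {x : Chains (baseSub T K)}
    (hx : x ∈ weightPart T K n W) : muZeroM T K x ∈ weightM T K n' W := by
  refine weightPart_le (Q := (weightM T K n' W).comap (muZeroM T K)) (fun m w e h => ?_) hx
  rw [Submodule.mem_comap]
  cases m with
  | zero => rw [muZeroM_chain_zero]; exact zero_mem _
  | succ m =>
    push_cast at e
    rw [muZeroM_chain_succ, sface_word _ (Nat.zero_le _), map_smul]
    refine Submodule.smul_mem _ _ (word_mem_weightM ?_ (by omega) ?_)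
    · simpa using h.faceNat opAct_mem_gradeSub (Nat.zero_le (m + 1))
    · exact (mem_subM T).2 (by simp [faceNat])

theorem unitCons_rot_mem_weightA {m l : ℕ} (hl : l ≤ m + 1) {n W : ℤ} {w : ℕ → CleftExt T}
    (h : IsHomogeneous T m W w) (e : (m : ℤ) + 1 = n) :
    chain (baseSub T K) (m + 1) (unitCons k _ m ((rot m ^ l) (word k m w))) ∈
      weightA T K n W := by
  rw [rot_pow_word _ _ hl, map_smul, map_smul, unitCons_word]
  refine Submodule.smul_mem _ _ (word_mem_weightA (h.rotNat hl).consNat (by push_cast; exact e) ?_)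
  simpa [consNat] using one_mem_subA

theorem connes_mem_weightA {n n' W : ℤ} (hn : n + 1 = n') {x : Chains (baseSub T K)}
    (hx : x ∈ weightPart T K n W) : connes _ x ∈ weightA T K n' W := by
  refine weightPart_le (Q := (weightA T K n' W).comap (connes _)) (fun m w e h => ?_) hx
  rw [Submodule.mem_comap, connes_chain, map_sum, map_sum]
  exact sum_mem fun l hl => unitCons_rot_mem_weightA (Finset.mem_range.1 hl).le h (by omega)

theorem varthetaOne_mem_weightA {n n' W : ℤ} (hn : n + 1 = n') (hW : 1 ≤ W)
    {x : Chains (baseSub T K)} (hx : x ∈ weightPart T K n W) :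
    varthetaOne T K x ∈ weightA T K n' W := by
  refine weightPart_le (Q := (weightA T K n' W).comap (varthetaOne T K)) (fun m w e h => ?_) hx
  rw [Submodule.mem_comap]
  rcases h.exists_isLast hW with h0 | ⟨i, hi⟩
  · rw [h0, map_zero, map_zero]; exact zero_mem _
  · rw [varthetaOne_word K hi, map_sum, map_sum]
    refine sum_mem fun l hl => unitCons_rot_mem_weightA ?_ h (by omega)
    rw [Finset.mem_range] at hl
    omega

theorem tOp_mem_weightM {n W : ℤ} (hW : 1 ≤ W) {x : Chains (baseSub T K)}
    (hx : x ∈ weightPart T K n W) : tOp T K x ∈ weightM T K n W := by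
  refine weightPart_le (Q := (weightM T K n W).comap (tOp T K)) (fun m w e h => ?_) hx
  rw [Submodule.mem_comap]
  rcases h.exists_isLast hW with h0 | ⟨i, hi⟩
  · rw [h0, map_zero, map_zero]; exact zero_mem _
  · have hle := hi.le
    rw [tOp_word K hi, rot_pow_word _ _ (by omega), map_smul]
    refine Submodule.smul_mem _ _ (word_mem_weightM (h.rotNat (by omega)) e ?_)
    rw [rotNat, if_pos (by omega), show m + 1 - (m + 1 - i) + 0 = i by omega]
    exact hi.mem

theorem normOp_mem_weightM {n W : ℤ} (v : ℤ) (hW : 1 ≤ W) {x : Chains (baseSub T K)}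
    (hx : x ∈ weightM T K n W) : normOp T K v x ∈ weightM T K n W := by
  rw [normOp, LinearMap.sum_apply]
  refine sum_mem fun l hl => ?_
  clear hl
  induction l with
  | zero => simpa using hx
  | succ l ih =>
    rw [pow_succ', Module.End.mul_apply]
    exact tOp_mem_weightM hW ih.1

end Weight

/-! ### The bigraded parts in terms of weights -/

section Parts

open MulOpposite CleftExt

variable {k : Type u} {A : Type v} {M : Type w} [CommRing k] [Ring A] [Algebra k A]
  [AddCommGroup M] [Module k M] [Module A M] [Module Aᵐᵒᵖ M]
  [SMulCommClass A Aᵐᵒᵖ M] [IsScalarTower k A M] [IsScalarTower k Aᵐᵒᵖ M]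
variable {T : AssocBimoduleMap k A M} {K : Subalgebra k A}

theorem eq_zero_of_mem {x : CleftExt T} (h : x ∈ subA T) (h' : x ∈ subM T) : x = 0 :=
  CleftExt.ext ((mem_subM T).1 h') ((mem_subA T).1 h)

theorem card_filter_succ_mem {m : ℕ} {S : Finset ℕ} (hS : S ⊆ Finset.range (m + 1)) :
    ((Finset.univ : Finset (Fin m)).filter fun i : Fin m => (i : ℕ) + 1 ∈ S).card = (S.erase 0).card := by
  refine Finset.card_bij (fun i _ => (i : ℕ) + 1) ?_ ?_ ?_
  · intro i hi
    simpa using hi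
  · intro i _ j _ e
    exact Fin.ext (by omega)
  · intro j hj
    rw [Finset.mem_erase] at hj
    have := Finset.mem_range.1 (hS hj.2)
    refine ⟨⟨j - 1, by omega⟩, ?_, ?_⟩
    · simpa [show j - 1 + 1 = j by omega] using hj.2
    · simp only
      omega

theorem word_mem_tensorPart {F : Submodule k (CleftExt T)} {m : ℕ} {n r : ℤ} (e : (m : ℤ) = n)
    {w : ℕ → CleftExt T} {S : Finset ℕ} (hS : S ⊆ Finset.range (m + 1)) (h0 : w 0 ∈ F)
    (hc : ((S.erase 0).card : ℤ) = r) (hM : ∀ i ∈ S, w i ∈ subM T)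
    (hA : ∀ i ≤ m, i ∉ S → w i ∈ subA T) :
    chain (baseSub T K) m (word k m w) ∈ tensorPart T K F n r := by
  refine Submodule.subset_span ⟨m, Finset.univ.filter fun i : Fin m => (i : ℕ) + 1 ∈ S, fun i => w i, e,
    by rw [card_filter_succ_mem hS, hc], h0, fun i hi => ?_, fun i hi => ?_, rfl⟩
  · simp only [Finset.mem_filter, Finset.mem_univ, true_and] at hi
    simpa using hM _ hi
  · simp only [Finset.mem_filter, Finset.mem_univ, true_and] at hi
    simpa using hA _ (by omega) hi

theorem tensorPart_le {F : Submodule k (CleftExt T)} {n r : ℤ}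
    {Q : Submodule k (Chains (baseSub T K))}
    (h : ∀ (m : ℕ) (w : ℕ → CleftExt T) (S : Finset ℕ), (m : ℤ) = n → w 0 ∈ F →
      S ⊆ Finset.range (m + 1) → 0 ∉ S → (S.card : ℤ) = r → (∀ i ∈ S, w i ∈ subM T) →
      (∀ i ≤ m, i ≠ 0 → i ∉ S → w i ∈ subA T) → chain (baseSub T K) m (word k m w) ∈ Q) :
    tensorPart T K F n r ≤ Q := by
  refine Submodule.span_le.2 ?_
  rintro _ ⟨m, S, x, e, hc, h0, hM, hA, rfl⟩
  rw [tens_eq_chain]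
  have hx : ∀ i : Fin m, extendWord x ((i : ℕ) + 1) = x i.succ := fun i => by
    simpa using extendWord_val x i.succ
  refine h m _ (S.image fun i : Fin m => (i : ℕ) + 1) e ?_ ?_ ?_ ?_ ?_ ?_
  · simpa using (extendWord_val x 0).symm ▸ h0
  · intro i hi
    obtain ⟨j, -, rfl⟩ := Finset.mem_image.1 hi
    exact Finset.mem_range.2 (by omega)
  · simp
  · rw [Finset.card_image_of_injective _ fun a b e => Fin.ext (Nat.succ_injective e), hc]
  · intro i hi
    obtain ⟨j, hj, rfl⟩ := Finset.mem_image.1 hi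
    rw [hx]
    exact hM j hj
  · intro i hi hi0 hS
    obtain ⟨j, rfl⟩ : ∃ j, i = j + 1 := ⟨i - 1, by omega⟩
    have := hx ⟨j, by omega⟩
    simp only at this
    rw [this]
    refine hA _ fun hj => hS (Finset.mem_image.2 ⟨_, hj, rfl⟩)

/-- The weight counts the leading factor as well, hence `w + 1`. The condition on `v` is automatic:
a nonzero word with `v + w + 1` factors, of which `w + 1` are in `M`, has `v ≥ 0`. -/
theorem XPart_eq (v w : ℤ) :
    XPart T K v w = if 0 ≤ w then weightM T K (v + w) (w + 1) else ⊥ := by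
  by_cases hw : 0 ≤ w
  · rw [if_pos hw]
    refine le_antisymm ?_ (weightM_le fun m x e h h0 => ?_)
    · unfold XPart
      split_ifs
      · refine tensorPart_le fun m x S e h0 hS hS0 hc hM hA => ?_
        refine word_mem_weightM ?_ e h0
        have := isHomogeneous_of_finset (T := T) (w := x) (n := m) (S := insert 0 S)
          (Finset.insert_subset (by simp) hS)
          (fun i hi => (Finset.mem_insert.1 hi).elim (fun e => e ▸ h0) (hM i))
          (fun i hi hiS => by
            rw [Finset.mem_insert, not_or] at hiS
            exact hA i hi hiS.1 hiS.2)
        rw [Finset.card_insert_of_notMem hS0] at this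
        push_cast at this
        rwa [hc] at this
      · exact bot_le
    · rcases h.exists_finset with hz | ⟨S, hS, hc, hM, hA⟩
      · rw [hz, map_zero]; exact zero_mem _
      · by_cases h0S : 0 ∈ S
        · have h1 := Finset.card_le_card hS
          rw [Finset.card_range] at h1
          have h2 := Finset.card_erase_of_mem h0S
          have h3 := Finset.card_pos.2 ⟨0, h0S⟩
          rw [XPart, if_pos ⟨by omega, hw⟩]
          exact word_mem_tensorPart e hS h0 (by omega) hM hA
        · rw [word_eq_zero (Nat.zero_le _) (eq_zero_of_mem (hA 0 (Nat.zero_le _) h0S) h0), map_zero]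
          exact zero_mem _
  · rw [if_neg hw, XPart, if_neg (by tauto)]

/-- Here the leading factor is in `A`, so all `w + 1` factors in `M` have positive index; a nonzero
word therefore even has `v ≥ 1`. -/
theorem YPart_eq (v w : ℤ) :
    YPart T K v w = if 0 ≤ w then weightA T K (v + w) (w + 1) else ⊥ := by
  by_cases hw : 0 ≤ w
  · rw [if_pos hw]
    refine le_antisymm ?_ (weightA_le fun m x e h h0 => ?_)
    · unfold YPart
      split_ifs
      · refine tensorPart_le fun m x S e h0 hS hS0 hc hM hA => ?_
        refine word_mem_weightA ?_ e h0
        rw [← hc]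
        refine isHomogeneous_of_finset hS hM fun i hi hiS => ?_
        by_cases hi0 : i = 0
        · rwa [hi0]
        · exact hA i hi hi0 hiS
      · exact bot_le
    · rcases h.exists_finset with hz | ⟨S, hS, hc, hM, hA⟩
      · rw [hz, map_zero]; exact zero_mem _
      · by_cases h0S : 0 ∈ S
        · rw [word_eq_zero (Nat.zero_le _) (eq_zero_of_mem h0 (hM 0 h0S)), map_zero]
          exact zero_mem _
        · have h2 := Finset.erase_eq_of_notMem h0S
          have h1 : S.card ≤ m := by
            have : S ⊆ (Finset.range (m + 1)).erase 0 := fun i hi =>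
              Finset.mem_erase.2 ⟨fun e => h0S (e ▸ hi), hS hi⟩
            simpa using Finset.card_le_card this
          rw [YPart, if_pos ⟨by omega, hw⟩]
          exact word_mem_tensorPart e hS h0 (by rw [h2, hc]) hM hA
  · rw [if_neg hw, YPart, if_neg (by tauto)]

theorem mem_XPart {v w : ℤ} {x : Chains (baseSub T K)} :
    x ∈ XPart T K v w ↔ (0 ≤ w ∧ x ∈ weightM T K (v + w) (w + 1)) ∨ (w < 0 ∧ x = 0) := by
  rw [XPart_eq]
  by_cases hw : 0 ≤ w
  · simp [hw, not_lt.2 hw]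
  · simp [hw, not_le.1 hw]

theorem mem_YPart {v w : ℤ} {x : Chains (baseSub T K)} :
    x ∈ YPart T K v w ↔ (0 ≤ w ∧ x ∈ weightA T K (v + w) (w + 1)) ∨ (w < 0 ∧ x = 0) := by
  rw [YPart_eq]
  by_cases hw : 0 ≤ w
  · simp [hw, not_lt.2 hw]
  · simp [hw, not_le.1 hw]

theorem XPart_le_finChains (v w : ℤ) : XPart T K v w ≤ finChains (baseSub T K) := by
  intro x hx
  rcases mem_XPart.1 hx with ⟨-, h⟩ | ⟨-, rfl⟩
  · exact weightPart_le_finChains _ _ h.1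
  · exact zero_mem _

theorem YPart_le_finChains (v w : ℤ) : YPart T K v w ≤ finChains (baseSub T K) := by
  intro x hx
  rcases mem_YPart.1 hx with ⟨-, h⟩ | ⟨-, rfl⟩
  · exact weightPart_le_finChains _ _ h.1
  · exact zero_mem _

theorem headM_of_mem_weightM {n W : ℤ} {x : Chains (baseSub T K)} (hx : x ∈ weightM T K n W) :
    headM T K x = x := by
  have := headA_add_headM K (weightPart_le_finChains _ _ hx.1)
  rwa [LinearMap.mem_ker.1 hx.2, zero_add] at this

theorem headA_of_mem_weightA {n W : ℤ} {x : Chains (baseSub T K)} (hx : x ∈ weightA T K n W) :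
    headA T K x = x := by
  have := headA_add_headM K (weightPart_le_finChains _ _ hx.1)
  rwa [LinearMap.mem_ker.1 hx.2, add_zero] at this

/-! ### The identities on the bigraded parts -/

section Identities

variable {n W : ℤ} {x : Chains (baseSub T K)}

theorem weightM_eqOn (hW : 1 ≤ W) {N : Type*} [AddCommGroup N] [Module k N]
    {f g : Chains (baseSub T K) →ₗ[k] N}
    (h : ∀ (m i : ℕ) (w : ℕ → CleftExt T), IsLast T m i w → w 0 ∈ subM T →
      f (chain (baseSub T K) m (word k m w)) = g (chain (baseSub T K) m (word k m w)))
    (hx : x ∈ weightM T K n W) : f x = g x := by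
  refine weightM_le (Q := LinearMap.eqLocus f g) (fun m w e hw h0 => ?_) hx
  rcases hw.exists_isLast hW with hz | ⟨i, hi⟩
  · rw [hz, map_zero]; exact zero_mem _
  · exact h m i w hi h0

/-- Degree `0` need not be considered: a single factor in `A` has weight zero, so positive weight
makes it vanish. -/
theorem weightA_eqOn (hW : 1 ≤ W) {N : Type*} [AddCommGroup N] [Module k N]
    {f g : Chains (baseSub T K) →ₗ[k] N}
    (h : ∀ (m i : ℕ) (w : ℕ → CleftExt T), IsLast T (m + 1) i w → w 0 ∈ subA T →
      f (chain (baseSub T K) (m + 1) (word k (m + 1) w)) =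
        g (chain (baseSub T K) (m + 1) (word k (m + 1) w)))
    (hx : x ∈ weightA T K n W) : f x = g x := by
  refine weightA_le (Q := LinearMap.eqLocus f g) (fun m w e hw h0 => ?_) hx
  rcases hw.exists_isLast hW with hz | ⟨i, hi⟩
  · rw [hz, map_zero]; exact zero_mem _
  · cases m with
    | zero =>
      obtain rfl : i = 0 := Nat.le_zero.1 hi.le
      rw [word_eq_zero le_rfl (eq_zero_of_mem h0 hi.mem), map_zero]
      exact zero_mem _
    | succ m => exact h m i w hi h0

theorem connes_varthetaOne (hW : 1 ≤ W) (hx : x ∈ weightPart T K n W) :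
    connes _ (varthetaOne T K x) = 0 := by
  refine weightPart_le (Q := LinearMap.ker (connes _ ∘ₗ varthetaOne T K)) (fun m w e hw => ?_) hx
  rcases hw.exists_isLast hW with hz | ⟨i, hi⟩
  · rw [hz, map_zero]; exact zero_mem _
  · exact connes_varthetaOne_word K hi

theorem tOp_varthetaOne (hW : 1 ≤ W) (hx : x ∈ weightM T K n W) :
    tOp T K (varthetaOne T K x) = 0 :=
  weightM_eqOn (f := tOp T K ∘ₗ varthetaOne T K) (g := 0) hW
    (fun _ _ _ h _ => tOp_varthetaOne_word K h) hx

theorem muZeroM_varthetaOne (hW : 1 ≤ W) (hx : x ∈ weightM T K n W) :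
    muZeroM T K (varthetaOne T K x) = x :=
  weightM_eqOn (f := muZeroM T K ∘ₗ varthetaOne T K) (g := LinearMap.id) hW
    (fun _ _ _ h h0 => muZeroM_varthetaOne_word K h h0) hx

theorem muSum_varthetaOne_weightM (hW : 1 ≤ W) (hx : x ∈ weightM T K n W) :
    muSum T K (varthetaOne T K x) + varthetaOne T K (muSum T K x) = x - tOp T K x :=
  weightM_eqOn (f := muSum T K ∘ₗ varthetaOne T K + varthetaOne T K ∘ₗ muSum T K)
    (g := LinearMap.id - tOp T K) hW (fun _ _ _ h h0 => muSum_varthetaOne_of_subM K h h0) hx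

theorem rhoD_varthetaOne_weightM (hW : 1 ≤ W) (hx : x ∈ weightM T K n W) :
    rhoD T K (varthetaOne T K x) = -varthetaOne T K (rhoD' T K x) :=
  weightM_eqOn (f := rhoD T K ∘ₗ varthetaOne T K) (g := -(varthetaOne T K ∘ₗ rhoD' T K)) hW
    (fun _ _ _ h h0 => rhoD_varthetaOne_of_subM K h h0) hx

theorem muSum_varthetaOne_weightA (hW : 1 ≤ W) (hx : x ∈ weightA T K n W) :
    muSum T K (varthetaOne T K x) + varthetaOne T K (headA T K (muSum T K x)) =
      x - tOp T K x - varthetaOne T K (muZeroM T K x) :=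
  weightA_eqOn (f := muSum T K ∘ₗ varthetaOne T K + varthetaOne T K ∘ₗ headA T K ∘ₗ muSum T K)
    (g := LinearMap.id - tOp T K - varthetaOne T K ∘ₗ muZeroM T K) hW
    (fun _ _ _ h h0 => muSum_varthetaOne_of_subA K h h0) hx

theorem rhoD_varthetaOne_weightA (hW : 1 ≤ W) (hx : x ∈ weightA T K n W) :
    rhoD T K (varthetaOne T K x) = -varthetaOne T K (rhoD T K x) :=
  weightA_eqOn (f := rhoD T K ∘ₗ varthetaOne T K) (g := -(varthetaOne T K ∘ₗ rhoD T K)) hW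
    (fun _ _ _ h h0 => rhoD_varthetaOne_of_subA K h h0) hx

/-- A word of weight `w + 1` has `w + 1` rotations that start with a factor in `M`, and `N` has as
many summands; `sum_varthetaOne_tOp_pow` then assembles all rotations. -/
theorem varthetaOne_normOp {w : ℤ} (hw : 0 ≤ w) (hx : x ∈ weightM T K n (w + 1)) :
    varthetaOne T K (normOp T K w x) = connes _ x := by
  refine weightM_le (Q := LinearMap.eqLocus (varthetaOne T K ∘ₗ normOp T K w) (connes _))
    (fun m y e hy h0 => ?_) hx
  rcases hy.exists_finset with hz | ⟨S, hS, hc, hM, hA⟩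
  · rw [hz, map_zero]; exact zero_mem _
  · by_cases h0S : 0 ∈ S
    · have := sum_varthetaOne_tOp_pow (n := m) (w := y) K (fun i => i ∈ S) (fun r _ => hM r) hA h0S
      rw [Finset.filter_mem_eq_inter, Finset.inter_eq_right.2 hS,
        show S.card = w.toNat + 1 by omega] at this
      rw [LinearMap.mem_eqLocus, LinearMap.comp_apply, normOp, LinearMap.sum_apply, map_sum, this]
    · rw [word_eq_zero (Nat.zero_le _) (eq_zero_of_mem (hA 0 (Nat.zero_le _) h0S) h0), map_zero]
      exact zero_mem _

end Identities

end Parts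

/-! ### Transfer of structure along an embedding -/

namespace DoubleMixedDiagram

variable {k : Type u} [CommRing k] {V : Type w} [AddCommGroup V] [Module k V]
  {V' : Type w} [AddCommGroup V'] [Module k V'] {D : DoubleMixedDiagram k V}
  {D' : DoubleMixedDiagram k V'} {f : ℤ → ℤ → V →ₗ[k] V'} {g : ℤ → ℤ → V' →ₗ[k] V}

/-- A diagram that embeds into a double mixed complex is a double mixed complex. -/
theorem IsDoubleMixedComplex.of_injective (h : D'.IsDoubleMixedComplex) (hf : IsHom D D' f)
    (hinj : ∀ v w, ∀ x ∈ D.X v w, f v w x = 0 → x = 0)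
    (b_mem : ∀ {v v' : ℤ} (w : ℤ), v' + 1 = v → ∀ x ∈ D.X v w, D.b v w x ∈ D.X v' w)
    (β_mem : ∀ (v : ℤ) {w w' : ℤ}, w' + 1 = w → ∀ x ∈ D.X v w, D.β v w x ∈ D.X v w')
    (B_mem : ∀ {v v' : ℤ} (w : ℤ), v + 1 = v' → ∀ x ∈ D.X v w, D.B v w x ∈ D.X v' w) :
    D.IsDoubleMixedComplex where
  b_mem := b_mem
  β_mem := β_mem
  B_mem := B_mem
  b_b {v v'} w e x hx := by
    have m1 := b_mem w e x hx
    refine hinj (v' - 1) w _ (b_mem w (by lia) _ m1) ?_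
    rw [← hf.comm_b w (by lia) _ m1, ← hf.comm_b w e x hx]
    exact h.b_b w e _ (hf.mem _ _ _ hx)
  β_β v {w w'} e x hx := by
    have m1 := β_mem v e x hx
    refine hinj v (w' - 1) _ (β_mem v (by lia) _ m1) ?_
    rw [← hf.comm_β v (by lia) _ m1, ← hf.comm_β v e x hx]
    exact h.β_β v e _ (hf.mem _ _ _ hx)
  B_B {v v'} w e x hx := by
    have m1 := B_mem w e x hx
    refine hinj (v' + 1) w _ (B_mem w rfl _ m1) ?_
    rw [← hf.comm_B w rfl _ m1, ← hf.comm_B w e x hx]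
    exact h.B_B w e _ (hf.mem _ _ _ hx)
  β_b {v v' w w'} e e' x hx := by
    have m1 := b_mem w e x hx
    have m2 := β_mem v e' x hx
    refine hinj v' w' _ (add_mem (β_mem v' e' _ m1) (b_mem w' e _ m2)) ?_
    rw [map_add, ← hf.comm_β v' e' _ m1, ← hf.comm_b w' e _ m2, ← hf.comm_b w e x hx,
      ← hf.comm_β v e' x hx]
    exact h.β_b e e' _ (hf.mem _ _ _ hx)
  β_B {v v' w w'} e e' x hx := by
    have m1 := B_mem w e x hx
    have m2 := β_mem v e' x hx
    refine hinj v' w' _ (add_mem (β_mem v' e' _ m1) (B_mem w' e _ m2)) ?_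
    rw [map_add, ← hf.comm_β v' e' _ m1, ← hf.comm_B w' e _ m2, ← hf.comm_B w e x hx,
      ← hf.comm_β v e' x hx]
    exact h.β_B e e' _ (hf.mem _ _ _ hx)
  b_B {v₁ v v₂} w e e' x hx := by
    have m1 := B_mem w e' x hx
    have m2 := b_mem w e x hx
    refine hinj v w _ (add_mem (b_mem w e' _ m1) (B_mem w e _ m2)) ?_
    rw [map_add, ← hf.comm_b w e' _ m1, ← hf.comm_B w e _ m2, ← hf.comm_B w e' x hx,
      ← hf.comm_b w e x hx]
    exact h.b_B w e e' _ (hf.mem _ _ _ hx)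

/-- A homotopy inverse of an embedding is a morphism. -/
theorem IsHom.of_isHomotopy (h : D'.IsDoubleMixedComplex) (hD : D.IsDoubleMixedComplex)
    (hf : IsHom D D' f) (hinj : ∀ v w, ∀ x ∈ D.X v w, f v w x = 0 → x = 0)
    (hg : ∀ v w, ∀ x ∈ D'.X v w, g v w x ∈ D.X v w) {s : ℤ → ℤ → V' →ₗ[k] V'}
    (hs : D'.IsHomotopy (fun v w => f v w ∘ₗ g v w) s) : IsHom D' D g where
  mem := hg
  comm_b {v v'} w e x hx := by
    have m1 := hg v w x hx
    have m2 := h.b_mem w e x hx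
    have m3 := hs.mem (v' := v + 1) w rfl x hx
    refine sub_eq_zero.1 (hinj v' w _ (sub_mem (hD.b_mem w e _ m1) (hg _ _ _ m2)) ?_)
    have e1 := hs.comm_b w e rfl x hx
    have e2 := hs.comm_b (v₁ := v' - 1) w (by lia) e _ m2
    have e3 := congrArg (D'.b v w) e1
    -- Because `b` squares to zero, `b` of the homotopy identity at `x` and the homotopy identity at
    -- `b x` both have left side `b s b x`. So `b` commutes with `f g`, and `f` can be cancelled.
    have e4 := h.b_b w rfl _ m3
    have e5 := h.b_b w e x hx
    simp only [LinearMap.comp_apply, map_add, map_sub] at e1 e2 e3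
    rw [e4, zero_add] at e3
    rw [e5, map_zero, add_zero] at e2
    rw [map_sub, ← hf.comm_b w e _ m1]
    rw [e3] at e2
    have := sub_right_injective e2
    rw [this, sub_self]
  comm_β v {w w'} e x hx := by
    have m1 := hg v w x hx
    have m2 := h.β_mem v e x hx
    have m3 := hs.mem (v' := v + 1) w rfl x hx
    have m4 := h.b_mem (v' := v - 1) w (by lia) x hx
    refine sub_eq_zero.1 (hinj v w' _ (sub_mem (hD.β_mem v e _ m1) (hg _ _ _ m2)) ?_)
    have e1 := congrArg (D'.β v w) (hs.comm_b (v₁ := v - 1) w (by lia) rfl x hx)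
    have e2 := hs.comm_b (v₁ := v - 1) w' (by lia) rfl _ m2
    have e3 := h.β_b rfl e _ m3
    have e4 := hs.comm_β (v' := v) (by lia) e _ m4
    have e5 := congrArg (D'.b (v + 1) w') (hs.comm_β rfl e x hx)
    have e6 := congrArg (s (v - 1) w') (h.β_b (v' := v - 1) (by lia) e x hx)
    simp only [LinearMap.comp_apply, map_add, map_sub, map_zero] at e1 e2 e5 e6
    rw [map_sub, ← hf.comm_β v e _ m1]
    -- The operator `β` anticommutes with `b` and with `s`, so it commutes with `b s + s b`, which
    -- is the identity minus `f g`. The argument for `B` below is the same.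
    linear_combination (norm := module) e1 - e2 - e3 - e4 + e5 + e6
  comm_B {v v'} w e x hx := by
    have m1 := hg v w x hx
    have m2 := h.B_mem w e x hx
    have m3 := hs.mem w e x hx
    have m4 := h.b_mem (v' := v - 1) w (by lia) x hx
    refine sub_eq_zero.1 (hinj v' w _ (sub_mem (hD.B_mem w e _ m1) (hg _ _ _ m2)) ?_)
    have e1 := congrArg (D'.B v w) (hs.comm_b (v₁ := v - 1) w (by lia) e x hx)
    have e2 := hs.comm_b (v₂ := v' + 1) w e rfl _ m2
    have e3 := h.b_B (v₂ := v' + 1) w e rfl _ m3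
    have e4 := hs.comm_B (v' := v) w (by lia) _ m4
    have e5 := congrArg (D'.b (v' + 1) w) (hs.comm_B w e x hx)
    have e6 := congrArg (s v w) (h.b_B (v₁ := v - 1) w (by lia) e x hx)
    simp only [LinearMap.comp_apply, map_add, map_sub, map_zero] at e1 e2 e5 e6
    rw [map_sub, ← hf.comm_B w e _ m1]
    linear_combination (norm := module) e1 - e2 - e3 - e4 + e5 + e6

end DoubleMixedDiagram

/-! ### The double mixed complexes and their comparison -/

section Complexes

open MulOpposite CleftExt

variable {k : Type u} {A : Type v} {M : Type w} [CommRing k] [Ring A] [Algebra k A]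
  [AddCommGroup M] [Module k M] [Module A M] [Module Aᵐᵒᵖ M]
  [SMulCommClass A Aᵐᵒᵖ M] [IsScalarTower k A M] [IsScalarTower k Aᵐᵒᵖ M]
variable (T : AssocBimoduleMap k A M) (K : Subalgebra k A)

variable {T K} in
theorem mem_XPart_of_nonneg {v w : ℤ} (hw : 0 ≤ w) {x : Chains (baseSub T K)} :
    x ∈ XPart T K v w ↔ x ∈ weightM T K (v + w) (w + 1) := by
  rw [XPart_eq, if_pos hw]

variable {T K} in
theorem mem_YPart_of_nonneg {v w : ℤ} (hw : 0 ≤ w) {x : Chains (baseSub T K)} :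
    x ∈ YPart T K v w ↔ x ∈ weightA T K (v + w) (w + 1) := by
  rw [YPart_eq, if_pos hw]

variable {T K} in
theorem eq_zero_of_mem_XPart {v w : ℤ} (hw : w < 0) {x : Chains (baseSub T K)}
    (hx : x ∈ XPart T K v w) : x = 0 := by
  rwa [XPart_eq, if_neg (not_le.2 hw)] at hx

variable {T K} in
theorem eq_zero_of_mem_YPart {v w : ℤ} (hw : w < 0) {x : Chains (baseSub T K)}
    (hx : x ∈ YPart T K v w) : x = 0 := by
  rwa [YPart_eq, if_neg (not_le.2 hw)] at hx

theorem muSum_mem_XPart {v v' w : ℤ} (e : v' + 1 = v) {x : Chains (baseSub T K)}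
    (hx : x ∈ XPart T K v w) : muSum T K x ∈ XPart T K v' w := by
  rcases le_or_gt 0 w with hw | hw
  · rw [mem_XPart_of_nonneg hw] at hx ⊢
    exact muSum_mem_weightM (by lia) hx
  · rw [eq_zero_of_mem_XPart hw hx, map_zero]
    exact zero_mem _

theorem rhoD_mem_XPart {v w w' : ℤ} (e : w' + 1 = w) {x : Chains (baseSub T K)}
    (hx : x ∈ XPart T K v w) : rhoD T K x ∈ XPart T K v w' := by
  rcases lt_trichotomy w 0 with hw | rfl | hw
  · rw [eq_zero_of_mem_XPart hw hx, map_zero]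
    exact zero_mem _
  -- In row `0` the target part is zero, so membership amounts to the vanishing of `d` in weight
  -- one.
  · rw [rhoD_eq_zero ((mem_XPart_of_nonneg le_rfl).1 hx).1]
    exact zero_mem _
  · rw [mem_XPart_of_nonneg hw.le] at hx
    rw [mem_XPart_of_nonneg (by lia)]
    exact rhoD_mem_weightM (by lia) (by lia) hx

theorem rhoD'_mem_XPart {v w w' : ℤ} (e : w' + 1 = w) {x : Chains (baseSub T K)}
    (hx : x ∈ XPart T K v w) : rhoD' T K x ∈ XPart T K v w' := by
  rcases lt_trichotomy w 0 with hw | rfl | hw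
  · rw [eq_zero_of_mem_XPart hw hx, map_zero]
    exact zero_mem _
  · rw [rhoD'_eq_zero ((mem_XPart_of_nonneg le_rfl).1 hx).1]
    exact zero_mem _
  · rw [mem_XPart_of_nonneg hw.le] at hx
    rw [mem_XPart_of_nonneg (by lia)]
    exact rhoD'_mem_weightM (by lia) (by lia) hx

theorem rhoD_mem_YPart {v w w' : ℤ} (e : w' + 1 = w) {x : Chains (baseSub T K)}
    (hx : x ∈ YPart T K v w) : rhoD T K x ∈ YPart T K v w' := by
  rcases lt_trichotomy w 0 with hw | rfl | hw
  · rw [eq_zero_of_mem_YPart hw hx, map_zero]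
    exact zero_mem _
  · rw [rhoD_eq_zero ((mem_YPart_of_nonneg le_rfl).1 hx).1]
    exact zero_mem _
  · rw [mem_YPart_of_nonneg hw.le] at hx
    rw [mem_YPart_of_nonneg (by lia)]
    exact rhoD_mem_weightA (by lia) (by lia) hx

theorem headM_of_mem_XPart {v w : ℤ} {x : Chains (baseSub T K)} (hx : x ∈ XPart T K v w) :
    headM T K x = x := by
  rcases le_or_gt 0 w with hw | hw
  · exact headM_of_mem_weightM ((mem_XPart_of_nonneg hw).1 hx)
  · rw [eq_zero_of_mem_XPart hw hx, map_zero]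

theorem headA_of_mem_XPart {v w : ℤ} {x : Chains (baseSub T K)} (hx : x ∈ XPart T K v w) :
    headA T K x = 0 := by
  rcases le_or_gt 0 w with hw | hw
  · exact ((mem_XPart_of_nonneg hw).1 hx).2
  · rw [eq_zero_of_mem_XPart hw hx, map_zero]

theorem headA_of_mem_YPart {v w : ℤ} {x : Chains (baseSub T K)} (hx : x ∈ YPart T K v w) :
    headA T K x = x := by
  rcases le_or_gt 0 w with hw | hw
  · exact headA_of_mem_weightA ((mem_YPart_of_nonneg hw).1 hx)
  · rw [eq_zero_of_mem_YPart hw hx, map_zero]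

theorem headM_of_mem_YPart {v w : ℤ} {x : Chains (baseSub T K)} (hx : x ∈ YPart T K v w) :
    headM T K x = 0 := by
  rcases le_or_gt 0 w with hw | hw
  · exact ((mem_YPart_of_nonneg hw).1 hx).2
  · rw [eq_zero_of_mem_YPart hw hx, map_zero]

theorem varthetaOne_mem_YPart {v v' w : ℤ} (e : v + 1 = v') {x : Chains (baseSub T K)}
    (hx : x ∈ XPart T K v w ∨ x ∈ YPart T K v w) : varthetaOne T K x ∈ YPart T K v' w := by
  rcases le_or_gt 0 w with hw | hw
  · rw [mem_XPart_of_nonneg hw, mem_YPart_of_nonneg hw] at hx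
    rw [mem_YPart_of_nonneg hw]
    exact varthetaOne_mem_weightA (n := v + w) (by lia) (by lia) (hx.elim (·.1) (·.1))
  · have : x = 0 := hx.elim (eq_zero_of_mem_XPart hw) (eq_zero_of_mem_YPart hw)
    rw [this, map_zero]
    exact zero_mem _

theorem tOp_mem_XPart {v w : ℤ} {x : Chains (baseSub T K)}
    (hx : x ∈ XPart T K v w ∨ x ∈ YPart T K v w) : tOp T K x ∈ XPart T K v w := by
  rcases le_or_gt 0 w with hw | hw
  · rw [mem_XPart_of_nonneg hw, mem_YPart_of_nonneg hw] at hx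
    rw [mem_XPart_of_nonneg hw]
    exact tOp_mem_weightM (by lia) (hx.elim (·.1) (·.1))
  · have : x = 0 := hx.elim (eq_zero_of_mem_XPart hw) (eq_zero_of_mem_YPart hw)
    rw [this, map_zero]
    exact zero_mem _

theorem normOp_mem_XPart {v w : ℤ} (r : ℤ) {x : Chains (baseSub T K)} (hx : x ∈ XPart T K v w) :
    normOp T K r x ∈ XPart T K v w := by
  rcases le_or_gt 0 w with hw | hw
  · rw [mem_XPart_of_nonneg hw] at hx ⊢
    exact normOp_mem_weightM r (by lia) hx
  · rw [eq_zero_of_mem_XPart hw hx, map_zero]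
    exact zero_mem _

theorem muZeroM_mem_XPart {v v' w : ℤ} (e : v' + 1 = v) {x : Chains (baseSub T K)}
    (hx : x ∈ YPart T K v w) : muZeroM T K x ∈ XPart T K v' w := by
  rcases le_or_gt 0 w with hw | hw
  · rw [mem_XPart_of_nonneg hw]
    exact muZeroM_mem_weightM (by lia) ((mem_YPart_of_nonneg hw).1 hx).1
  · rw [eq_zero_of_mem_YPart hw hx, map_zero]
    exact zero_mem _

theorem connes_mem_YPart {v v' w : ℤ} (e : v + 1 = v') {x : Chains (baseSub T K)}
    (hx : x ∈ XPart T K v w ∨ x ∈ YPart T K v w) : connes _ x ∈ YPart T K v' w := by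
  rcases le_or_gt 0 w with hw | hw
  · rw [mem_XPart_of_nonneg hw, mem_YPart_of_nonneg hw] at hx
    rw [mem_YPart_of_nonneg hw]
    exact connes_mem_weightA (n := v + w) (by lia) (hx.elim (·.1) (·.1))
  · have : x = 0 := hx.elim (eq_zero_of_mem_XPart hw) (eq_zero_of_mem_YPart hw)
    rw [this, map_zero]
    exact zero_mem _

theorem headM_muSum_mem_XPart {v v' w : ℤ} (e : v' + 1 = v) {x : Chains (baseSub T K)}
    (hx : x ∈ YPart T K v w) : headM T K (muSum T K x) ∈ XPart T K v' w := by
  rcases le_or_gt 0 w with hw | hw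
  · rw [mem_XPart_of_nonneg hw]
    exact headM_mem_weightM (muSum_mem_weightPart (by lia) ((mem_YPart_of_nonneg hw).1 hx).1)
  · rw [eq_zero_of_mem_YPart hw hx, map_zero, map_zero]
    exact zero_mem _

theorem headA_muSum_mem_YPart {v v' w : ℤ} (e : v' + 1 = v) {x : Chains (baseSub T K)}
    (hx : x ∈ YPart T K v w) : headA T K (muSum T K x) ∈ YPart T K v' w := by
  rcases le_or_gt 0 w with hw | hw
  · rw [mem_YPart_of_nonneg hw]
    exact headA_mem_weightA (muSum_mem_weightPart (by lia) ((mem_YPart_of_nonneg hw).1 hx).1)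
  · rw [eq_zero_of_mem_YPart hw hx, map_zero, map_zero]
    exact zero_mem _

/-! ### The canonical double mixed complex -/

/-- All chains of finite support, with the operators `b`, `d` and `B`. -/
def flatDiagram : DoubleMixedDiagram k (Chains (baseSub T K)) where
  X _ _ := finChains (baseSub T K)
  b _ _ := muSum T K
  β _ _ := rhoD T K
  B _ _ := connes _

/-- The same ambient module stands in every bidegree, so the relations between $b$, $d$ and $B$ need
no case distinction by weight or leading factor. -/
theorem isDoubleMixedComplex_flatDiagram : (flatDiagram T K).IsDoubleMixedComplex where
  b_mem _ _ _ hx := (isBoundary_muSum T K).chain_mem hx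
  β_mem _ _ _ _ _ hx := (isBoundary_rhoD T K).chain_mem hx
  B_mem _ _ _ hx := connes_mem hx
  b_b _ _ _ hx := muSum_muSum T K hx
  β_β _ _ _ _ _ hx := rhoD_rhoD T K hx
  B_B _ _ _ hx := connes_connes hx
  β_b _ _ _ hx := rhoD_muSum T K hx
  β_B _ _ _ hx := rhoD_connes T K hx
  b_B _ _ _ _ hx := muSum_connes T K hx

/-- The sum of the two components. -/
def sumMap (_v _w : ℤ) : Chains (baseSub T K) × Chains (baseSub T K) →ₗ[k] Chains (baseSub T K) :=
  LinearMap.id.coprod LinearMap.id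

theorem sumMap_apply (v w : ℤ) (z : Chains (baseSub T K) × Chains (baseSub T K)) :
    sumMap T K v w z = z.1 + z.2 := rfl

theorem mem_canonicalHat {v w : ℤ} {z : Chains (baseSub T K) × Chains (baseSub T K)} :
    z ∈ (canonicalHat T K).X v w ↔ z.1 ∈ XPart T K v w ∧ z.2 ∈ YPart T K v w := Iff.rfl

theorem mem_XHat {v w : ℤ} {z : Chains (baseSub T K) × Chains (baseSub T K)} :
    z ∈ (XHat T K).X v w ↔ z.1 ∈ XPart T K v w ∧ z.2 ∈ XPart T K (v - 1) w := Iff.rfl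

theorem canonicalHat_b (v w : ℤ) (z : Chains (baseSub T K) × Chains (baseSub T K)) :
    (canonicalHat T K).b v w z =
      (muSum T K z.1 + headM T K (muSum T K z.2), headA T K (muSum T K z.2)) := rfl

theorem canonicalHat_β (v w : ℤ) (z : Chains (baseSub T K) × Chains (baseSub T K)) :
    (canonicalHat T K).β v w z = (rhoD T K z.1, rhoD T K z.2) := rfl

theorem canonicalHat_B (v w : ℤ) (z : Chains (baseSub T K) × Chains (baseSub T K)) :
    (canonicalHat T K).B v w z = (0, connes _ z.1 + connes _ z.2) := rfl

theorem XHat_b (v w : ℤ) (z : Chains (baseSub T K) × Chains (baseSub T K)) :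
    (XHat T K).b v w z = (muSum T K z.1 + (z.2 - tOp T K z.2), -muSum T K z.2) := rfl

theorem XHat_β (v w : ℤ) (z : Chains (baseSub T K) × Chains (baseSub T K)) :
    (XHat T K).β v w z = (rhoD T K z.1, -rhoD' T K z.2) := rfl

theorem XHat_B (v w : ℤ) (z : Chains (baseSub T K) × Chains (baseSub T K)) :
    (XHat T K).B v w z = (0, normOp T K w z.1) := rfl

theorem thetaHat_apply (v w : ℤ) (z : Chains (baseSub T K) × Chains (baseSub T K)) :
    thetaHat T K v w z = (z.1 + tOp T K z.2, muZeroM T K z.2) := rfl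

theorem varthetaHat_apply (v w : ℤ) (z : Chains (baseSub T K) × Chains (baseSub T K)) :
    varthetaHat T K v w z = (z.1, varthetaOne T K z.2) := rfl

theorem eq_zero_of_sumMap_eq_zero {v w : ℤ} {z : Chains (baseSub T K) × Chains (baseSub T K)}
    (hz : z ∈ (canonicalHat T K).X v w) (h : z.1 + z.2 = 0) : z = 0 := by
  have h1 := congrArg (headM T K) h
  have h2 := congrArg (headA T K) h
  rw [map_add, headM_of_mem_XPart T K hz.1, headM_of_mem_YPart T K hz.2, map_zero, add_zero] at h1
  rw [map_add, headA_of_mem_XPart T K hz.1, headA_of_mem_YPart T K hz.2, map_zero, zero_add] at h2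
  exact Prod.ext h1 h2

/-- The two components of $\hat{\mathfrak b}$ on tensors that start in `A` are the two head
projections of the same element $\sum_j\mu_j(y)$, so adding the components recovers it. -/
theorem isHom_sumMap :
    DoubleMixedDiagram.IsHom (canonicalHat T K) (flatDiagram T K) (sumMap T K) where
  mem v w z hz := add_mem (XPart_le_finChains _ _ hz.1) (YPart_le_finChains _ _ hz.2)
  comm_b w _ z hz := by
    rw [sumMap_apply, sumMap_apply, canonicalHat_b, add_assoc, add_comm (headM _ _ _),
      headA_add_headM K ((isBoundary_muSum T K).chain_mem (YPart_le_finChains _ _ hz.2))]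
    exact map_add _ _ _
  comm_β _ _ _ _ z _ := map_add (rhoD T K) z.1 z.2
  comm_B w _ z _ := by
    rw [sumMap_apply, sumMap_apply, canonicalHat_B, zero_add]
    exact map_add _ _ _

theorem isDoubleMixedComplex_canonicalHat : (canonicalHat T K).IsDoubleMixedComplex :=
  (isDoubleMixedComplex_flatDiagram T K).of_injective (isHom_sumMap T K)
    (fun _ _ _ hz h => eq_zero_of_sumMap_eq_zero T K hz h)
    (fun _ e _ hz => ⟨add_mem (muSum_mem_XPart T K e hz.1) (headM_muSum_mem_XPart T K e hz.2),
      headA_muSum_mem_YPart T K e hz.2⟩)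
    (fun _ _ _ e _ hz => ⟨rhoD_mem_XPart T K e hz.1, rhoD_mem_YPart T K e hz.2⟩)
    (fun _ e _ hz => ⟨zero_mem _, add_mem (connes_mem_YPart T K e (Or.inl hz.1))
      (connes_mem_YPart T K e (Or.inr hz.2))⟩)

/-! ### The comparison maps -/

theorem thetaHat_varthetaHat (v w : ℤ) (z : Chains (baseSub T K) × Chains (baseSub T K))
    (hz : z ∈ (XHat T K).X v w) : thetaHat T K v w (varthetaHat T K v w z) = z := by
  rw [mem_XHat] at hz
  rw [varthetaHat_apply, thetaHat_apply]
  rcases le_or_gt 0 w with hw | hw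
  · have h2 := (mem_XPart_of_nonneg hw).1 hz.2
    rw [tOp_varthetaOne (by lia) h2, muZeroM_varthetaOne (by lia) h2, add_zero]
  · have h2 := eq_zero_of_mem_XPart hw hz.2
    exact Prod.ext (by simp [h2]) (by simp [h2])

theorem isHom_varthetaHat :
    DoubleMixedDiagram.IsHom (XHat T K) (canonicalHat T K) (varthetaHat T K) where
  mem v w z hz := ⟨hz.1, varthetaOne_mem_YPart T K (by lia) (Or.inl hz.2)⟩
  comm_b {v v'} w e z hz := by
    rw [mem_XHat] at hz
    rw [varthetaHat_apply, varthetaHat_apply, canonicalHat_b, XHat_b]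
    -- This splits $b\vartheta(y)$ by its leading factor: $y-t(y)$ has it in `M` and $\vartheta(by)$
    -- has it in `A`. The two pieces are the two components of $\hat\vartheta\hat b(0,y)$.
    have h : muSum T K (varthetaOne T K z.2) =
        (z.2 - tOp T K z.2) + -varthetaOne T K (muSum T K z.2) := by
      rcases le_or_gt 0 w with hw | hw
      · rw [← muSum_varthetaOne_weightM (by lia) ((mem_XPart_of_nonneg hw).1 hz.2),
          add_neg_cancel_right]
      · simp [eq_zero_of_mem_XPart hw hz.2]
    have m1 := sub_mem hz.2 (tOp_mem_XPart T K (Or.inl hz.2))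
    have m2 := varthetaOne_mem_YPart T K (v' := v') (by lia)
      (Or.inl (muSum_mem_XPart T K (v' := v' - 1) (by lia) hz.2))
    simp only [h, map_add, map_neg, headM_of_mem_XPart T K m1, headM_of_mem_YPart T K m2,
      headA_of_mem_XPart T K m1, headA_of_mem_YPart T K m2, neg_zero, add_zero, zero_add]
  comm_β v {w w'} e z hz := by
    rw [mem_XHat] at hz
    rw [varthetaHat_apply, varthetaHat_apply, canonicalHat_β, XHat_β, map_neg]
    rcases le_or_gt 0 w with hw | hw
    · rw [rhoD_varthetaOne_weightM (by lia) ((mem_XPart_of_nonneg hw).1 hz.2)]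
    · simp [eq_zero_of_mem_XPart hw hz.2]
  comm_B {v v'} w e z hz := by
    rw [mem_XHat] at hz
    rw [varthetaHat_apply, varthetaHat_apply, canonicalHat_B, XHat_B]
    rcases le_or_gt 0 w with hw | hw
    · rw [varthetaOne_normOp hw ((mem_XPart_of_nonneg hw).1 hz.1),
        connes_varthetaOne (by lia) ((mem_XPart_of_nonneg hw).1 hz.2).1, add_zero]
    · simp [eq_zero_of_mem_XPart hw hz.2, eq_zero_of_mem_XPart hw hz.1]

theorem eq_zero_of_varthetaHat_eq_zero (v w : ℤ)
    (z : Chains (baseSub T K) × Chains (baseSub T K)) (hz : z ∈ (XHat T K).X v w)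
    (h : varthetaHat T K v w z = 0) : z = 0 := by
  rw [← thetaHat_varthetaHat T K v w z hz, h, map_zero]

/-- Since $\hat\vartheta$ is injective and compatible with all operators, the relations among $b$,
$d$, $d'$, $t$ and $N$ follow from those of the canonical complex and need no direct verification.
-/
theorem isDoubleMixedComplex_XHat : (XHat T K).IsDoubleMixedComplex :=
  (isDoubleMixedComplex_canonicalHat T K).of_injective (isHom_varthetaHat T K)
    (eq_zero_of_varthetaHat_eq_zero T K)
    (fun {v v'} w e z hz => by
      obtain rfl : v - 1 = v' := by lia
      exact ⟨add_mem (muSum_mem_XPart T K e hz.1)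
        (sub_mem hz.2 (tOp_mem_XPart T K (Or.inl hz.2))),
        neg_mem (muSum_mem_XPart T K (by lia) hz.2)⟩)
    (fun _ _ _ e _ hz => ⟨rhoD_mem_XPart T K e hz.1, neg_mem (rhoD'_mem_XPart T K e hz.2)⟩)
    (fun {v v'} w e z hz => by
      obtain rfl : v = v' - 1 := by lia
      exact ⟨zero_mem _, normOp_mem_XPart T K _ hz.1⟩)

/-- The homotopy `(x, y) ↦ (0, ∑_l 1 ⊗ 𝔱 ^ l (y))`. -/
def homotopyHat (_v _w : ℤ) : Chains (baseSub T K) × Chains (baseSub T K) →ₗ[k]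
    Chains (baseSub T K) × Chains (baseSub T K) :=
  LinearMap.prod 0 (varthetaOne T K ∘ₗ LinearMap.snd k _ _)

theorem homotopyHat_apply (v w : ℤ) (z : Chains (baseSub T K) × Chains (baseSub T K)) :
    homotopyHat T K v w z = (0, varthetaOne T K z.2) := rfl

theorem isHomotopy_homotopyHat : (canonicalHat T K).IsHomotopy
    (fun v w => varthetaHat T K v w ∘ₗ thetaHat T K v w) (homotopyHat T K) where
  mem w e z hz := ⟨zero_mem _, varthetaOne_mem_YPart T K e (Or.inr hz.2)⟩
  comm_b {v₁ v v₂} w e e' z hz := by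
    rw [mem_canonicalHat] at hz
    rw [homotopyHat_apply, homotopyHat_apply, LinearMap.comp_apply, thetaHat_apply,
      varthetaHat_apply, canonicalHat_b, canonicalHat_b]
    -- The `M`-head of the right side is $-t(y)$, the rest has its head in `A`. So the homotopy
    -- formula yields $(-t(y),\,y-\vartheta\mu_0^M(y))$, which is the identity minus
    -- $\hat\vartheta\hat\theta$ at $(x,y)$.
    have h : muSum T K (varthetaOne T K z.2) = z.2 - tOp T K z.2 -
        varthetaOne T K (muZeroM T K z.2) - varthetaOne T K (headA T K (muSum T K z.2)) := by
      rcases le_or_gt 0 w with hw | hw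
      · rw [← muSum_varthetaOne_weightA (by lia) ((mem_YPart_of_nonneg hw).1 hz.2),
          add_sub_cancel_right]
      · simp [eq_zero_of_mem_YPart hw hz.2]
    have m1 := tOp_mem_XPart T K (Or.inr hz.2)
    have m2 := varthetaOne_mem_YPart T K e (Or.inl (muZeroM_mem_XPart T K e hz.2))
    have m3 := varthetaOne_mem_YPart T K e (Or.inr (headA_muSum_mem_YPart T K e hz.2))
    simp only [h, map_zero, map_sub, zero_add, headM_of_mem_XPart T K m1, headM_of_mem_YPart T K m2,
      headM_of_mem_YPart T K m3, headM_of_mem_YPart T K hz.2, headA_of_mem_XPart T K m1,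
      headA_of_mem_YPart T K m2, headA_of_mem_YPart T K m3, headA_of_mem_YPart T K hz.2]
    refine Prod.ext ?_ ?_
    · simp
    · simp
  comm_β {v v' w w'} e e' z hz := by
    rw [mem_canonicalHat] at hz
    rw [homotopyHat_apply, homotopyHat_apply, canonicalHat_β, canonicalHat_β]
    rcases le_or_gt 0 w with hw | hw
    · simp [rhoD_varthetaOne_weightA (by lia) ((mem_YPart_of_nonneg hw).1 hz.2)]
    · simp [eq_zero_of_mem_YPart hw hz.2]
  comm_B {v v'} w e z hz := by
    rw [mem_canonicalHat] at hz
    rw [homotopyHat_apply, homotopyHat_apply, canonicalHat_B, canonicalHat_B]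
    have h1 := varthetaOne_connes K (XPart_le_finChains _ _ hz.1)
    have h2 := varthetaOne_connes K (YPart_le_finChains _ _ hz.2)
    have h3 : connes _ (varthetaOne T K z.2) = 0 := by
      rcases le_or_gt 0 w with hw | hw
      · exact connes_varthetaOne (by lia) ((mem_YPart_of_nonneg hw).1 hz.2).1
      · simp [eq_zero_of_mem_YPart hw hz.2]
    simp [h1, h2, h3]

/-- No formula for $\hat\theta$ beyond its degree is needed: $\hat\vartheta\hat\theta$ commutes with
the operators by the homotopy, and the injective $\hat\vartheta$ can be cancelled. -/
theorem isHom_thetaHat :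
    DoubleMixedDiagram.IsHom (canonicalHat T K) (XHat T K) (thetaHat T K) :=
  .of_isHomotopy (isDoubleMixedComplex_canonicalHat T K) (isDoubleMixedComplex_XHat T K)
    (isHom_varthetaHat T K) (eq_zero_of_varthetaHat_eq_zero T K)
    (fun v _ _ hz => ⟨add_mem hz.1 (tOp_mem_XPart T K (Or.inr hz.2)),
      muZeroM_mem_XPart T K (sub_add_cancel v 1) hz.2⟩)
    (isHomotopy_homotopyHat T K)

end Complexes

/-! ### The weight decomposition -/

section WeightProj

open MulOpposite CleftExt

variable {k : Type u} {A : Type v} {M : Type w} [CommRing k] [Ring A] [Algebra k A]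
  [AddCommGroup M] [Module k M] [Module A M] [Module Aᵐᵒᵖ M]
  [SMulCommClass A Aᵐᵒᵖ M] [IsScalarTower k A M] [IsScalarTower k Aᵐᵒᵖ M]
variable (T : AssocBimoduleMap k A M) (K : Subalgebra k A)

/-- The projection to `M` in the places of `S` and to `A` in the others. -/
def placeProj {n : ℕ} (S : Finset (Fin (n + 1))) (i : Fin (n + 1)) :
    CleftExt T →ₗ[k] CleftExt T := if i ∈ S then piM T else piA T

theorem placeProj_descends {n : ℕ} (S : Finset (Fin (n + 1))) :
    Descends (baseSub T K) (rotWord (baseSub T K) (placeProj T S) 0) := by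
  refine rotWord_descends (φ := id) (fun i => ?_) fun i hi c hc => ?_
  · unfold placeProj
    split_ifs
    exacts [isBimodMap_piM K, isBimodMap_piA K]
  · refine ⟨?_, fun h => (hi h).elim⟩
    unfold placeProj
    split_ifs
    · rw [piM_of_mem hc]
      exact zero_mem _
    · rwa [piA_of_mem hc]

/-- The projection to the part of total weight `W`. -/
def weightProj (W : ℤ) : Chains (baseSub T K) →ₗ[k] Chains (baseSub T K) :=
  preserving fun n =>
    descend (∑ S : Finset (Fin (n + 1)) with (S.card : ℤ) = W,
      rotWord (baseSub T K) (placeProj T S) 0) (Descends.sum fun S _ => placeProj_descends T K S)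

/-- The word `w` with the letters of index in `S` projected to `M` and the others to `A`. -/
def placeWord {n : ℕ} (S : Finset (Fin (n + 1))) (w : ℕ → CleftExt T) : ℕ → CleftExt T :=
  extendWord fun i : Fin (n + 1) => placeProj T S i (w i)

theorem weightProj_word (W : ℤ) (n : ℕ) (w : ℕ → CleftExt T) :
    weightProj T K W (chain (baseSub T K) n (word k n w)) =
      ∑ S : Finset (Fin (n + 1)) with (S.card : ℤ) = W,
        chain (baseSub T K) n (word k n (placeWord T S w)) := by
  rw [weightProj, preserving_chain, descend_mkQ, lift_word, sum_apply,
    ← LinearMap.single_apply (R := k), map_sum]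
  refine Finset.sum_congr rfl fun S _ => ?_
  rw [LinearMap.single_apply, rotWord_apply]
  exact single_cls n _ _ fun i => by rw [add_zero, placeWord, extendWord_val]

variable {T} in
theorem isHomogeneous_placeWord {n : ℕ} (S : Finset (Fin (n + 1))) (w : ℕ → CleftExt T) :
    IsHomogeneous T n S.card (placeWord T S w) := by
  have h : ∀ i : Fin (n + 1), placeWord T S w i = placeProj T S i (w i) := fun i => by
    rw [placeWord, extendWord_val]
  rw [← Finset.card_map Fin.valEmbedding]
  refine isHomogeneous_of_finset (fun i hi => ?_) (fun i hi => ?_) fun i hi hiS => ?_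
  · obtain ⟨j, -, rfl⟩ := Finset.mem_map.1 hi
    exact Finset.mem_range.2 j.2
  · obtain ⟨j, hj, rfl⟩ := Finset.mem_map.1 hi
    rw [Fin.valEmbedding_apply, h, placeProj, if_pos hj]
    exact piM_mem T _
  · have := h ⟨i, by omega⟩
    rw [this, placeProj, if_neg fun hj => hiS (Finset.mem_map.2 ⟨_, hj, rfl⟩)]
    exact piA_mem T _

theorem weightProj_mem {n : ℤ} (W : ℤ) {x : Chains (baseSub T K)}
    (hx : x ∈ degreePart (baseSub T K) n) : weightProj T K W x ∈ weightPart T K n W := by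
  rcases mem_degreePart_iff.1 hx with ⟨m, z, rfl, rfl⟩ | ⟨-, rfl⟩
  · rw [← Submodule.Quotient.mk_eq_zero, ← Submodule.mkQ_apply, ← LinearMap.comp_apply]
    refine chain_hom_ext (g := 0) (fun w => ?_) z
    rw [LinearMap.comp_apply, Submodule.mkQ_apply, LinearMap.zero_apply,
      Submodule.Quotient.mk_eq_zero, weightProj_word]
    refine sum_mem fun S hS => ?_
    rw [← (Finset.mem_filter.1 hS).2]
    exact (isHomogeneous_placeWord S w).mem_weightPart rfl
  · rw [map_zero]
    exact zero_mem _

/-- Expand $\bigotimes_i(\pi_M+\pi_A)(x_i)$ over the subsets of the $n+1$ places and collect the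
subsets by cardinality. -/
theorem sum_weightProj {n : ℤ} {x : Chains (baseSub T K)}
    (hx : x ∈ degreePart (baseSub T K) n) :
    ∑ W ∈ Finset.Icc 0 (n + 1), weightProj T K W x = x := by
  rcases mem_degreePart_iff.1 hx with ⟨m, z, rfl, rfl⟩ | ⟨-, rfl⟩
  · rw [← LinearMap.sum_apply]
    refine chain_hom_ext (g := LinearMap.id) (fun w => ?_) z
    rw [LinearMap.sum_apply, LinearMap.id_apply]
    simp only [weightProj_word]
    rw [Finset.sum_fiberwise_of_maps_to (s := Finset.univ)
      (g := fun S : Finset (Fin (m + 1)) => (S.card : ℤ)), ← map_sum]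
    · congr 1
      have := (PiTensorProduct.tprod k).map_add_univ (fun i : Fin (m + 1) => piM T (w i))
        (fun i => piA T (w i))
      have e : ((fun i : Fin (m + 1) => piM T (w i)) + fun i : Fin (m + 1) => piA T (w i)) =
          fun i : Fin (m + 1) => w i := funext fun i => by
        rw [Pi.add_apply, add_comm, piA_add_piM]
      rw [e] at this
      rw [word, this]
      refine Finset.sum_congr rfl fun S _ => ?_
      rw [placeWord, word_extendWord]
      congr 1
      funext i
      by_cases h : i ∈ S <;> simp [placeProj, h]
    · intro S _
      have := Finset.card_le_univ S
      rw [Fintype.card_fin] at this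
      rw [Finset.mem_Icc]
      omega
  · simp

variable {T K}

theorem word_placeWord_of_finset {n : ℕ} {w : ℕ → CleftExt T} {S : Finset ℕ}
    (hM : ∀ i ∈ S, w i ∈ subM T) (hA : ∀ i ≤ n, i ∉ S → w i ∈ subA T)
    (S' : Finset (Fin (n + 1))) :
    word k n (placeWord T S' w) =
      if S' = Finset.univ.filter (fun i : Fin (n + 1) => (i : ℕ) ∈ S) then word k n w else 0 := by
  have h : ∀ i : Fin (n + 1), placeWord T S' w i = placeProj T S' i (w i) := fun i => by
    rw [placeWord, extendWord_val]
  split_ifs with he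
  · refine word_congr fun i hi => ?_
    have h' := h ⟨i, by omega⟩
    rw [h', placeProj, he]
    simp only [Finset.mem_filter, Finset.mem_univ, true_and]
    split_ifs with hiS
    · exact piM_of_mem_subM (hM i hiS)
    · exact piA_of_mem_subA (hA i hi hiS)
  · obtain ⟨i, hi⟩ : ∃ i : Fin (n + 1), ¬(i ∈ S' ↔ (i : ℕ) ∈ S) := by
      by_contra! hc
      exact he (Finset.ext fun i => by simpa using hc i)
    refine word_eq_zero (i := i) (Nat.lt_succ_iff.1 i.2) ?_
    rw [h, placeProj]
    split_ifs with hiS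
    · exact piM_of_mem_subA (hA i (Nat.lt_succ_iff.1 i.2) fun h => hi ⟨fun _ => h, fun _ => hiS⟩)
    · exact piA_of_mem_subM (hM i (by tauto))

theorem weightProj_of_mem {n W : ℤ} (W' : ℤ) {x : Chains (baseSub T K)}
    (hx : x ∈ weightPart T K n W) : weightProj T K W' x = if W' = W then x else 0 := by
  suffices weightPart T K n W ≤
      LinearMap.eqLocus (weightProj T K W') (if W' = W then LinearMap.id else 0) by
    have h := LinearMap.mem_eqLocus.1 (this hx)
    split_ifs at h ⊢ <;> exact h
  refine weightPart_le fun m w e hw => ?_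
  rcases hw.exists_finset with hz | ⟨S, hS, hc, hM, hA⟩
  · rw [hz, map_zero]; exact zero_mem _
  · have hcard : ((Finset.univ : Finset (Fin (m + 1))).filter
        fun i : Fin (m + 1) => (i : ℕ) ∈ S).card = S.card := by
      refine Finset.card_bij (fun i _ => (i : ℕ)) (fun i hi => by simpa using hi)
        (fun i _ j _ e => Fin.ext e) fun j hj => ?_
      exact ⟨⟨j, Finset.mem_range.1 (hS hj)⟩, by simpa using hj, rfl⟩
    rw [LinearMap.mem_eqLocus, weightProj_word]
    simp only [word_placeWord_of_finset hM hA, apply_ite (chain (baseSub T K) m), map_zero]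
    rw [Finset.sum_ite_eq']
    simp only [Finset.mem_filter, Finset.mem_univ, true_and, hcard, hc]
    by_cases h : W' = W
    · simp [h]
    · rw [if_neg (Ne.symm h), if_neg h, LinearMap.zero_apply]

theorem chainsMap_proj_of_mem {n W : ℤ} (hW : 1 ≤ W) {x : Chains (baseSub T K)}
    (hx : x ∈ weightPart T K n W) : chainsMap (proj T) (map_proj_le T K) x = 0 := by
  refine weightPart_le (Q := LinearMap.ker (chainsMap (proj T) (map_proj_le T K)))
    (fun m w e hw => ?_) hx
  rw [LinearMap.mem_ker]
  rcases hw.exists_isLast hW with hz | ⟨i, hi⟩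
  · rw [hz, map_zero, map_zero]
  · rw [chainsMap_chain, word_eq_zero hi.le (i := i) (show proj T (w i) = 0 from hi.mem), map_zero]

theorem chainsMap_inl_proj_of_mem {n : ℤ} {x : Chains (baseSub T K)}
    (hx : x ∈ weightPart T K n 0) :
    chainsMap (inl T) le_rfl (chainsMap (proj T) (map_proj_le T K) x) = x := by
  refine weightPart_le (Q := LinearMap.eqLocus
    (chainsMap (inl T) (K' := baseSub T K) le_rfl ∘ₗ chainsMap (proj T) (map_proj_le T K))
    LinearMap.id) (fun m w e hw => ?_) hx
  rcases hw.exists_finset with hz | ⟨S, hS, hc, hM, hA⟩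
  · rw [hz, map_zero]; exact zero_mem _
  · obtain rfl : S = ∅ := Finset.card_eq_zero.1 (by exact_mod_cast hc)
    rw [LinearMap.mem_eqLocus, LinearMap.comp_apply, chainsMap_chain, chainsMap_chain,
      LinearMap.id_apply, word_congr fun i hi => ?_]
    exact piA_of_mem_subA (hA i hi (Finset.notMem_empty i))

/-- Applied to the weight decomposition, the projection to `A` kills all positive weights; in weight
zero it has a left inverse, induced by the inclusion of `A`. -/
theorem weightProj_zero_of_mem_ker {n : ℤ} {x : Chains (baseSub T K)}
    (hx : x ∈ degreePart (baseSub T K) n)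
    (h : chainsMap (proj T) (map_proj_le T K) x = 0) : weightProj T K 0 x = 0 := by
  have e := congrArg (chainsMap (proj T) (map_proj_le T K)) (sum_weightProj T K hx)
  rw [map_sum, h, Finset.sum_eq_single 0] at e
  · rw [← chainsMap_inl_proj_of_mem (weightProj_mem T K 0 hx), e, map_zero]
  · intro W hW h0
    rw [Finset.mem_Icc] at hW
    exact chainsMap_proj_of_mem (by omega) (weightProj_mem T K W hx)
  · intro hn
    rcases mem_degreePart_iff.1 hx with ⟨m, z, rfl, rfl⟩ | ⟨-, rfl⟩
    · exact (hn (Finset.mem_Icc.2 (by omega))).elim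
    · rw [map_zero, map_zero]

/-! ### The identification of the total complex -/

variable (T K)

theorem eq_zero_of_mem_canonicalHat {v w : ℤ} (h : ¬(0 ≤ v ∧ 0 ≤ w))
    {z : Chains (baseSub T K) × Chains (baseSub T K)} (hz : z ∈ (canonicalHat T K).X v w) :
    z = 0 := by
  rw [mem_canonicalHat, XPart, YPart, if_neg h, if_neg h] at hz
  exact Prod.ext hz.1 hz.2

theorem apply_eq_zero_of_mem_total {n : ℤ}
    {x : ℤ → Chains (baseSub T K) × Chains (baseSub T K)}
    (hx : x ∈ (canonicalHat T K).total.X n) {p : ℤ} (hp : p ∉ Finset.Icc 0 n) : x p = 0 := by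
  refine eq_zero_of_mem_canonicalHat T K ?_ (DoubleMixedDiagram.mem_total.1 hx p)
  rw [Finset.mem_Icc] at hp
  omega

theorem assemble_apply (n : ℤ) (x : ℤ → Chains (baseSub T K) × Chains (baseSub T K)) :
    assemble T K n x = ∑ p ∈ Finset.Icc 0 n, ((x p).1 + (x p).2) := by
  rw [assemble, LinearMap.sum_apply]
  rfl

theorem support_subset_of_mem_total {n : ℤ}
    {x : ℤ → Chains (baseSub T K) × Chains (baseSub T K)}
    (hx : x ∈ (canonicalHat T K).total.X n) :
    Function.support (fun p => (x p).1 + (x p).2) ⊆ Finset.Icc 0 n := by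
  intro p hp
  by_contra h
  exact hp (by simp [apply_eq_zero_of_mem_total T K hx h])

/-- A sum over all of `ℤ` can be reindexed by the column shifts of `b` and `B` without adjusting the
interval of summation, which depends on the degree. -/
theorem assemble_eq_finsum {n : ℤ} {x : ℤ → Chains (baseSub T K) × Chains (baseSub T K)}
    (hx : x ∈ (canonicalHat T K).total.X n) :
    assemble T K n x = ∑ᶠ p, ((x p).1 + (x p).2) := by
  rw [assemble_apply, finsum_eq_sum_of_support_subset _ (support_subset_of_mem_total T K hx)]

theorem add_mem_weightPart {n : ℤ} {x : ℤ → Chains (baseSub T K) × Chains (baseSub T K)}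
    (hx : x ∈ (canonicalHat T K).total.X n) {p : ℤ} (hp : p ∈ Finset.Icc 0 n) :
    (x p).1 + (x p).2 ∈ weightPart T K n (n - p + 1) := by
  have h := (mem_canonicalHat T K).1 (DoubleMixedDiagram.mem_total.1 hx p)
  rw [Finset.mem_Icc] at hp
  rw [mem_XPart_of_nonneg (by omega), mem_YPart_of_nonneg (by omega),
    show p + (n - p) = n by ring] at h
  exact add_mem h.1.1 h.2.1

/-- In total degree `n`, column `p` is the part of weight `n - p + 1`, split by the leading factor.
So the claim is that the relative complex is the direct sum of the positive weights; injectivity and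
the inverse come from `weightProj`, `headM` and `headA`. -/
theorem bijOn_assemble (n : ℤ) : Set.BijOn (assemble T K n) ((canonicalHat T K).total.X n)
    ((relativeHoch T K).X n) := by
  refine ⟨fun x hx => ?_, ?_, fun z hz => ?_⟩
  · rw [assemble_apply]
    refine ⟨sum_mem fun p hp =>
      weightPart_le_degreePart _ _ (add_mem_weightPart T K hx hp), ?_⟩
    refine sum_mem fun p hp => chainsMap_proj_of_mem ?_ (add_mem_weightPart T K hx hp)
    rw [Finset.mem_Icc] at hp
    omega
  · suffices ∀ x ∈ (canonicalHat T K).total.X n, assemble T K n x = 0 → x = 0 by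
      intro x hx y hy e
      exact sub_eq_zero.1 (this _ (sub_mem hx hy) (by rw [map_sub, e, sub_self]))
    intro x hx e
    funext p
    by_cases hp : p ∈ Finset.Icc 0 n
    · have h := congrArg (weightProj T K (n - p + 1)) e
      rw [assemble_apply, map_sum, map_zero, Finset.sum_eq_single_of_mem p hp] at h
      · rw [weightProj_of_mem _ (add_mem_weightPart T K hx hp), if_pos rfl] at h
        exact eq_zero_of_sumMap_eq_zero T K (DoubleMixedDiagram.mem_total.1 hx p) h
      · intro q hq hqp
        rw [weightProj_of_mem _ (add_mem_weightPart T K hx hq), if_neg (by omega)]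
    · exact apply_eq_zero_of_mem_total T K hx hp
  · have hz' : z ∈ degreePart (baseSub T K) n := hz.1
    refine ⟨fun p => if p ∈ Finset.Icc 0 n then (headM T K (weightProj T K (n - p + 1) z),
      headA T K (weightProj T K (n - p + 1) z)) else 0, ?_, ?_⟩
    · refine DoubleMixedDiagram.mem_total.2 fun p => ?_
      split_ifs with hp
      · rw [Finset.mem_Icc] at hp
        have h := weightProj_mem T K (n - p + 1) hz'
        rw [mem_canonicalHat, mem_XPart_of_nonneg (by omega), mem_YPart_of_nonneg (by omega),
          show p + (n - p) = n by ring]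
        exact ⟨headM_mem_weightM h, headA_mem_weightA h⟩
      · exact zero_mem _
    · have h0 := weightProj_zero_of_mem_ker hz' hz.2
      have h1 : ∑ W ∈ Finset.Icc 1 (n + 1), weightProj T K W z = z := by
        refine (Finset.sum_subset (Finset.Icc_subset_Icc_left zero_le_one) fun W hW hW' => ?_).trans
          (sum_weightProj T K hz')
        rw [Finset.mem_Icc] at hW hW'
        obtain rfl : W = 0 := by omega
        exact h0
      rw [assemble_apply]
      conv_rhs => rw [← h1]
      refine Finset.sum_bij (fun p _ => n - p + 1) ?_ ?_ ?_ ?_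
      · intro p hp
        rw [Finset.mem_Icc] at hp ⊢
        omega
      · intro p _ q _ e
        omega
      · intro W hW
        rw [Finset.mem_Icc] at hW
        exact ⟨n - W + 1, Finset.mem_Icc.2 (by omega), by omega⟩
      · intro p hp
        simp only [if_pos hp]
        rw [add_comm]
        exact headA_add_headM K (weightPart_le_finChains _ _ (weightProj_mem T K _ hz'))

theorem isHom_assemble :
    MixedDiagram.IsHom (canonicalHat T K).total (relativeHoch T K) (assemble T K) where
  mem n := (bijOn_assemble T K n).mapsTo
  comm_b {n m} e x hx := by
    have hb := (isDoubleMixedComplex_canonicalHat T K).total.b_mem e x hx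
    have hfin : ∀ p, (x p).1 + (x p).2 ∈ finChains (baseSub T K) := fun p =>
      (isHom_sumMap T K).mem _ _ _ (DoubleMixedDiagram.mem_total.1 hx p)
    rw [assemble_eq_finsum T K hb]
    have hp : ∀ p, (((canonicalHat T K).total.b n x) p).1 + (((canonicalHat T K).total.b n x) p).2 =
        muSum T K ((x (p + 1)).1 + (x (p + 1)).2) + rhoD T K ((x p).1 + (x p).2) := by
      intro p
      rw [DoubleMixedDiagram.total_b]
      have h1 := (isHom_sumMap T K).comm_b (v' := p) _ rfl _
        (DoubleMixedDiagram.mem_total.1 hx (p + 1))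
      have h2 := (isHom_sumMap T K).comm_β p (w' := n - p - 1) (by lia) _
        (DoubleMixedDiagram.mem_total.1 hx p)
      exact (map_add (sumMap T K 0 0) _ _).trans (congrArg₂ (· + ·) h1.symm h2.symm)
    simp only [hp]
    have hfs := (Finset.finite_toSet _).subset (support_subset_of_mem_total T K hx)
    have f1 : (Function.support fun p => muSum T K ((x p).1 + (x p).2)).Finite :=
      hfs.subset fun p hp h => hp (by simp only [h, map_zero])
    have f2 : (Function.support fun p => rhoD T K ((x p).1 + (x p).2)).Finite :=
      hfs.subset fun p hp h => hp (by simp only [h, map_zero])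
    -- In column `p` the total differential combines $b$ of column $p+1$ with $d$ of column $p$.
    -- After shifting the first sum, each column contributes $b+d$, the Hochschild boundary.
    rw [finsum_add_distrib (f1.preimage (f := fun p : ℤ => p + 1)
      (add_left_injective (1 : ℤ)).injOn) f2]
    have hshift := finsum_comp_equiv (Equiv.addRight (1 : ℤ))
      (f := fun p => muSum T K ((x p).1 + (x p).2))
    refine Eq.trans ?_ (congrArg (· + _) hshift.symm)
    rw [← finsum_add_distrib f1 f2, assemble_eq_finsum T K hx]
    refine ((hochB (baseSub T K)).toAddMonoidHom.map_finsum hfs).trans (finsum_congr fun p => ?_)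
    exact hochB_eq T K (hfin p)
  comm_B {n m} e x hx := by
    have hB := (isDoubleMixedComplex_canonicalHat T K).total.B_mem e x hx
    have hfs := (Finset.finite_toSet _).subset (support_subset_of_mem_total T K hx)
    rw [assemble_eq_finsum T K hB, assemble_eq_finsum T K hx]
    have hp : ∀ p, (((canonicalHat T K).total.B n x) p).1 + (((canonicalHat T K).total.B n x) p).2 =
        connes _ ((x (p - 1)).1 + (x (p - 1)).2) := by
      intro p
      rw [DoubleMixedDiagram.total_B, canonicalHat_B, zero_add, map_add]
    simp only [hp]
    have hshift := finsum_comp_equiv (Equiv.subRight (1 : ℤ))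
      (f := fun p => connes (baseSub T K) ((x p).1 + (x p).2))
    exact ((connes (baseSub T K)).toAddMonoidHom.map_finsum hfs).trans hshift.symm

end WeightProj

end

end CleftHomology

theorem mainTheorem1 {k : Type u} {A : Type v} {M : Type w} [CommRing k] [Ring A] [Algebra k A]
    [AddCommGroup M] [Module k M] [Module A M] [Module Aᵐᵒᵖ M] [SMulCommClass A Aᵐᵒᵖ M]
    [IsScalarTower k A M] [IsScalarTower k Aᵐᵒᵖ M]
    (T : AssocBimoduleMap k A M) (K : Subalgebra k A) :
    ∃ (hX : (XHat T K).IsDoubleMixedComplex)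
      (hC : (canonicalHat T K).IsDoubleMixedComplex)
      (hR : (relativeHoch T K).IsMixedComplex)
      (hϑ : DoubleMixedDiagram.IsHom (XHat T K) (canonicalHat T K) (varthetaHat T K))
      (hθ : DoubleMixedDiagram.IsHom (canonicalHat T K) (XHat T K) (thetaHat T K))
      (hΦ : MixedDiagram.IsHom (canonicalHat T K).total (relativeHoch T K) (assemble T K)),
      (∀ v w : ℤ, ∀ z ∈ (XHat T K).X v w, thetaHat T K v w (varthetaHat T K v w z) = z) ∧
      Nonempty (Homotopy
        (MixedDiagram.hochMap hC.total hX.total hθ.total ≫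
          MixedDiagram.hochMap hX.total hC.total hϑ.total)
        (𝟙 ((canonicalHat T K).total.hochChain hC.total))) ∧
      (∀ n : ℤ, Set.BijOn (assemble T K n) ((canonicalHat T K).total.X n)
        ((relativeHoch T K).X n)) ∧
      ∀ n : ℤ,
        IsIso (MixedDiagram.HHMap hX.total hC.total hϑ.total n ≫
          MixedDiagram.HHMap hC.total hR hΦ n) ∧
        IsIso (MixedDiagram.HCMap hX.total hC.total hϑ.total n ≫
          MixedDiagram.HCMap hC.total hR hΦ n) ∧
        IsIso (MixedDiagram.HPMap hX.total hC.total hϑ.total n ≫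
          MixedDiagram.HPMap hC.total hR hΦ n) ∧
        IsIso (MixedDiagram.HNMap hX.total hC.total hϑ.total n ≫
          MixedDiagram.HNMap hC.total hR hΦ n) := by
  have hX := isDoubleMixedComplex_XHat T K
  have hC := isDoubleMixedComplex_canonicalHat T K
  have hR : (relativeHoch T K).IsMixedComplex := isMixedComplex_relativeMixed _ _
  have hϑ := isHom_varthetaHat T K
  have hθ := isHom_thetaHat T K
  have hΦ := isHom_assemble T K
  have hb := bijOn_assemble T K
  have hs := (isHomotopy_homotopyHat T K).total
  have hθϑ : ∀ n, ∀ x ∈ (XHat T K).total.X n, DoubleMixedDiagram.totalMap (thetaHat T K) n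
      (DoubleMixedDiagram.totalMap (varthetaHat T K) n x) = x := fun n x hx =>
    funext fun p => thetaHat_varthetaHat T K _ _ _ (DoubleMixedDiagram.mem_total.1 hx p)
  -- On homology, the first factor is an isomorphism because $\hat\vartheta$ is a homotopy
  -- equivalence compatible with `B`, the second because `assemble` is already an isomorphism of
  -- complexes.
  have col : ∀ (P : Set ℤ) (n : ℤ), IsIso
      (HomologicalComplex.homologyMap (MixedDiagram.colMap hX.total hC.total hϑ.total P) n ≫
        HomologicalComplex.homologyMap (MixedDiagram.colMap hC.total hR hΦ P) n) := fun P n => by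
    have := MixedDiagram.isIso_homologyMap_colMap hX.total hC.total hϑ.total hθ.total hθϑ hs P n
    have := MixedDiagram.isIso_colMap hC.total hR hΦ hb P
    infer_instance
  refine ⟨hX, hC, hR, hϑ, hθ, hΦ, thetaHat_varthetaHat T K,
    hs.isChainHomotopy.nonempty_homotopy _ _ fun _ _ => rfl, hb,
    fun n => ⟨?_, col _ n, col _ n, col _ n⟩⟩
  have := MixedDiagram.isIso_homologyMap_hochMap hX.total hC.total hϑ.total hθ.total hθϑ hs n
  have := MixedDiagram.isIso_hochMap hC.total hR hΦ hb
  exact inferInstanceAs (IsIso (HomologicalComplex.homologyMap _ n ≫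
    HomologicalComplex.homologyMap _ n))
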